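/- Throughout, $\mathbb{K}$ is a field of characteristic $0$ and $\overline{\mathbf{C}}=(\mathbf{C},\perp)$ is a small orthogonal category with $\mathbf{C}\neq\emptyset$, i.e. a category with a symmetric relation $\perp$ on pairs of morphisms with common target which is stable under pre- and postcomposition. **Conventions.** An operation $\underline{f}=(f_1,\dots,f_n):(c_1,\dots,c_n)\to t$ (for $n\geq 0$) is a tuple of mutually orthogonal morphisms $f_i:c_i\to t$; these form a coloured operad $\mathcal{P}_{\overline{\mathbf{C}}}$. A *2AQFT* $\mathfrak{A}$ on $\overline{\mathbf{C}}$ is a pseudo-morphism from $\mathcal{P}_{\overline{\mathbf{C}}}$ to the operad of locally presentable $\mathbb{K}$-linear categories and functors of several variables that are $\mathbb{K}$-linear and co-continuous in each variable: it consists of locally presentable $\mathbb{K}$-linear categories $\mathfrak{A}(c)$, factorization products $\mathfrak{A}(\underline{f}):\prod_i\mathfrak{A}(c_i)\to\mathfrak{A}(t)$, and coherent natural isomorphisms for operadic composition, units and permutations. The factorization product of the empty tuple gives the pointing $\mathfrak{A}(\ast_t)\in\mathfrak{A}(t)$. A $1$-morphism of 2AQFTs is a pseudo-transformation with co-continuous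 $\mathbb{K}$-linear components; it is an equivalence if it has an inverse up to invertible $2$-morphisms. An *AQFT* is a functor $\mathfrak{A}:\mathbf{C}\to\mathbf{Alg}_{\mathbb{K}}$ such that the images of $\mathfrak{A}(f_1)$ and $\mathfrak{A}(f_2)$ commute whenever $f_1\perp f_2$. The inclusion $\iota$ sends an AQFT $\mathfrak{A}$ to the 2AQFT $c\mapsto\mathbf{Mod}_{\mathfrak{A}(c)}$ (right modules) with $\iota(\mathfrak{A})(\underline{f})(V_1,\dots,V_n)=(V_1\otimes\cdots\otimes V_n)\otimes_{\mathfrak{A}(c_1)\otimes\cdots\otimes\mathfrak{A}(c_n)}\mathfrak{A}(t)$. The truncation $\pi$ sends a 2AQFT $\mathfrak{B}$ to the AQFT $c\mapsto\mathrm{End}(\mathfrak{B}(\ast_c))$. A $1$-morphism $\zeta:\iota(\mathfrak{A})\to\mathfrak{B}$ comes with isomorphisms $\zeta_{\ast_c}:\mathfrak{B}(\ast_c)\to\zeta_c(\mathfrak{A}(c))$ and has the adjunct $\mathfrak{A}\to\pi(\mathfrak{B})$, $a\mapsto\zeta_{\ast_c}^{-1}\circ\zeta_c(a\,\cdot\,)\circ\zeta_{\ast_c}$.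 The counit component at $\mathfrak{B}$ is a $1$-morphism $\epsilon_{\mathfrak{B}}:\iota\pi(\mathfrak{B})\to\mathfrak{B}$ whose adjunct is $\mathrm{id}_{\pi(\mathfrak{B})}$ (unique up to invertible $2$-morphism), and $\mathfrak{B}$ is *truncated* if $\epsilon_{\mathfrak{B}}$ is an equivalence. For a group $G$ acting on an AQFT $\mathfrak{A}$ by automorphisms, the gauging $\mathfrak{A}^G$ assigns to $c$ the category of $G$-equivariant right $\mathfrak{A}(c)$-modules, with factorization products $(V_1\otimes\cdots\otimes V_n)\otimes_{\mathfrak{A}(c_1)\otimes\cdots\otimes\mathfrak{A}(c_n)}\mathfrak{A}(t)$ carrying the diagonal $G$-action and with the canonical coherence maps; $\mathfrak{A}^G_0$ denotes the AQFT of $G$-invariant subalgebras $\mathfrak{A}(c)^G\subseteq\mathfrak{A}(c)$. **Statement.** Let $G$ be a finite group, and let $\mathbb{K}$ also denote the trivial AQFT $c\mapsto\mathbb{K}$ on $\overline{\mathbf{C}}$, equipped with the trivial $G$-action. Then: 1. The gauging $\mathbb{K}^G$ is a 2AQFT. 2. For every $c\in\mathbf{C}$, forgetting the (redundant) $\mathbb{K}$-module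 structure is a $\mathbb{K}$-linear equivalence $\mathbb{K}^G(c)\simeq\mathbf{Rep}_{\mathbb{K}}(G)$. 3. Under these equivalences, each factorization product $\mathbb{K}^G(\underline{f})$ is naturally isomorphic to the $n$-ary tensor product $\otimes^n:\prod_{i=1}^n\mathbf{Rep}_{\mathbb{K}}(G)\to\mathbf{Rep}_{\mathbb{K}}(G)$, via $v_1\otimes\cdots\otimes v_n\otimes 1\mapsto v_1\otimes\cdots\otimes v_n$. 4. For every $t\in\mathbf{C}$, the pointing $\mathbb{K}^G(\ast_t)$ corresponds to the trivial representation $\mathbb{K}$. 5. There are isomorphisms of AQFTs $\pi(\mathbb{K}^G)\cong\mathbb{K}^G_0\cong\mathbb{K}$. 6. A counit component $\epsilon_{\mathbb{K}^G}:\iota\pi(\mathbb{K}^G)\to\mathbb{K}^G$ exists. If $G\neq\{e\}$, then it is not an equivalence, i.e. $\mathbb{K}^G$ is not truncated. Moreover, if $G\neq\{e\}$, then for no AQFT $\mathfrak{A}$ does there exist an equivalence $\iota(\mathfrak{A})\to\mathbb{K}^G$; in this sense 2AQFTs genuinely extend ordinary AQFTs. -/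

import Mathlib

open CategoryTheory CategoryTheory.Limits MulOpposite
open scoped TensorProduct ModuleCat

universe v w u

namespace TwoCatAQFT

/-! ### Orthogonal categories and the prefactorization operad -/

/-- An orthogonality relation on a category `C`: a symmetric relation on pairs of morphisms with
common target which is stable under pre- and postcomposition. -/
structure Orthogonality (C : Type w) [Category.{v} C] where
  perp : ∀ {c₁ c₂ t : C}, (c₁ ⟶ t) → (c₂ ⟶ t) → Prop
  symm : ∀ {c₁ c₂ t : C} {f₁ : c₁ ⟶ t} {f₂ : c₂ ⟶ t}, perp f₁ f₂ → perp f₂ f₁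
  comp : ∀ {b₁ b₂ c₁ c₂ t s : C} {f₁ : c₁ ⟶ t} {f₂ : c₂ ⟶ t} (g : t ⟶ s) (h₁ : b₁ ⟶ c₁)
    (h₂ : b₂ ⟶ c₂), perp f₁ f₂ → perp (h₁ ≫ f₁ ≫ g) (h₂ ≫ f₂ ≫ g)

section Operad

variable {C : Type w} [Category.{v} C] {O : Orthogonality C}

/-- The operations of the prefactorization operad: tuples of mutually orthogonal morphisms.
Tuples are indexed by arbitrary finite types instead of the sets `{1, …, n}` only; operadic
composition then lands in tuples indexed by a sigma type, and permutations become bijections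
between index types. -/
@[ext]
structure Op (O : Orthogonality C) {I : Type} (c : I → C) (t : C) where
  hom : ∀ i, c i ⟶ t
  orth : ∀ i j, i ≠ j → O.perp (hom i) (hom j)

namespace Op

/-- The identity operation. -/
def id (O : Orthogonality C) (t : C) : Op O (fun _ : Unit => t) t where
  hom _ := 𝟙 t
  orth _ _ h := (h (Subsingleton.elim _ _)).elim

/-- A single morphism as an operation of arity one. -/
def unary (O : Orthogonality C) {c t : C} (f : c ⟶ t) : Op O (fun _ : Unit => c) t where
  hom _ := f
  orth _ _ h := (h (Subsingleton.elim _ _)).elim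

/-- The unique operation of arity zero. -/
def empty (O : Orthogonality C) (t : C) : Op O (fun i : Empty => (i.elim : C)) t where
  hom i := i.elim
  orth i := i.elim

/-- Operadic composition. -/
def comp {I : Type} {J : I → Type} {b : ∀ i, J i → C} {a : I → C} {t : C}
    (f : Op O a t) (g : ∀ i, Op O (b i) (a i)) :
    Op O (fun p : Σ i, J i => b p.1 p.2) t where
  hom p := (g p.1).hom p.2 ≫ f.hom p.1
  orth := by
    rintro ⟨i, j⟩ ⟨i', j'⟩ h
    by_cases hi : i = i'
    · subst hi
      have h' : j ≠ j' := fun e => h (by rw [e])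
      simpa using O.comp (f.hom i) (𝟙 _) (𝟙 _) ((g i).orth j j' h')
    · simpa using O.comp (𝟙 t) ((g i).hom j) ((g i').hom j') (f.orth i i' hi)

/-- The action of bijections (in particular of permutations) on operations. -/
def perm {I I' : Type} (e : I' ≃ I) {c : I → C} {t : C} (f : Op O c t) :
    Op O (fun i' => c (e i')) t where
  hom i' := f.hom (e i')
  orth i j h := f.orth _ _ (fun h' => h (e.injective h'))

end Op

end Operad

/-! ### Linear categories and multilinear functors -/

/-- A (bundled) `K`-linear category, with objects in `Type (u+1)` and small hom-sets. -/
structure LinCat (K : Type u) [Field K] where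
  carrier : Type (u + 1)
  [category : Category.{u} carrier]
  [preadditive : Preadditive carrier]
  [linear : Linear K carrier]

namespace LinCat

variable {K : Type u} [Field K]

instance : CoeSort (LinCat.{u} K) (Type (u + 1)) := ⟨LinCat.carrier⟩

attribute [instance] LinCat.category LinCat.preadditive LinCat.linear

end LinCat

section Multi

/-- Splitting a family of objects indexed by a sigma type into a family of families. -/
def sigmaCurry {I : Type} {J : I → Type} (D : ∀ i, J i → Type w) [∀ i j, Category.{v} (D i j)] :
    (∀ p : Σ i, J i, D p.1 p.2) ⥤ ∀ i, ∀ j, D i j where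
  obj V i j := V ⟨i, j⟩
  map α i j := α ⟨i, j⟩

/-- Reindexing of families of objects along a bijection. -/
def reindex {I I' : Type} (e : I' ≃ I) (D : I → Type w) [∀ i, Category.{v} (D i)] :
    (∀ i, D i) ⥤ ∀ i', D (e i') where
  obj V i' := V (e i')
  map α i' := α (e i')

open Classical in
/-- The functor into a product category which puts its argument in the `i`-th slot and keeps the
fixed objects `X j` in the other slots. -/
noncomputable def insertAt {I : Type} {D : I → Type w} [∀ i, Category.{v} (D i)]
    (X : ∀ i, D i) (i : I) : D i ⥤ ∀ j, D j :=
  Functor.pi' fun j =>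
    if h : i = j then (h ▸ 𝟭 (D i) : D i ⥤ D j) else (Functor.const (D i)).obj (X j)

/-- A functor of several variables which is `K`-linear and co-continuous in each variable. -/
structure IsMultiLinCocont (K : Type u) [Field K] {I : Type} {D : I → Type (u + 1)}
    [∀ i, Category.{u} (D i)] [∀ i, Preadditive (D i)] [∀ i, Linear K (D i)]
    {T : Type (u + 1)} [Category.{u} T] [Preadditive T] [Linear K T]
    (F : (∀ i, D i) ⥤ T) : Prop where
  map_update_add : ∀ [DecidableEq I] {X Y : ∀ i, D i} (f : X ⟶ Y) (i : I) (g h : X i ⟶ Y i),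
    F.map (X := X) (Y := Y) (Function.update f i (g + h)) =
      F.map (X := X) (Y := Y) (Function.update f i g) +
        F.map (X := X) (Y := Y) (Function.update f i h)
  map_update_smul : ∀ [DecidableEq I] {X Y : ∀ i, D i} (f : X ⟶ Y) (i : I) (r : K)
    (g : X i ⟶ Y i),
    F.map (X := X) (Y := Y) (Function.update f i (r • g)) =
      r • F.map (X := X) (Y := Y) (Function.update f i g)
  preserves : ∀ (X : ∀ i, D i) (i : I), PreservesColimitsOfSize.{u, u} (insertAt X i ⋙ F)

end Multi

/-! ### 2AQFTs -/

/-- The data of a 2AQFT: categories, factorization products and coherence maps.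
`decomp f g` is the inverse of the composition coherence
`𝔄(f) ∘ 𝔄(g) ⇒ 𝔄(f g)`; invertibility of all coherence maps is part of `IsTwoAQFT`. -/
structure TwoAQFTData (K : Type u) [Field K] {C : Type w} [Category.{v} C]
    (O : Orthogonality C) where
  obj : C → LinCat.{u} K
  prod : ∀ {I : Type} [Finite I] {c : I → C} {t : C} (_ : Op O c t), (∀ i, obj (c i)) ⥤ obj t
  decomp : ∀ {I : Type} [Finite I] {J : I → Type} [∀ i, Finite (J i)] {b : ∀ i, J i → C}
    {a : I → C} {t : C} (f : Op O a t) (g : ∀ i, Op O (b i) (a i)),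
    prod (f.comp g) ⟶
      sigmaCurry (fun i j => obj (b i j)) ⋙ Functor.pi (fun i => prod (g i)) ⋙ prod f
  unit : ∀ t : C, 𝟭 (obj t) ⟶ Functor.pi' (fun _ : Unit => 𝟭 (obj t)) ⋙ prod (Op.id O t)
  perm : ∀ {I I' : Type} [Finite I] [Finite I'] (e : I' ≃ I) {c : I → C} {t : C} (f : Op O c t)
    (f' : Op O (fun i' => c (e i')) t) (_ : f' = f.perm e),
    prod f ⟶ reindex e (fun i => obj (c i)) ⋙ prod f'

section Axioms

variable {K : Type u} [Field K] {C : Type w} [Category.{v} C] {O : Orthogonality C}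

/-- The canonical bijection `(Σ _ : Unit, I) ≃ I`. -/
def unitSigma (I : Type) : (Σ _ : Unit, I) ≃ I where
  toFun p := p.2
  invFun i := ⟨(), i⟩
  left_inv _ := rfl
  right_inv _ := rfl

/-- The canonical bijection `(Σ _ : I, Unit) ≃ I`. -/
def sigmaUnit (I : Type) : (Σ _ : I, Unit) ≃ I where
  toFun p := p.1
  invFun i := ⟨i, ()⟩
  left_inv _ := rfl
  right_inv _ := rfl

/-- The associativity bijection for sigma types. -/
def sigmaAssoc {I : Type} {J : I → Type} (L : ∀ i, J i → Type) :
    (Σ p : Σ i, J i, L p.1 p.2) ≃ Σ i, Σ j, L i j where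
  toFun p := ⟨p.1.1, p.1.2, p.2⟩
  invFun p := ⟨⟨p.1, p.2.1⟩, p.2.2⟩
  left_inv _ := rfl
  right_inv _ := rfl

/-- The block permutation associated with a bijection of the outer index types. -/
def sigmaOuter {I I' : Type} (e : I' ≃ I) (J : I → Type) : (Σ i', J (e i')) ≃ Σ i, J i :=
  Equiv.sigmaCongrLeft e

/-- The sum of bijections of the inner index types. -/
def sigmaInner {I : Type} {J J' : I → Type} (e : ∀ i, J' i ≃ J i) : (Σ i, J' i) ≃ Σ i, J i where
  toFun p := ⟨p.1, e p.1 p.2⟩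
  invFun p := ⟨p.1, (e p.1).symm p.2⟩
  left_inv p := by simp
  right_inv p := by simp

lemma Op.assoc_eq {I : Type} {J : I → Type} {L : ∀ i, J i → Type} {d : ∀ i j, L i j → C}
    {b : ∀ i, J i → C} {a : I → C} {t : C} (f : Op O a t) (g : ∀ i, Op O (b i) (a i))
    (h : ∀ i j, Op O (d i j) (b i j)) :
    (f.comp g).comp (fun p => h p.1 p.2) =
      (f.comp fun i => (g i).comp (h i)).perm (sigmaAssoc L) := by
  ext; simp [Op.comp, Op.perm, sigmaAssoc]

lemma Op.id_comp_eq {I : Type} {c : I → C} {t : C} (f : Op O c t) :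
    (Op.id O t).comp (fun _ => f) = f.perm (unitSigma I) := by
  ext; simp [Op.comp, Op.perm, unitSigma, Op.id]

lemma Op.comp_id_eq {I : Type} {c : I → C} {t : C} (f : Op O c t) :
    f.comp (fun i => Op.id O (c i)) = f.perm (sigmaUnit I) := by
  ext; simp [Op.comp, Op.perm, sigmaUnit, Op.id]

/-- The axioms of a 2AQFT, i.e. of a pseudo-morphism from the prefactorization operad to the
operad of locally presentable `K`-linear categories. -/
structure IsTwoAQFT (A : TwoAQFTData.{v, w, u} K O) : Prop where
  presentable : ∀ c, IsLocallyPresentable.{u} (A.obj c)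
  multi : ∀ {I : Type} [Finite I] {c : I → C} {t : C} (f : Op O c t),
    IsMultiLinCocont K (A.prod f)
  isIso_decomp : ∀ {I : Type} [Finite I] {J : I → Type} [∀ i, Finite (J i)] {b : ∀ i, J i → C}
    {a : I → C} {t : C} (f : Op O a t) (g : ∀ i, Op O (b i) (a i)), IsIso (A.decomp f g)
  isIso_unit : ∀ t : C, IsIso (A.unit t)
  isIso_perm : ∀ {I I' : Type} [Finite I] [Finite I'] (e : I' ≃ I) {c : I → C} {t : C}
    (f : Op O c t) (f' : Op O (fun i' => c (e i')) t) (h : f' = f.perm e), IsIso (A.perm e f f' h)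
  /-- associativity -/
  assoc : ∀ {I : Type} [Finite I] {J : I → Type} [∀ i, Finite (J i)] {L : ∀ i, J i → Type}
    [∀ i j, Finite (L i j)] {d : ∀ i j, L i j → C} {b : ∀ i, J i → C} {a : I → C} {t : C}
    (f : Op O a t) (g : ∀ i, Op O (b i) (a i)) (h : ∀ i j, Op O (d i j) (b i j))
    (V : ∀ p : Σ i, Σ j, L i j, A.obj (d p.1 p.2.1 p.2.2)),
    (A.perm (sigmaAssoc L) (f.comp fun i => (g i).comp (h i)) _ (Op.assoc_eq f g h)).app V ≫
        (A.decomp (f.comp g) (fun p => h p.1 p.2)).app (fun q => V (sigmaAssoc L q)) ≫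
        (A.decomp f g).app (fun p => (A.prod (h p.1 p.2)).obj fun l => V ⟨p.1, p.2, l⟩) =
      (A.decomp f (fun i => (g i).comp (h i))).app V ≫
        (A.prod f).map (fun i => (A.decomp (g i) (h i)).app fun q => V ⟨i, q⟩)
  /-- left unitality -/
  unit_left : ∀ {I : Type} [Finite I] {c : I → C} {t : C} (f : Op O c t)
    (V : ∀ i, A.obj (c i)),
    (A.perm (unitSigma I) f _ (Op.id_comp_eq f)).app V ≫
        (A.decomp (Op.id O t) (fun _ => f)).app (fun p => V p.2) =
      (A.unit t).app ((A.prod f).obj V)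
  /-- right unitality -/
  unit_right : ∀ {I : Type} [Finite I] {c : I → C} {t : C} (f : Op O c t)
    (V : ∀ i, A.obj (c i)),
    (A.perm (sigmaUnit I) f _ (Op.comp_id_eq f)).app V ≫
        (A.decomp f (fun i => Op.id O (c i))).app (fun p => V p.1) =
      (A.prod f).map (fun i => (A.unit (c i)).app (V i))
  /-- the trivial permutation -/
  perm_refl : ∀ {I : Type} [Finite I] {c : I → C} {t : C} (f : Op O c t)
    (V : ∀ i, A.obj (c i)), (A.perm (Equiv.refl I) f f rfl).app V = 𝟙 _
  /-- compositions of permutations -/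
  perm_trans : ∀ {I I' I'' : Type} [Finite I] [Finite I'] [Finite I''] (e : I' ≃ I)
    (e' : I'' ≃ I') {c : I → C} {t : C} (f : Op O c t) (V : ∀ i, A.obj (c i)),
    (A.perm e f _ rfl).app V ≫ (A.perm e' (f.perm e) _ rfl).app (fun i' => V (e i')) =
      (A.perm (e'.trans e) f _ rfl).app V
  /-- equivariance for permutations of the outer operation -/
  outer : ∀ {I I' : Type} [Finite I] [Finite I'] (e : I' ≃ I) {J : I → Type} [∀ i, Finite (J i)]
    {b : ∀ i, J i → C} {a : I → C} {t : C} (f : Op O a t) (g : ∀ i, Op O (b i) (a i))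
    (V : ∀ p : Σ i, J i, A.obj (b p.1 p.2)),
    (A.perm (sigmaOuter e J) (f.comp g) ((f.perm e).comp fun i' => g (e i')) rfl).app V ≫
        (A.decomp (f.perm e) (fun i' => g (e i'))).app (fun p => V ⟨e p.1, p.2⟩) =
      (A.decomp f g).app V ≫
        (A.perm e f _ rfl).app (fun i => (A.prod (g i)).obj fun j => V ⟨i, j⟩)
  /-- equivariance for permutations of the inner operations -/
  inner : ∀ {I : Type} [Finite I] {J J' : I → Type} [∀ i, Finite (J i)] [∀ i, Finite (J' i)]
    (e : ∀ i, J' i ≃ J i) {b : ∀ i, J i → C} {a : I → C} {t : C} (f : Op O a t)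
    (g : ∀ i, Op O (b i) (a i)) (V : ∀ p : Σ i, J i, A.obj (b p.1 p.2)),
    (A.perm (sigmaInner e) (f.comp g) (f.comp fun i => (g i).perm (e i)) rfl).app V ≫
        (A.decomp f (fun i => (g i).perm (e i))).app (fun p => V ⟨p.1, e p.1 p.2⟩) =
      (A.decomp f g).app V ≫
        (A.prod f).map (fun i => (A.perm (e i) (g i) _ rfl).app fun j => V ⟨i, j⟩)

end Axioms

/-- A 2AQFT over `K` on the orthogonal category `(C, O)`. -/
structure TwoAQFT (K : Type u) [Field K] {C : Type w} [Category.{v} C] (O : Orthogonality C)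
    extends TwoAQFTData.{v, w, u} K O where
  isTwoAQFT : IsTwoAQFT toTwoAQFTData

/-! ### AQFTs and the truncation of a 2AQFT -/

section AQFT

variable (K : Type u) [Field K] {C : Type w} [Category.{v} C] (O : Orthogonality C)

/-- The orthogonal commutativity property of a functor to algebras. -/
def PerpCommutative : ObjectProperty (C ⥤ AlgCat.{u} K) := fun A =>
  ∀ ⦃c₁ c₂ t : C⦄ (f₁ : c₁ ⟶ t) (f₂ : c₂ ⟶ t), O.perp f₁ f₂ →
    ∀ (a₁ : A.obj c₁) (a₂ : A.obj c₂), Commute ((A.map f₁).hom a₁) ((A.map f₂).hom a₂)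

/-- The category of AQFTs: the full subcategory of the functor category on the functors with
the orthogonal commutativity property. -/
abbrev AQFT := (PerpCommutative K O).FullSubcategory

end AQFT

section Truncation

variable {K : Type u} [Field K] {C : Type w} [Category.{v} C] {O : Orthogonality C}

/-- The canonical bijection `(Σ _ : I, Empty) ≃ Empty`. -/
def sigmaEmpty (I : Type) : (Σ _ : I, Empty) ≃ Empty where
  toFun p := p.2
  invFun i := i.elim
  left_inv p := p.2.elim
  right_inv i := i.elim

lemma Op.comp_empty_eq {I : Type} {c : I → C} {t : C} (f : Op O c t) :
    f.comp (fun i => Op.empty O (c i)) = (Op.empty O t).perm (sigmaEmpty I) := by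
  ext p; exact p.2.elim

namespace TwoAQFTData

variable (A : TwoAQFTData.{v, w, u} K O)

/-- The pointing `𝔄(∗_t)` of the category `𝔄(t)`. -/
def point (t : C) : A.obj t := (A.prod (Op.empty O t)).obj (fun i => i.elim)

/-- The coherence map `𝔞_t ⟶ 𝔄(f)(𝔞_{c₁}, …, 𝔞_{cₙ})`. -/
def toPoint {I : Type} [Finite I] {c : I → C} {t : C} (f : Op O c t) :
    A.point t ⟶ (A.prod f).obj (fun i => A.point (c i)) :=
  (A.perm (sigmaEmpty I) (Op.empty O t) (f.comp fun i => Op.empty O (c i))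
      (Op.comp_empty_eq f)).app (fun i => i.elim) ≫
    (A.decomp f (fun i => Op.empty O (c i))).app (fun p => p.2.elim)

end TwoAQFTData

namespace IsTwoAQFT

lemma toPoint_perm_aux {D : Type*} [Category* D] {X₁ X₂ X₃ X₄ X₅ : D} {p : X₁ ⟶ X₂}
    {p' : X₂ ⟶ X₃} {d' : X₃ ⟶ X₄} {d : X₂ ⟶ X₅} {q : X₅ ⟶ X₄} {r : X₁ ⟶ X₃}
    (h₁ : p' ≫ d' = d ≫ q) (h₂ : p ≫ p' = r) : (p ≫ d) ≫ q = r ≫ d' := by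
  rw [Category.assoc, ← h₁, ← h₂, Category.assoc]

lemma toPoint_comp_aux {D : Type*} [Category* D] {X₁ X₂ X₃ X₄ X₅ X₆ X₇ X₈ : D}
    {pa : X₁ ⟶ X₂} {d₁ : X₂ ⟶ X₃} {d₂ : X₃ ⟶ X₄} {dw : X₁ ⟶ X₅} {md : X₅ ⟶ X₄}
    {pin : X₆ ⟶ X₁} {d₀ : X₆ ⟶ X₇} {mp : X₇ ⟶ X₅} {p : X₈ ⟶ X₆} {q : X₈ ⟶ X₁} {r : X₈ ⟶ X₂}
    {m : X₇ ⟶ X₄} (h₁ : pa ≫ d₁ ≫ d₂ = dw ≫ md) (h₂ : pin ≫ dw = d₀ ≫ mp) (h₃ : p ≫ pin = q)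
    (h₄ : q ≫ pa = r) (h₅ : m = mp ≫ md) : (r ≫ d₁) ≫ d₂ = (p ≫ d₀) ≫ m := by
  rw [h₅, ← h₄, ← h₃]
  simp only [Category.assoc]
  rw [h₁, reassoc_of% h₂]

lemma prodEnd_perm_aux {D : Type*} [Category* D] {X Y Z : D} {a : X ⟶ Y} {p : Y ⟶ Z}
    {a' : X ⟶ Z} {m : Y ⟶ Y} {m' : Z ⟶ Z} {k : X ⟶ X} (h₁ : a ≫ p = a') (h₂ : m ≫ p = p ≫ m')
    (h₃ : a ≫ m = k ≫ a) : a' ≫ m' = k ≫ a' := by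
  rw [← h₁, Category.assoc, ← h₂, reassoc_of% h₃]

lemma update_unit {D : Type*} [Category* D] {X Y : D} (f : ∀ _ : Unit, X ⟶ Y) (g : X ⟶ Y)
    [DecidableEq Unit] : Function.update f () g = fun _ => g :=
  funext fun _ => by simp

lemma prodEnd_comp_aux {D : Type*} [Category* D] {X Y Z W : D} {r : X ⟶ Y} {d : Y ⟶ Z}
    (hd : IsIso d) {s : X ⟶ W} {T : W ⟶ Z} {m : Y ⟶ Y} {m' : Z ⟶ Z} {M : W ⟶ W} {k : X ⟶ X}
    (h₁ : r ≫ d = s ≫ T) (h₂ : m ≫ d = d ≫ m') (h₃ : T ≫ m' = M ≫ T) (h₄ : s ≫ M = k ≫ s) :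
    r ≫ m = k ≫ r := by
  rw [← cancel_mono d, Category.assoc, h₂, reassoc_of% h₁, h₃, reassoc_of% h₄, Category.assoc, h₁]

variable {A : TwoAQFTData.{v, w, u} K O}

lemma perm_congr {I I' : Type} [Finite I] [Finite I'] (e : I' → I) {c : I → C} {t : C}
    (f : Op O c t) (f' : Op O (fun i' => c (e i')) t) (V : ∀ i, A.obj (c i)) (k k' : I → I')
    (hl) (hr) (hl') (hr') (h) (h') :
    (A.perm ⟨e, k, hl, hr⟩ f f' h).app V = (A.perm ⟨e, k', hl', hr'⟩ f f' h').app V := by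
  obtain rfl : k = k' := funext fun i => by
    rw [← hl' (k i), hr i]
  rfl

lemma perm_trans' (hA : IsTwoAQFT A) {I I' I'' : Type} [Finite I] [Finite I'] [Finite I''] (e : I' ≃ I)
    (e' : I'' ≃ I') {c : I → C} {t : C} (f : Op O c t) (f' : Op O (fun i' => c (e i')) t)
    (h : f' = f.perm e) (f'' : Op O (fun i => c (e (e' i))) t) (h' : f'' = f'.perm e')
    (V : ∀ i, A.obj (c i)) (k : I → I'') (hl) (hr)
    (h'' : f'' = f.perm ⟨fun x => e (e' x), k, hl, hr⟩) :
    (A.perm e f f' h).app V ≫ (A.perm e' f' f'' h').app (fun i' => V (e i')) =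
      (A.perm ⟨fun x => e (e' x), k, hl, hr⟩ f f'' h'').app V := by
  subst h h'
  obtain rfl : k = fun x => e'.symm (e.symm x) := by
    funext x
    have := hl (e'.symm (e.symm x))
    simpa using this
  exact hA.perm_trans e e' f V

lemma inner' (hA : IsTwoAQFT A) {I : Type} [Finite I] {J J' : I → Type} [∀ i, Finite (J i)] [∀ i, Finite (J' i)]
    (e : ∀ i, J' i ≃ J i) {b : ∀ i, J i → C} {a : I → C} {t : C} (f : Op O a t)
    (g : ∀ i, Op O (b i) (a i)) (g' : ∀ i, Op O (fun j => b i (e i j)) (a i))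
    (h : ∀ i, g' i = (g i).perm (e i))
    (h' : f.comp g' = (f.comp g).perm (sigmaInner e)) (V : ∀ p : Σ i, J i, A.obj (b p.1 p.2)) :
    (A.perm (sigmaInner e) (f.comp g) (f.comp g') h').app V ≫
        (A.decomp f g').app (fun p => V ⟨p.1, e p.1 p.2⟩) =
      (A.decomp f g).app V ≫
        (A.prod f).map (fun i => (A.perm (e i) (g i) (g' i) (h i)).app fun j => V ⟨i, j⟩) := by
  obtain rfl : g' = fun i => (g i).perm (e i) := funext h
  exact hA.inner e f g V

lemma toPoint_perm (hA : IsTwoAQFT A) {I I' : Type} [Finite I] [Finite I'] (e : I' ≃ I) {c : I → C} {t : C}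
    (f : Op O c t) :
    A.toPoint f ≫ (A.perm e f (f.perm e) rfl).app (fun i => A.point (c i)) =
      A.toPoint (f.perm e) := by
  have h1 := hA.outer e f (fun i => Op.empty O (c i)) (fun p => p.2.elim)
  have h2 := hA.perm_trans' (sigmaEmpty I) (sigmaOuter e fun _ => Empty) (Op.empty O t)
    (f.comp fun i => Op.empty O (c i)) (Op.comp_empty_eq f)
    ((f.perm e).comp fun i' => Op.empty O (c (e i'))) rfl (fun i => i.elim)
    (sigmaEmpty I').symm (sigmaEmpty I').left_inv (sigmaEmpty I').right_inv
    (Op.comp_empty_eq (f.perm e))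
  exact toPoint_perm_aux h1 h2

lemma toPoint_comp (hA : IsTwoAQFT A) {I : Type} [Finite I] {J : I → Type} [∀ i, Finite (J i)] {b : ∀ i, J i → C}
    {a : I → C} {t : C} (f : Op O a t) (g : ∀ i, Op O (b i) (a i)) :
    A.toPoint (f.comp g) ≫ (A.decomp f g).app (fun p => A.point (b p.1 p.2)) =
      A.toPoint f ≫ (A.prod f).map (fun i => A.toPoint (g i)) := by
  have h1 := hA.assoc f g (fun i j => Op.empty O (b i j)) (fun p => p.2.2.elim)
  have h2 := hA.inner' (fun i => sigmaEmpty (J i)) f (fun i => Op.empty O (a i))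
    (fun i => (g i).comp fun j => Op.empty O (b i j)) (fun i => Op.comp_empty_eq (g i))
    (by ext p; exact p.2.2.elim) (fun p => p.2.elim)
  have h3 := hA.perm_trans' (sigmaEmpty I) (sigmaInner fun i => sigmaEmpty (J i)) (Op.empty O t)
    (f.comp fun i => Op.empty O (a i)) (Op.comp_empty_eq f)
    (f.comp fun i => (g i).comp fun j => Op.empty O (b i j)) (by ext p; exact p.2.2.elim)
    (fun i => i.elim) (fun i => i.elim) (fun p => p.2.2.elim) (fun i => i.elim)
    (by ext p; exact p.2.2.elim)
  have h4 := hA.perm_trans'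
    ⟨fun x => sigmaEmpty I (sigmaInner (fun i => sigmaEmpty (J i)) x), fun i => i.elim,
      (fun p => p.2.2.elim), (fun i => i.elim)⟩
    (sigmaAssoc fun i (_ : J i) => Empty) (Op.empty O t)
    (f.comp fun i => (g i).comp fun j => Op.empty O (b i j)) (by ext p; exact p.2.2.elim)
    ((f.comp g).comp fun p => Op.empty O (b p.1 p.2)) (by ext p; exact p.2.elim)
    (fun i => i.elim) (sigmaEmpty (Σ i, J i)).symm (sigmaEmpty (Σ i, J i)).left_inv
    (sigmaEmpty (Σ i, J i)).right_inv (by ext p; exact p.2.elim)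
  have h5 := (A.prod f).map_comp
    (fun i => (A.perm (sigmaEmpty (J i)) (Op.empty O (a i))
      ((g i).comp fun j => Op.empty O (b i j)) (Op.comp_empty_eq (g i))).app (fun i => i.elim))
    (fun i => (A.decomp (g i) (fun j => Op.empty O (b i j))).app (fun p => p.2.elim))
  exact toPoint_comp_aux h1 h2 h3 h4 h5

lemma isIso_toPoint (hA : IsTwoAQFT A) {I : Type} [Finite I] {c : I → C} {t : C} (f : Op O c t) :
    IsIso (A.toPoint f) := by
  have := hA.isIso_perm (sigmaEmpty I) (Op.empty O t) (f.comp fun i => Op.empty O (c i))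
    (Op.comp_empty_eq f)
  have := hA.isIso_decomp f (fun i => Op.empty O (c i))
  exact @IsIso.comp_isIso _ _ _ _ _ _ _ (NatIso.isIso_app_of_isIso _ _)
    (NatIso.isIso_app_of_isIso _ _)

lemma toPoint_id (hA : IsTwoAQFT A) (t : C) : A.toPoint (Op.id O t) = (A.unit t).app (A.point t) :=
  (congrArg (· ≫ _) (perm_congr (fun p : Σ _ : Unit, Empty => p.2) (Op.empty O t)
      ((Op.id O t).comp fun _ => Op.empty O t) (fun i => i.elim) (sigmaEmpty Unit).symm (unitSigma Empty).symm
      (sigmaEmpty Unit).left_inv (sigmaEmpty Unit).right_inv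
      (unitSigma Empty).left_inv (unitSigma Empty).right_inv (Op.comp_empty_eq (Op.id O t))
      (Op.id_comp_eq (Op.empty O t)))).trans
    (hA.unit_left (Op.empty O t) (fun i => i.elim))

/-- The induced map `𝔄(f) : ∏ᵢ End(𝔞_{cᵢ}) → End(𝔄(f)(𝔞_{c₁}, …, 𝔞_{cₙ})) ≅ End(𝔞_t)` on
endomorphisms of the pointings. -/
noncomputable def prodEnd (hA : IsTwoAQFT A) {I : Type} [Finite I] {c : I → C} {t : C} (f : Op O c t)
    (h : ∀ i, End (A.point (c i))) : End (A.point t) :=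
  haveI := hA.isIso_toPoint f
  A.toPoint f ≫ (A.prod f).map (X := fun i => A.point (c i)) (Y := fun i => A.point (c i)) h ≫
    inv (A.toPoint f)

lemma prodEnd_eq_iff (hA : IsTwoAQFT A) {I : Type} [Finite I] {c : I → C} {t : C} (f : Op O c t)
    (h : ∀ i, End (A.point (c i))) (k : A.point t ⟶ A.point t) :
    hA.prodEnd f h = k ↔ A.toPoint f ≫
      (A.prod f).map (X := fun i => A.point (c i)) (Y := fun i => A.point (c i)) h =
        k ≫ A.toPoint f := by
  have := hA.isIso_toPoint f
  unfold prodEnd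
  rw [← Category.assoc, IsIso.comp_inv_eq]

lemma toPoint_comp_map (hA : IsTwoAQFT A) {I : Type} [Finite I] {c : I → C} {t : C} (f : Op O c t)
    (h : ∀ i, End (A.point (c i))) :
    A.toPoint f ≫
      (A.prod f).map (X := fun i => A.point (c i)) (Y := fun i => A.point (c i)) h =
        hA.prodEnd f h ≫ A.toPoint f :=
  (hA.prodEnd_eq_iff f h _).1 rfl

lemma prodEnd_one (hA : IsTwoAQFT A) {I : Type} [Finite I] {c : I → C} {t : C} (f : Op O c t) :
    hA.prodEnd f (fun _ => 1) = 1 := by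
  rw [prodEnd_eq_iff]
  exact (congrArg (_ ≫ ·) ((A.prod f).map_id _)).trans
    ((Category.comp_id _).trans (Category.id_comp _).symm)

lemma prodEnd_mul (hA : IsTwoAQFT A) {I : Type} [Finite I] {c : I → C} {t : C} (f : Op O c t)
    (h k : ∀ i, End (A.point (c i))) :
    hA.prodEnd f (fun i => h i * k i) = hA.prodEnd f h * hA.prodEnd f k := by
  rw [prodEnd_eq_iff]
  refine (congrArg (_ ≫ ·) ((A.prod f).map_comp (X := fun i => A.point (c i))
    (Y := fun i => A.point (c i)) (Z := fun i => A.point (c i)) k h)).trans ?_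
  rw [End.mul_def, Category.assoc, ← toPoint_comp_map, ← Category.assoc, toPoint_comp_map,
    Category.assoc]

lemma prodEnd_id (hA : IsTwoAQFT A) {t : C} (h : End (A.point t)) : hA.prodEnd (Op.id O t) (fun _ => h) = h := by
  rw [prodEnd_eq_iff, hA.toPoint_id]
  exact ((A.unit t).naturality h).symm

lemma prodEnd_perm (hA : IsTwoAQFT A) {I I' : Type} [Finite I] [Finite I'] (e : I' ≃ I) {c : I → C} {t : C}
    (f : Op O c t) (f' : Op O (fun i' => c (e i')) t) (hf : f' = f.perm e)
    (h : ∀ i, End (A.point (c i))) :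
    hA.prodEnd f' (fun i' => h (e i')) = hA.prodEnd f h := by
  subst hf
  rw [prodEnd_eq_iff]
  exact prodEnd_perm_aux (hA.toPoint_perm e f)
    ((A.perm e f _ rfl).naturality (X := fun i => A.point (c i)) (Y := fun i => A.point (c i)) h)
    (hA.toPoint_comp_map f h)

lemma prodEnd_comp (hA : IsTwoAQFT A) {I : Type} [Finite I] {J : I → Type} [∀ i, Finite (J i)] {b : ∀ i, J i → C}
    {a : I → C} {t : C} (f : Op O a t) (g : ∀ i, Op O (b i) (a i))
    (h : ∀ p : Σ i, J i, End (A.point (b p.1 p.2))) :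
    hA.prodEnd (f.comp g) h = hA.prodEnd f (fun i => hA.prodEnd (g i) fun j => h ⟨i, j⟩) := by
  have := hA.isIso_decomp f g
  rw [prodEnd_eq_iff]
  refine prodEnd_comp_aux (NatIso.isIso_app_of_isIso _ _) (hA.toPoint_comp f g)
    ((A.decomp f g).naturality (X := fun p => A.point (b p.1 p.2))
      (Y := fun p => A.point (b p.1 p.2)) h)
    (M := (A.prod f).map (X := fun i => A.point (a i)) (Y := fun i => A.point (a i))
      fun i => hA.prodEnd (g i) fun j => h ⟨i, j⟩) ?_ (hA.toPoint_comp_map f _)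
  refine ((A.prod f).map_comp _ _).symm.trans (Eq.trans ?_ ((A.prod f).map_comp _ _))
  exact congrArg (A.prod f).map (funext fun i => hA.toPoint_comp_map (g i) _)

/-- Endomorphisms concentrated in one slot. -/
lemma prodEnd_single (hA : IsTwoAQFT A) {I : Type} [Finite I] {c : I → C} {t : C} (f : Op O c t) (i₀ : I)
    (h : ∀ i, End (A.point (c i))) (h₁ : ∀ i, i ≠ i₀ → h i = 1) :
    hA.prodEnd f h = hA.prodEnd (Op.unary O (f.hom i₀)) (fun _ => h i₀) := by
  let g : ∀ i, Op O (fun _ : PLift (i = i₀) => c i) (c i) := fun i =>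
    ⟨fun _ => 𝟙 _, fun _ _ h => (h (Subsingleton.elim _ _)).elim⟩
  have hg : ∀ i, hA.prodEnd (g i) (fun _ => h i) = h i := by
    intro i
    by_cases hi : i = i₀
    · subst hi
      let e : PLift (i = i) ≃ Unit := ⟨fun _ => (), fun _ => ⟨rfl⟩, fun _ => rfl, fun _ => rfl⟩
      exact (hA.prodEnd_perm e (Op.id O (c i)) (g i) rfl (fun _ => h i)).trans (hA.prodEnd_id _)
    · rw [h₁ i hi]
      exact hA.prodEnd_one _
  let e : Unit ≃ Σ i, PLift (i = i₀) :=
    ⟨fun _ => ⟨i₀, ⟨rfl⟩⟩, fun _ => (), fun _ => rfl, by rintro ⟨i, ⟨rfl⟩⟩; rfl⟩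
  have h2 := hA.prodEnd_comp f g (fun p => h p.1)
  have h3 := hA.prodEnd_perm e (f.comp g) (Op.unary O (f.hom i₀))
    (by ext; simp [Op.unary, Op.perm, Op.comp, e, g]) (fun p => h p.1)
  rw [show (fun i => hA.prodEnd (g i) fun _ => h i) = h from funext hg] at h2
  exact h2.symm.trans h3.symm

lemma prodEnd_unary_id (hA : IsTwoAQFT A) {t : C} (h : End (A.point t)) :
    hA.prodEnd (Op.unary O (𝟙 t)) (fun _ => h) = h :=
  hA.prodEnd_id h

lemma prodEnd_unary_comp (hA : IsTwoAQFT A) {b c t : C} (g : b ⟶ c) (f : c ⟶ t) (h : End (A.point b)) :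
    hA.prodEnd (Op.unary O (g ≫ f)) (fun _ => h) =
      hA.prodEnd (Op.unary O f) (fun _ => hA.prodEnd (Op.unary O g) (fun _ => h)) := by
  have h2 := hA.prodEnd_comp (Op.unary O f) (fun _ => Op.unary O g) (fun _ => h)
  have h3 := hA.prodEnd_perm (unitSigma Unit) (Op.unary O (g ≫ f))
    ((Op.unary O f).comp fun _ => Op.unary O g) rfl (fun _ => h)
  exact h3.symm.trans h2

/-- The algebra homomorphism `End(𝔞_c) → End(𝔞_t)` induced by a morphism `c ⟶ t`. -/
noncomputable def truncMap (hA : IsTwoAQFT A) {c t : C} (f : c ⟶ t) : End (A.point c) →ₐ[K] End (A.point t) :=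
  AlgHom.ofLinearMap
    { toFun := fun h => hA.prodEnd (Op.unary O f) (fun _ => h)
      map_add' := fun h k => by
        have e := (hA.multi (Op.unary O f)).map_update_add (X := fun _ => A.point c)
          (Y := fun _ => A.point c) (fun _ => h) () h k
        simp only [update_unit] at e
        rw [prodEnd_eq_iff]
        refine (congrArg (_ ≫ ·) e).trans ?_
        rw [Preadditive.comp_add, Preadditive.add_comp]
        exact congrArg₂ _ (hA.toPoint_comp_map _ _) (hA.toPoint_comp_map _ _)
      map_smul' := fun r h => by
        have e := (hA.multi (Op.unary O f)).map_update_smul (X := fun _ => A.point c)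
          (Y := fun _ => A.point c) (fun _ => h) () r h
        simp only [update_unit] at e
        rw [prodEnd_eq_iff]
        refine (congrArg (_ ≫ ·) e).trans ?_
        refine (Linear.comp_smul _ _ _ _ _ _).trans (Eq.trans ?_ (Linear.smul_comp _ _ _ _ _ _).symm)
        exact congrArg _ (hA.toPoint_comp_map _ _) }
    (hA.prodEnd_one _) (fun h k => hA.prodEnd_mul _ (fun _ => h) (fun _ => k))

lemma commute_prodEnd_unary (hA : IsTwoAQFT A) {c₁ c₂ t : C} (f₁ : c₁ ⟶ t) (f₂ : c₂ ⟶ t) (hf : O.perp f₁ f₂)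
    (h₁ : End (A.point c₁)) (h₂ : End (A.point c₂)) :
    Commute (hA.prodEnd (Op.unary O f₁) (fun _ => h₁))
      (hA.prodEnd (Op.unary O f₂) (fun _ => h₂)) := by
  let c : Bool → C := fun i => bif i then c₁ else c₂
  let f : Op O c t :=
    ⟨fun i => match i with
      | true => f₁
      | false => f₂, fun i j hij => by
      cases i <;> cases j
      · exact (hij rfl).elim
      · exact O.symm hf
      · exact hf
      · exact (hij rfl).elim⟩
  let k₁ : ∀ i, End (A.point (c i)) := fun i => match i with
    | true => h₁
    | false => 1
  let k₂ : ∀ i, End (A.point (c i)) := fun i => match i with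
    | true => 1
    | false => h₂
  have e₁ := hA.prodEnd_single f true k₁ (by rintro (_ | _) h; exacts [rfl, (h rfl).elim])
  have e₂ := hA.prodEnd_single f false k₂ (by rintro (_ | _) h; exacts [(h rfl).elim, rfl])
  have e₃ := hA.prodEnd_mul f k₁ k₂
  have e₄ := hA.prodEnd_mul f k₂ k₁
  have e₅ : (fun i => k₁ i * k₂ i) = fun i => k₂ i * k₁ i := by
    funext i
    cases i
    · exact (one_mul _).trans (mul_one _).symm
    · exact (mul_one _).trans (one_mul _).symm
  rw [e₅, e₄] at e₃
  rw [e₁, e₂] at e₃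
  exact e₃.symm

end IsTwoAQFT

/-- The truncation `π(𝔄)` of a 2AQFT: the AQFT of endomorphism algebras of the pointings. -/
noncomputable def truncation (A : TwoAQFT.{v, w, u} K O) : AQFT.{v, w, u} K O where
  obj :=
    { obj := fun c => AlgCat.of K (End (A.point c))
      map := fun f => AlgCat.ofHom (A.isTwoAQFT.truncMap f)
      map_id := fun t => by
        ext h
        exact A.isTwoAQFT.prodEnd_unary_id h
      map_comp := fun g f => by
        ext h
        exact A.isTwoAQFT.prodEnd_unary_comp g f h }
  property := fun _ _ _ f₁ f₂ hf h₁ h₂ => A.isTwoAQFT.commute_prodEnd_unary f₁ f₂ hf h₁ h₂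

end Truncation

/-! ### 1-morphisms, invertible 2-morphisms and equivalences -/

section Morphisms

variable {K : Type u} [Field K] {C : Type w} [Category.{v} C] {O : Orthogonality C}

/-- The data of a 1-morphism of 2AQFTs. -/
structure PreHom (A B : TwoAQFTData.{v, w, u} K O) where
  app : ∀ c, A.obj c ⥤ B.obj c
  coh : ∀ {I : Type} [Finite I] {c : I → C} {t : C} (f : Op O c t),
    Functor.pi (fun i => app (c i)) ⋙ B.prod f ≅ A.prod f ⋙ app t

namespace PreHom

/-- The identity 1-morphism. -/
def id (A : TwoAQFTData.{v, w, u} K O) : PreHom A A where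
  app c := 𝟭 (A.obj c)
  coh f := NatIso.ofComponents (fun V => Iso.refl ((A.prod f).obj V)) (fun h => by
    exact (Category.comp_id _).trans (Category.id_comp _).symm)

/-- Composition of 1-morphisms. -/
def comp {A₁ A₂ A₃ : TwoAQFTData.{v, w, u} K O} (ζ : PreHom A₁ A₂) (ξ : PreHom A₂ A₃) :
    PreHom A₁ A₃ where
  app c := ζ.app c ⋙ ξ.app c
  coh {_} _ {c} {t} f :=
    Functor.isoWhiskerLeft (Functor.pi fun i => ζ.app (c i)) (ξ.coh f) ≪≫
      Functor.isoWhiskerRight (ζ.coh f) (ξ.app t)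

/-- The comparison `𝔟_t ⟶ ζ_t(𝔞_t)` of pointings. -/
def pointMap {A B : TwoAQFTData.{v, w, u} K O} (ζ : PreHom A B) (t : C) :
    B.point t ⟶ (ζ.app t).obj (A.point t) :=
  (B.prod (Op.empty O t)).map (fun i => i.elim) ≫ (ζ.coh (Op.empty O t)).hom.app (fun i => i.elim)

end PreHom

/-- A 1-morphism of 2AQFTs (a pseudo-transformation): co-continuous `K`-linear functors together
with coherence isomorphisms. -/
structure Hom (A B : TwoAQFTData.{v, w, u} K O) extends PreHom A B where
  additive : ∀ c, (app c).Additive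
  linear : ∀ c, (app c).Linear K
  preserves : ∀ c, PreservesColimitsOfSize.{u, u} (app c)
  coh_comp : ∀ {I : Type} [Finite I] {J : I → Type} [∀ i, Finite (J i)] {b : ∀ i, J i → C}
    {a : I → C} {t : C} (f : Op O a t) (g : ∀ i, Op O (b i) (a i))
    (V : ∀ p : Σ i, J i, A.obj (b p.1 p.2)),
    (coh (f.comp g)).hom.app V ≫ (app t).map ((A.decomp f g).app V) =
      (B.decomp f g).app (fun p => (app (b p.1 p.2)).obj (V p)) ≫
        (B.prod f).map (fun i => (coh (g i)).hom.app fun j => V ⟨i, j⟩) ≫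
        (coh f).hom.app (fun i => (A.prod (g i)).obj fun j => V ⟨i, j⟩)
  coh_unit : ∀ (t : C) (V : A.obj t),
    (B.unit t).app ((app t).obj V) ≫ (coh (Op.id O t)).hom.app (fun _ => V) =
      (app t).map ((A.unit t).app V)
  coh_perm : ∀ {I I' : Type} [Finite I] [Finite I'] (e : I' ≃ I) {c : I → C} {t : C}
    (f : Op O c t) (V : ∀ i, A.obj (c i)),
    (coh f).hom.app V ≫ (app t).map ((A.perm e f _ rfl).app V) =
      (B.perm e f _ rfl).app (fun i => (app (c i)).obj (V i)) ≫
        (coh (f.perm e)).hom.app (fun i' => V (e i'))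

/-- An invertible 2-morphism (modification) between 1-morphisms. -/
structure InvertibleModification {A B : TwoAQFTData.{v, w, u} K O} (ζ κ : PreHom A B) where
  iso : ∀ c, ζ.app c ≅ κ.app c
  comm : ∀ {I : Type} [Finite I] {c : I → C} {t : C} (f : Op O c t) (V : ∀ i, A.obj (c i)),
    (ζ.coh f).hom.app V ≫ (iso t).hom.app ((A.prod f).obj V) =
      (B.prod f).map (fun i => (iso (c i)).hom.app (V i)) ≫ (κ.coh f).hom.app V

/-- A 1-morphism is an equivalence if it has an inverse up to invertible 2-morphisms. -/
def Hom.IsEquivalence {A B : TwoAQFTData.{v, w, u} K O} (ζ : Hom A B) : Prop :=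
  ∃ ξ : Hom B A,
    Nonempty (InvertibleModification (ζ.toPreHom.comp ξ.toPreHom) (PreHom.id A)) ∧
    Nonempty (InvertibleModification (ξ.toPreHom.comp ζ.toPreHom) (PreHom.id B))

end Morphisms

/-! ### Induced modules -/

section IndMod

variable {K : Type u} [Field K] {I : Type} {R : I → Type u} [∀ i, Ring (R i)]
  [∀ i, Algebra K (R i)] {B : Type u} [Ring B] [Algebra K B] (φ : ∀ i, R i →ₐ[K] B)
  (V : I → Type u) [∀ i, AddCommGroup (V i)] [∀ i, Module K (V i)] [∀ i, Module (R i)ᵐᵒᵖ (V i)]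

open Classical in
/-- The relations `(v₁ ⊗ ⋯ ⊗ vᵢ r ⊗ ⋯ ⊗ vₙ) ⊗ 1 ∼ (v₁ ⊗ ⋯ ⊗ vₙ) ⊗ φᵢ(r)`; the tensor factor `B`
is written on the left. -/
def indRel : Set (B ⊗[K] PiTensorProduct K V) :=
  {x | ∃ (v : ∀ i, V i) (i : I) (r : R i),
    x = (1 : B) ⊗ₜ[K] PiTensorProduct.tprod K (Function.update v i (op r • v i)) -
      φ i r ⊗ₜ[K] PiTensorProduct.tprod K v}

/-- The induced right `B`-module `(V₁ ⊗ ⋯ ⊗ Vₙ) ⊗_{R₁ ⊗ ⋯ ⊗ Rₙ} B` along the map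
`r₁ ⊗ ⋯ ⊗ rₙ ↦ φ₁(r₁) ⋯ φₙ(rₙ)`. Since `R₁ ⊗ ⋯ ⊗ Rₙ` is generated by the images of the `Rᵢ`, it
suffices to impose the relations for elements of the single factors. -/
abbrev IndMod : Type u :=
  (B ⊗[K] PiTensorProduct K V) ⧸ Submodule.span Bᵐᵒᵖ (indRel φ V)

namespace IndMod

/-- The class of `v₁ ⊗ ⋯ ⊗ vₙ ⊗ 1`. -/
noncomputable def gen (v : ∀ i, V i) : IndMod φ V :=
  Submodule.Quotient.mk ((1 : B) ⊗ₜ[K] PiTensorProduct.tprod K v)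

lemma gen_update_add [DecidableEq I] (v : ∀ i, V i) (i : I) (x y : V i) :
    gen φ V (Function.update v i (x + y)) =
      gen φ V (Function.update v i x) + gen φ V (Function.update v i y) := by
  simp only [gen, ← Submodule.Quotient.mk_add, MultilinearMap.map_update_add,
    TensorProduct.tmul_add]

lemma gen_update_smul [DecidableEq I] (v : ∀ i, V i) (i : I) (k : K) (x : V i) :
    gen φ V (Function.update v i (k • x)) = k • gen φ V (Function.update v i x) := by
  simp only [gen, ← Submodule.Quotient.mk_smul, MultilinearMap.map_update_smul,
    TensorProduct.tmul_smul]

lemma gen_update_op [DecidableEq I] (v : ∀ i, V i) (i : I) (r : R i) :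
    gen φ V (Function.update v i (op r • v i)) = op (φ i r) • gen φ V v := by
  obtain rfl : ‹DecidableEq I› = Classical.decEq I := Subsingleton.elim _ _
  rw [gen, gen, ← Submodule.Quotient.mk_smul, Submodule.Quotient.eq]
  refine Submodule.subset_span ⟨v, i, r, ?_⟩
  rw [TensorProduct.smul_tmul']
  simp

variable {φ V}

lemma induction {p : IndMod φ V → Prop} (h₀ : p 0) (h₁ : ∀ (v : ∀ i, V i) (b : B), p (op b • gen φ V v))
    (h₂ : ∀ x y, p x → p y → p (x + y)) (x : IndMod φ V) : p x := by
  induction x using Submodule.Quotient.induction_on with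
  | _ x =>
    induction x using TensorProduct.induction_on with
    | zero => exact h₀
    | add x y hx hy => exact h₂ _ _ hx hy
    | tmul b t =>
      induction t using PiTensorProduct.induction_on with
      | smul_tprod k v =>
        have := h₁ v (k • b)
        convert this using 1
        rw [gen, ← Submodule.Quotient.mk_smul, TensorProduct.smul_tmul']
        simp only [op_smul_eq_mul, one_mul, TensorProduct.tmul_smul]
        rw [TensorProduct.smul_tmul']
      | add x y hx hy =>
        rw [TensorProduct.tmul_add]
        exact h₂ _ _ hx hy

variable {W : Type u} [AddCommGroup W]

/-- Additive maps out of an induced module which are compatible with the right actions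
(possibly twisted by `τ`) are determined by their values on generators. -/
lemma ext_gen {S : Type u} [Ring S] [Module Sᵐᵒᵖ W] (τ : B → S) (f g : IndMod φ V → W)
    (hf : ∀ x y, f (x + y) = f x + f y) (hg : ∀ x y, g (x + y) = g x + g y)
    (hf' : ∀ b x, f (op b • x) = op (τ b) • f x) (hg' : ∀ b x, g (op b • x) = op (τ b) • g x)
    (h : ∀ v, f (gen φ V v) = g (gen φ V v)) : f = g := by
  funext x
  induction x using induction with
  | h₀ =>
    have a := hf 0 0
    have b := hg 0 0
    simp only [add_zero, left_eq_add] at a b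
    rw [a, b]
  | h₁ v b => rw [hf', hg', h]
  | h₂ x y hx hy => rw [hf, hg, hx, hy]

variable {S : Type u} [Ring S] [Algebra K S] [Module K W] [Module Sᵐᵒᵖ W] [IsScalarTower K Sᵐᵒᵖ W]

lemma smul_smul_comm (k : K) (s : S) (x : W) : op s • k • x = k • op s • x :=
  smul_comm _ _ _

/-- Auxiliary map for `IndMod.lift`. -/
noncomputable def liftAux (τ : B →ₐ[K] S) (Φ : MultilinearMap K V W) :
    B ⊗[K] PiTensorProduct K V →ₗ[K] W :=
  TensorProduct.lift (LinearMap.mk₂ K (fun b t => op (τ b) • PiTensorProduct.lift Φ t)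
    (fun a b t => by rw [map_add, MulOpposite.op_add, add_smul])
    (fun k b t => by rw [map_smul, MulOpposite.op_smul, smul_assoc])
    (fun b s t => by rw [map_add, smul_add])
    (fun k b t => by rw [map_smul, smul_smul_comm]))

lemma liftAux_tmul (τ : B →ₐ[K] S) (Φ : MultilinearMap K V W) (b : B) (v : ∀ i, V i) :
    liftAux τ Φ (b ⊗ₜ PiTensorProduct.tprod K v) = op (τ b) • Φ v := by
  simp [liftAux]

lemma liftAux_smul (τ : B →ₐ[K] S) (Φ : MultilinearMap K V W) (b : B)
    (x : B ⊗[K] PiTensorProduct K V) :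
    liftAux τ Φ (op b • x) = op (τ b) • liftAux τ Φ x := by
  induction x using TensorProduct.induction_on with
  | zero => simp
  | add x y hx hy => rw [smul_add, map_add, map_add, smul_add, hx, hy]
  | tmul c t => simp [liftAux, TensorProduct.smul_tmul', mul_smul]

/-- The universal property of the induced module, twisted by an algebra homomorphism `τ`. -/
noncomputable def lift (τ : B →ₐ[K] S) (Φ : MultilinearMap K V W)
    (hΦ : ∀ [DecidableEq I] (v) (i) (r : R i),
      Φ (Function.update v i (op r • v i)) = op (τ (φ i r)) • Φ v) :
    IndMod φ V →ₗ[K] W :=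
  Submodule.liftQ ((Submodule.span Bᵐᵒᵖ (indRel φ V)).restrictScalars K) (liftAux τ Φ) (by
      intro x hx
      rw [Submodule.restrictScalars_mem] at hx
      rw [LinearMap.mem_ker]
      induction hx using Submodule.span_induction with
      | mem x hx =>
        classical
        obtain ⟨v, i, r, rfl⟩ := hx
        rw [map_sub, liftAux_tmul, liftAux_tmul, hΦ, map_one, MulOpposite.op_one, one_smul, sub_self]
      | zero => rw [map_zero]
      | add x y _ _ hx hy => rw [map_add, hx, hy, add_zero]
      | smul b x _ hx =>
        obtain ⟨b, rfl⟩ := op_surjective b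
        rw [liftAux_smul, hx, smul_zero]) ∘ₗ
    (Submodule.Quotient.restrictScalarsEquiv K (Submodule.span Bᵐᵒᵖ (indRel φ V))).symm.toLinearMap

variable (τ : B →ₐ[K] S) (Φ : MultilinearMap K V W)
    (hΦ : ∀ [DecidableEq I] (v) (i) (r : R i),
      Φ (Function.update v i (op r • v i)) = op (τ (φ i r)) • Φ v)

@[simp]
lemma lift_gen (v : ∀ i, V i) : lift τ Φ hΦ (gen φ V v) = Φ v := by
  have := liftAux_tmul τ Φ 1 v
  rw [map_one, MulOpposite.op_one, one_smul] at this
  exact this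

@[simp]
lemma lift_smul (b : B) (x : IndMod φ V) :
    lift τ Φ hΦ (op b • x) = op (τ b) • lift τ Φ hΦ x := by
  induction x using Submodule.Quotient.induction_on with
  | _ x => exact liftAux_smul τ Φ b x

variable (φ)

/-- The multilinear map underlying `gen`, precomposed with linear maps. -/
noncomputable def genMulti {V W : I → Type u} [∀ i, AddCommGroup (V i)] [∀ i, Module K (V i)]
    [∀ i, AddCommGroup (W i)] [∀ i, Module K (W i)] [∀ i, Module (R i)ᵐᵒᵖ (W i)]
    (f : ∀ i, V i →ₗ[K] W i) : MultilinearMap K V (IndMod φ W) where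
  toFun v := gen φ W fun i => f i (v i)
  map_update_add' v i x y := by
    have (z : V i) := funext (Function.apply_update (fun j => f j) v i z)
    simp only [this, map_add, gen_update_add]
  map_update_smul' v i k x := by
    have (z : V i) := funext (Function.apply_update (fun j => f j) v i z)
    simp only [this, map_smul, gen_update_smul]

lemma gen_map_op {V W : I → Type u} [∀ i, AddCommGroup (V i)] [∀ i, Module (R i)ᵐᵒᵖ (V i)]
    [∀ i, AddCommGroup (W i)] [∀ i, Module K (W i)] [∀ i, Module (R i)ᵐᵒᵖ (W i)]
    (f : ∀ i, V i → W i) [DecidableEq I] (v : ∀ i, V i) (i : I) (r s : R i)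
    (h : f i (op r • v i) = op s • f i (v i)) :
    gen φ W (fun j => f j (Function.update v i (op r • v i) j)) =
      op (φ i s) • gen φ W (fun j => f j (v j)) := by
  rw [← gen_update_op]
  congr 1
  rw [← h]
  exact funext (Function.apply_update (fun j => f j) v i _)

variable {φ} in
lemma genMulti_op {V W : I → Type u} [∀ i, AddCommGroup (V i)] [∀ i, Module K (V i)]
    [∀ i, Module (R i)ᵐᵒᵖ (V i)] [∀ i, AddCommGroup (W i)] [∀ i, Module K (W i)]
    [∀ i, Module (R i)ᵐᵒᵖ (W i)] (τ : B →ₐ[K] B) (σ : ∀ i, R i → R i)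
    (hσ : ∀ i r, φ i (σ i r) = τ (φ i r)) (f : ∀ i, V i →ₗ[K] W i)
    (hf : ∀ i r v, f i (op r • v) = op (σ i r) • f i v) [DecidableEq I] (v : ∀ i, V i) (i : I)
    (r : R i) :
    genMulti φ f (Function.update v i (op r • v i)) = op (τ (φ i r)) • genMulti φ f v := by
  rw [← hσ]
  exact gen_map_op φ (fun i => f i) v i r _ (hf i r (v i))

/-- Functoriality of the induced module, twisted by `τ`. -/
noncomputable def map {V W : I → Type u} [∀ i, AddCommGroup (V i)] [∀ i, Module K (V i)]
    [∀ i, Module (R i)ᵐᵒᵖ (V i)] [∀ i, AddCommGroup (W i)] [∀ i, Module K (W i)]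
    [∀ i, Module (R i)ᵐᵒᵖ (W i)] (τ : B →ₐ[K] B) (σ : ∀ i, R i → R i)
    (hσ : ∀ i r, φ i (σ i r) = τ (φ i r)) (f : ∀ i, V i →ₗ[K] W i)
    (hf : ∀ i r v, f i (op r • v) = op (σ i r) • f i v) : IndMod φ V →ₗ[K] IndMod φ W :=
  lift τ (genMulti φ f) (fun v i r => genMulti_op τ σ hσ f hf v i r)

/-- The multilinear map underlying `perm`. -/
noncomputable def permMulti {I' : Type} (e : I' ≃ I) (V : I → Type u) [∀ i, AddCommGroup (V i)]
    [∀ i, Module K (V i)] [∀ i, Module (R i)ᵐᵒᵖ (V i)] (φ' : ∀ i', R (e i') →ₐ[K] B) :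
    MultilinearMap K V (IndMod φ' (fun i' => V (e i'))) where
  toFun v := gen φ' (fun i' => V (e i')) (fun i' => v (e i'))
  map_update_add' v i x y := by
    classical
    obtain ⟨i, rfl⟩ := e.surjective i
    obtain rfl : ‹DecidableEq I› = Classical.decEq I := Subsingleton.elim _ _
    simp only [Function.update_comp_eq_of_injective' _ e.injective, gen_update_add]
  map_update_smul' v i k x := by
    classical
    obtain ⟨i, rfl⟩ := e.surjective i
    simp only [Function.update_comp_eq_of_injective' _ e.injective, gen_update_smul]

variable {φ} in
lemma permMulti_op {I' : Type} (e : I' ≃ I) (V : I → Type u) [∀ i, AddCommGroup (V i)]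
    [∀ i, Module K (V i)] [∀ i, Module (R i)ᵐᵒᵖ (V i)] (φ' : ∀ i', R (e i') →ₐ[K] B)
    (h : ∀ i', φ' i' = φ (e i')) [DecidableEq I] (v : ∀ i, V i) (i : I) (r : R i) :
    permMulti e V φ' (Function.update v i (op r • v i)) =
      op (AlgHom.id K B (φ i r)) • permMulti e V φ' v := by
  classical
  obtain ⟨i, rfl⟩ := e.surjective i
  simp only [permMulti, MultilinearMap.coe_mk,
    Function.update_comp_eq_of_injective' _ e.injective]
  rw [AlgHom.id_apply, ← h]
  exact gen_update_op φ' _ (fun i' => v (e i')) i r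

/-- The map on induced modules given by `[v] ↦ [v ∘ e]` for a bijection `e` of index types. -/
noncomputable def perm {I' : Type} (e : I' ≃ I) (V : I → Type u) [∀ i, AddCommGroup (V i)]
    [∀ i, Module K (V i)] [∀ i, Module (R i)ᵐᵒᵖ (V i)] (φ' : ∀ i', R (e i') →ₐ[K] B)
    (h : ∀ i', φ' i' = φ (e i')) :
    IndMod φ V →ₗ[K] IndMod φ' (fun i' => V (e i')) :=
  lift (AlgHom.id K B) (permMulti e V φ') (fun v i r => permMulti_op e V φ' h v i r)

lemma perm_gen {I' : Type} (e : I' ≃ I) (V : I → Type u) [∀ i, AddCommGroup (V i)]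
    [∀ i, Module K (V i)] [∀ i, Module (R i)ᵐᵒᵖ (V i)] (φ' : ∀ i', R (e i') →ₐ[K] B)
    (h : ∀ i', φ' i' = φ (e i')) (v : ∀ i, V i) :
    perm φ e V φ' h (gen φ V v) = gen φ' (fun i' => V (e i')) (fun i' => v (e i')) := by
  unfold perm
  rw [lift_gen (hΦ := fun v i r => permMulti_op e V φ' h v i r)]
  rfl

lemma perm_op_smul {I' : Type} (e : I' ≃ I) (V : I → Type u) [∀ i, AddCommGroup (V i)]
    [∀ i, Module K (V i)] [∀ i, Module (R i)ᵐᵒᵖ (V i)] (φ' : ∀ i', R (e i') →ₐ[K] B)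
    (h : ∀ i', φ' i' = φ (e i')) (b : B) (x : IndMod φ V) :
    perm φ e V φ' h (op b • x) = op b • perm φ e V φ' h x := by
  unfold perm
  rw [lift_smul (hΦ := fun v i r => permMulti_op e V φ' h v i r)]
  rfl

lemma sigma_update {J : I → Type} {V : (Σ i, J i) → Type u} {X : I → Type u}
    (γ : ∀ i, (∀ j, V ⟨i, j⟩) → X i) [DecidableEq I] [∀ i, DecidableEq (J i)]
    [DecidableEq (Σ i, J i)] (v : ∀ p : Σ i, J i, V p) (i : I) (j : J i) (x : V ⟨i, j⟩) :
    (fun i' => γ i' fun j' => Function.update v ⟨i, j⟩ x ⟨i', j'⟩) =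
      Function.update (fun i' => γ i' fun j' => v ⟨i', j'⟩) i
        (γ i (Function.update (fun j' => v ⟨i, j'⟩) j x)) := by
  funext i'
  by_cases h : i' = i
  · subst h
    rw [Function.update_self]
    congr 1
    funext j'
    by_cases h' : j' = j
    · subst h'; simp
    · rw [Function.update_of_ne h', Function.update_of_ne (by simpa using h')]
  · rw [Function.update_of_ne h]
    congr 1
    funext j'
    rw [Function.update_of_ne (fun e => h (congrArg Sigma.fst e))]

section Decomp

variable {J : I → Type} {T : (Σ i, J i) → Type u} [∀ p, Ring (T p)]
    [∀ p, Algebra K (T p)] (ψ : ∀ i j, T ⟨i, j⟩ →ₐ[K] R i)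
    (χ : ∀ p : Σ i, J i, T p →ₐ[K] B) (hχ : ∀ i j x, χ ⟨i, j⟩ x = φ i (ψ i j x))
    {V : (Σ i, J i) → Type u} [∀ p, AddCommGroup (V p)] [∀ p, Module K (V p)]
    [∀ p, Module (T p)ᵐᵒᵖ (V p)]

/-- The multilinear map underlying `decomp`. -/
noncomputable def decompMulti :
    MultilinearMap K V (IndMod φ fun i => IndMod (ψ i) fun j => V ⟨i, j⟩) where
  toFun v := gen φ (fun i => IndMod (ψ i) fun j => V ⟨i, j⟩) fun i => gen (ψ i) (fun j => V ⟨i, j⟩) fun j => v ⟨i, j⟩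
  map_update_add' v p x y := by
    classical
    obtain ⟨i, j⟩ := p
    simp only [sigma_update (fun i => gen (ψ i) (fun j => V ⟨i, j⟩)), gen_update_add]
  map_update_smul' v p k x := by
    classical
    obtain ⟨i, j⟩ := p
    simp only [sigma_update (fun i => gen (ψ i) (fun j => V ⟨i, j⟩)), gen_update_smul]

variable {φ} in
lemma decompMulti_op [DecidableEq (Σ i, J i)] (hχ : ∀ i j x, χ ⟨i, j⟩ x = φ i (ψ i j x))
    (v : ∀ p : Σ i, J i, V p) (p : Σ i, J i) (x : T p) :
    decompMulti φ ψ (Function.update v p (op x • v p)) =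
      op (AlgHom.id K B (χ p x)) • decompMulti φ ψ v := by
  classical
  obtain ⟨i, j⟩ := p
  have h₁ := sigma_update (fun i => gen (ψ i) fun j => V ⟨i, j⟩) v i j (op x • v ⟨i, j⟩)
  have h₂ := gen_update_op (ψ i) (fun j => V ⟨i, j⟩) (fun j => v ⟨i, j⟩) j x
  have h₃ := gen_update_op φ (fun i => IndMod (ψ i) fun j => V ⟨i, j⟩)
    (fun i => gen (ψ i) (fun j => V ⟨i, j⟩) fun j => v ⟨i, j⟩) i (ψ i j x)
  rw [AlgHom.id_apply, hχ]
  refine (congrArg (gen φ fun i => IndMod (ψ i) fun j => V ⟨i, j⟩) h₁).trans (Eq.trans ?_ h₃)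
  rw [← h₂]

/-- The map `[v] ↦ [[v₁], …, [vₙ]]` from an induced module to an iterated induced module. -/
noncomputable def decomp :
    IndMod χ V →ₗ[K] IndMod φ fun i => IndMod (ψ i) fun j => V ⟨i, j⟩ :=
  lift (AlgHom.id K B) (decompMulti φ ψ) (fun v p x => decompMulti_op ψ χ hχ v p x)

lemma decomp_gen (v : ∀ p : Σ i, J i, V p) :
    decomp φ ψ χ hχ (gen χ V v) =
      gen φ (fun i => IndMod (ψ i) fun j => V ⟨i, j⟩) fun i => gen (ψ i) (fun j => V ⟨i, j⟩) fun j => v ⟨i, j⟩ := by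
  unfold decomp
  rw [lift_gen (hΦ := fun v p x => decompMulti_op ψ χ hχ v p x)]
  rfl

lemma decomp_op_smul (b : B) (x : IndMod χ V) :
    decomp φ ψ χ hχ (op b • x) = op b • decomp φ ψ χ hχ x := by
  unfold decomp
  rw [lift_smul (hΦ := fun v p x => decompMulti_op ψ χ hχ v p x)]
  rfl

end Decomp

variable (V) in
lemma map_gen {W : I → Type u} [∀ i, AddCommGroup (W i)] [∀ i, Module K (W i)]
    [∀ i, Module (R i)ᵐᵒᵖ (W i)] (τ : B →ₐ[K] B) (σ : ∀ i, R i → R i)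
    (hσ : ∀ i r, φ i (σ i r) = τ (φ i r)) (f : ∀ i, V i →ₗ[K] W i)
    (hf : ∀ i r v, f i (op r • v) = op (σ i r) • f i v) (v : ∀ i, V i) :
    map φ τ σ hσ f hf (gen φ V v) = gen φ W fun i => f i (v i) := by
  unfold map
  rw [lift_gen (hΦ := fun v i r => genMulti_op τ σ hσ f hf v i r)]
  rfl

lemma map_op_smul {V W : I → Type u} [∀ i, AddCommGroup (V i)] [∀ i, Module K (V i)]
    [∀ i, Module (R i)ᵐᵒᵖ (V i)] [∀ i, AddCommGroup (W i)] [∀ i, Module K (W i)]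
    [∀ i, Module (R i)ᵐᵒᵖ (W i)] (τ : B →ₐ[K] B) (σ : ∀ i, R i → R i)
    (hσ : ∀ i r, φ i (σ i r) = τ (φ i r)) (f : ∀ i, V i →ₗ[K] W i)
    (hf : ∀ i r v, f i (op r • v) = op (σ i r) • f i v) (b : B) (x : IndMod φ V) :
    map φ τ σ hσ f hf (op b • x) = op (τ b) • map φ τ σ hσ f hf x := by
  unfold map
  rw [lift_smul (hΦ := fun v i r => genMulti_op τ σ hσ f hf v i r)]

lemma update_const_unit {X : Type u} [DecidableEq Unit] (x z : X) :
    Function.update (fun _ : Unit => x) () z = fun _ => z :=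
  funext fun _ => by simp

/-- The map `v ↦ [v]` for the identity. -/
noncomputable def unit (V : Type u) [AddCommGroup V] [Module K V] [Module Bᵐᵒᵖ V]
    (ι : Unit → B →ₐ[K] B) : V →ₗ[K] IndMod ι (fun _ => V) where
  toFun v := gen ι (fun _ => V) (fun _ => v)
  map_add' x y := by
    have := gen_update_add ι (fun _ => V) (fun _ => x) () x y
    simpa only [update_const_unit] using this
  map_smul' k x := by
    have := gen_update_smul ι (fun _ => V) (fun _ => x) () k x
    simp only [update_const_unit] at this
    exact this

lemma unit_smul (V : Type u) [AddCommGroup V] [Module K V] [Module Bᵐᵒᵖ V]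
    (ι : Unit → B →ₐ[K] B) (hι : ι () = AlgHom.id K B) (b : B) (v : V) :
    unit V ι (op b • v) = op b • unit V ι v := by
  have := gen_update_op ι (fun _ => V) (fun _ => v) () b
  simp only [update_const_unit, hι, AlgHom.id_apply] at this
  exact this

variable {φ}

lemma hom_ext [Module Bᵐᵒᵖ W] (f g : IndMod φ V →ₗ[Bᵐᵒᵖ] W)
    (h : ∀ v, f (gen φ V v) = g (gen φ V v)) : f = g :=
  DFunLike.coe_injective (ext_gen (fun b => b) f g f.map_add g.map_add
    (fun b => f.map_smul (op b)) (fun b => g.map_smul (op b)) h)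

end IndMod

end IndMod

/-! ### Equivariant modules -/

section EqMod

variable {K : Type u} [Field K] {G : Type u} [Group G] {A : Type u} [Ring A] [Algebra K A]

/-- A `G`-equivariant right module over a `K`-algebra `A` on which `G` acts by `act`: a
`K`-linear representation of `G` with a compatible right `A`-action. -/
structure EqMod (act : G →* (A →ₐ[K] A)) where
  carrier : Type u
  [addCommGroup : AddCommGroup carrier]
  [module : Module K carrier]
  [rightModule : Module Aᵐᵒᵖ carrier]
  [isScalarTower : IsScalarTower K Aᵐᵒᵖ carrier]
  ρ : Representation K G carrier
  ρ_smul : ∀ (g : G) (a : A) (v : carrier), ρ g (op a • v) = op (act g a) • ρ g v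

namespace EqMod

variable {act : G →* (A →ₐ[K] A)}

attribute [instance] addCommGroup module rightModule isScalarTower

instance : CoeSort (EqMod act) (Type u) := ⟨EqMod.carrier⟩

/-- The `K`-module of equivariant module homomorphisms. -/
def homSubmodule (V W : EqMod act) : Submodule K (V →ₗ[Aᵐᵒᵖ] W) where
  carrier := {f | ∀ g v, f (V.ρ g v) = W.ρ g (f v)}
  add_mem' hf hg g v := by simp [hf g v, hg g v]
  zero_mem' g v := by simp
  smul_mem' r f hf g v := by simp [hf g v]

instance : Category (EqMod act) where
  Hom V W := homSubmodule V W
  id V := ⟨LinearMap.id, fun _ _ => rfl⟩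
  comp f g := ⟨g.1.comp f.1, fun γ v => by simp [f.2 γ v, g.2 γ (f.1 v)]⟩

instance : Preadditive (EqMod act) where
  homGroup V W := inferInstanceAs (AddCommGroup (homSubmodule V W))
  add_comp _ _ _ f f' g := Subtype.ext (LinearMap.ext fun v => map_add g.1 (f.1 v) (f'.1 v))
  comp_add _ _ _ f g g' := rfl

instance : Linear K (EqMod act) where
  homModule V W := inferInstanceAs (Module K (homSubmodule V W))
  smul_comp _ _ _ r f g := Subtype.ext (LinearMap.ext fun v => by
    exact g.1.map_smul_of_tower r (f.1 v))
  comp_smul _ _ _ _ _ _ := rfl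

/-- The linear map underlying a morphism. -/
def lin {V W : EqMod act} (f : V ⟶ W) : V →ₗ[Aᵐᵒᵖ] W := f.1

lemma lin_ρ {V W : EqMod act} (f : V ⟶ W) (g : G) (v : V) : lin f (V.ρ g v) = W.ρ g (lin f v) :=
  f.2 g v

lemma lin_smul {V W : EqMod act} (f : V ⟶ W) (k : K) (v : V) : lin f (k • v) = k • lin f v :=
  (lin f).map_smul_of_tower k v

lemma lin_comp {U V W : EqMod act} (f : U ⟶ V) (g : V ⟶ W) (v : U) :
    lin (f ≫ g) v = lin g (lin f v) := rfl

lemma hom_ext {V W : EqMod act} {f g : V ⟶ W} (h : ∀ v, lin f v = lin g v) : f = g :=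
  Subtype.ext (LinearMap.ext h)

/-- Constructor for morphisms. -/
def mkHom {V W : EqMod act} (f : V →ₗ[K] W) (h : ∀ (a : A) v, f (op a • v) = op a • f v)
    (h' : ∀ g v, f (V.ρ g v) = W.ρ g (f v)) : V ⟶ W :=
  ⟨{ toFun := f, map_add' := f.map_add, map_smul' := fun a v => h a.unop v }, h'⟩

lemma lin_mkHom {V W : EqMod act} (f : V →ₗ[K] W) (h) (h') (v : V) :
    lin (mkHom f h h') v = f v := rfl

end EqMod

end EqMod

/-! ### Induction functors for equivariant modules -/

namespace EqMod

section Induction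

variable {K : Type u} [Field K] {G : Type u} [Group G] {I : Type} {R : I → Type u}
  [∀ i, Ring (R i)] [∀ i, Algebra K (R i)] {actR : ∀ i, G →* (R i →ₐ[K] R i)}
  {B : Type u} [Ring B] [Algebra K B] {actB : G →* (B →ₐ[K] B)} (φ : ∀ i, R i →ₐ[K] B)
  (hφ : ∀ i g r, φ i (actR i g r) = actB g (φ i r))

/-- The induced equivariant module `(V₁ ⊗ ⋯ ⊗ Vₙ) ⊗_{R₁ ⊗ ⋯ ⊗ Rₙ} B` with the diagonal
`G`-action. -/
noncomputable def ind (V : ∀ i, EqMod (actR i)) : EqMod actB where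
  carrier := IndMod φ (fun i => (V i).carrier)
  ρ :=
    { toFun := fun g => IndMod.map φ (actB g) (fun i => actR i g) (fun i => hφ i g)
        (fun i => (V i).ρ g) (fun i r v => (V i).ρ_smul g r v)
      map_one' := DFunLike.coe_injective (IndMod.ext_gen (fun b => b) _ _
        (map_add _) (fun _ _ => rfl)
        (fun b x => by
          refine (IndMod.map_op_smul _ _ _ _ _ _ b x).trans ?_
          rw [show actB 1 b = b by rw [map_one, AlgHom.one_apply]])
        (fun _ _ => rfl) (fun v => by
          rw [IndMod.map_gen]
          simp only [map_one, Module.End.one_apply]))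
      map_mul' := fun g h => DFunLike.coe_injective (IndMod.ext_gen (actB (g * h)) _ _
        (map_add _) (map_add _)
        (fun b x => IndMod.map_op_smul _ _ _ _ _ _ b x)
        (fun b x => by
          rw [Module.End.mul_apply, Module.End.mul_apply, IndMod.map_op_smul, IndMod.map_op_smul,
            map_mul, AlgHom.mul_apply])
        (fun v => by
          rw [Module.End.mul_apply, IndMod.map_gen, IndMod.map_gen, IndMod.map_gen]
          simp only [map_mul, Module.End.mul_apply])) }
  ρ_smul g a v := IndMod.map_op_smul φ (actB g) (fun i => actR i g) (fun i => hφ i g)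
    (fun i => (V i).ρ g) (fun i r v => (V i).ρ_smul g r v) a v

/-- The generator `[v₁, …, vₙ]` of an induced equivariant module. -/
noncomputable def gen (V : ∀ i, EqMod (actR i)) (v : ∀ i, V i) : ind φ hφ V :=
  IndMod.gen φ (fun i => (V i).carrier) v

lemma ind_ρ_gen (V : ∀ i, EqMod (actR i)) (g : G) (v : ∀ i, V i) :
    (ind φ hφ V).ρ g (gen φ hφ V v) = gen φ hφ V (fun i => (V i).ρ g (v i)) :=
  IndMod.map_gen φ (fun i => (V i).carrier) (actB g) (fun i => actR i g) (fun i => hφ i g)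
    (fun i => (V i).ρ g) (fun i r v => (V i).ρ_smul g r v) v

variable {φ hφ}

lemma ind_hom_ext {V : ∀ i, EqMod (actR i)} {W : EqMod actB} {f g : ind φ hφ V ⟶ W}
    (h : ∀ v, lin f (gen φ hφ V v) = lin g (gen φ hφ V v)) : f = g :=
  Subtype.ext (IndMod.hom_ext _ _ h)

lemma ind_ext {V : ∀ i, EqMod (actR i)} {W : EqMod actB} (τ : B → B) (f g : ind φ hφ V →+ W)
    (hf : ∀ (b : B) x, f (op b • x) = op (τ b) • f x)
    (hg : ∀ (b : B) x, g (op b • x) = op (τ b) • g x)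
    (h : ∀ v, f (gen φ hφ V v) = g (gen φ hφ V v)) : f = g :=
  DFunLike.coe_injective (IndMod.ext_gen τ f g f.map_add g.map_add hf hg h)

/-- Morphisms out of an induced equivariant module: equivariance can be checked on generators. -/
noncomputable def indMk {V : ∀ i, EqMod (actR i)} {W : EqMod actB} (f : ind φ hφ V →ₗ[K] W)
    (h : ∀ (b : B) x, f (op b • x) = op b • f x)
    (h' : ∀ g v, f (gen φ hφ V fun i => (V i).ρ g (v i)) = W.ρ g (f (gen φ hφ V v))) :
    ind φ hφ V ⟶ W :=
  mkHom f h (fun g x => DFunLike.congr_fun (ind_ext (actB g)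
    (f.toAddMonoidHom.comp ((ind φ hφ V).ρ g).toAddMonoidHom)
    ((W.ρ g).toAddMonoidHom.comp f.toAddMonoidHom)
    (fun b x => (congrArg f ((ind φ hφ V).ρ_smul g b x)).trans (h _ _))
    (fun b x => (congrArg _ (h b x)).trans (W.ρ_smul g b _))
    (fun v => (congrArg f (ind_ρ_gen φ hφ V g v)).trans (h' g v))) x)

lemma lin_indMk {V : ∀ i, EqMod (actR i)} {W : EqMod actB} (f : ind φ hφ V →ₗ[K] W)
    (h : ∀ (b : B) x, f (op b • x) = op b • f x) (h') (x : ind φ hφ V) :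
    lin (indMk f h h') x = f x := rfl

variable (φ hφ)

/-- The action of the induction functor on morphisms. -/
noncomputable def indMap {V W : ∀ i, EqMod (actR i)} (f : ∀ i, V i ⟶ W i) :
    ind φ hφ V ⟶ ind φ hφ W :=
  indMk (V := V) (W := ind φ hφ W)
    (IndMod.map φ (AlgHom.id K B) (fun _ r => r) (fun _ _ => rfl)
      (fun i => (lin (f i)).restrictScalars K) (fun i r v => (lin (f i)).map_smul (op r) v) :)
    (fun b x => IndMod.map_op_smul φ _ _ _ _ _ b x)
    (fun g v => by
      refine (IndMod.map_gen φ _ _ _ _ _ _ _).trans (Eq.trans ?_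
        (congrArg _ (IndMod.map_gen φ _ _ _ _ _ _ _).symm))
      exact Eq.trans (congrArg (gen φ hφ W) (funext fun i => lin_ρ (f i) g (v i)))
        (ind_ρ_gen φ hφ W g _).symm)

lemma indMap_gen {V W : ∀ i, EqMod (actR i)} (f : ∀ i, V i ⟶ W i) (v : ∀ i, V i) :
    lin (indMap φ hφ f) (gen φ hφ V v) = gen φ hφ W (fun i => lin (f i) (v i)) :=
  IndMod.map_gen φ _ (AlgHom.id K B) (fun _ r => r) (fun _ _ => rfl)
    (fun i => (lin (f i)).restrictScalars K) (fun i r v => (lin (f i)).map_smul (op r) v) v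

/-- The functor `(V₁, …, Vₙ) ↦ (V₁ ⊗ ⋯ ⊗ Vₙ) ⊗_{R₁ ⊗ ⋯ ⊗ Rₙ} B` for equivariant modules. -/
noncomputable def indFunctor : (∀ i, EqMod (actR i)) ⥤ EqMod actB where
  obj V := ind φ hφ V
  map f := indMap φ hφ f
  map_id V := ind_hom_ext fun v => indMap_gen φ hφ _ v
  map_comp f g := ind_hom_ext fun v => by
    rw [lin_comp, indMap_gen, indMap_gen, indMap_gen]
    rfl

end Induction

end EqMod

/-! ### Coherence maps for induced equivariant modules -/

namespace EqMod

section Coherence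

variable {K : Type u} [Field K] {G : Type u} [Group G] {I : Type} {R : I → Type u}
  [∀ i, Ring (R i)] [∀ i, Algebra K (R i)] {actR : ∀ i, G →* (R i →ₐ[K] R i)}
  {B : Type u} [Ring B] [Algebra K B] {actB : G →* (B →ₐ[K] B)} (φ : ∀ i, R i →ₐ[K] B)
  (hφ : ∀ i g r, φ i (actR i g r) = actB g (φ i r))

section Decomp

variable {J : I → Type} {T : (Σ i, J i) → Type u} [∀ p, Ring (T p)]
  [∀ p, Algebra K (T p)] {actT : ∀ p, G →* (T p →ₐ[K] T p)}
  (ψ : ∀ i j, T ⟨i, j⟩ →ₐ[K] R i)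
  (hψ : ∀ i j g r, ψ i j (actT ⟨i, j⟩ g r) = actR i g (ψ i j r))
  (χ : ∀ p : Σ i, J i, T p →ₐ[K] B)
  (hχ' : ∀ (p : Σ i, J i) g r, χ p (actT p g r) = actB g (χ p r))
  (hχ : ∀ i j x, χ ⟨i, j⟩ x = φ i (ψ i j x))

/-- The linear map underlying `decompApp`. -/
noncomputable def decompLin (V : ∀ p : Σ i, J i, EqMod (actT p)) :
    ind χ hχ' V →ₗ[K] ind φ hφ fun i => ind (ψ i) (hψ i) fun j => V ⟨i, j⟩ :=
  (IndMod.decomp φ ψ χ hχ (V := fun p => (V p).carrier) :)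

lemma decompLin_gen (V : ∀ p : Σ i, J i, EqMod (actT p)) (v : ∀ p, V p) :
    decompLin φ hφ ψ hψ χ hχ' hχ V (gen χ hχ' V v) =
      gen φ hφ (fun i => ind (ψ i) (hψ i) fun j => V ⟨i, j⟩)
        fun i => gen (ψ i) (hψ i) (fun j => V ⟨i, j⟩) fun j => v ⟨i, j⟩ :=
  IndMod.decomp_gen φ ψ χ hχ (V := fun p => (V p).carrier) v

lemma decompLin_op_smul (V : ∀ p : Σ i, J i, EqMod (actT p)) (b : B) (x : ind χ hχ' V) :
    decompLin φ hφ ψ hψ χ hχ' hχ V (op b • x) = op b • decompLin φ hφ ψ hψ χ hχ' hχ V x :=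
  IndMod.decomp_op_smul φ ψ χ hχ (V := fun p => (V p).carrier) b x

/-- The coherence map `[v] ↦ [[v₁], …, [vₙ]]`. -/
noncomputable def decompApp (V : ∀ p : Σ i, J i, EqMod (actT p)) :
    ind χ hχ' V ⟶ ind φ hφ fun i => ind (ψ i) (hψ i) fun j => V ⟨i, j⟩ :=
  indMk (decompLin φ hφ ψ hψ χ hχ' hχ V) (decompLin_op_smul φ hφ ψ hψ χ hχ' hχ V)
    (fun g v => by
      rw [decompLin_gen, decompLin_gen, ind_ρ_gen]
      exact congrArg (gen φ hφ _) (funext fun i => (ind_ρ_gen (ψ i) (hψ i) _ g _).symm))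

lemma decompApp_gen (V : ∀ p : Σ i, J i, EqMod (actT p)) (v : ∀ p, V p) :
    lin (decompApp φ hφ ψ hψ χ hχ' hχ V) (gen χ hχ' V v) =
      gen φ hφ _ fun i => gen (ψ i) (hψ i) (fun j => V ⟨i, j⟩) fun j => v ⟨i, j⟩ :=
  decompLin_gen φ hφ ψ hψ χ hχ' hχ V v

/-- The coherence map `[v] ↦ [[v₁], …, [vₙ]]` as a natural transformation. -/
noncomputable def decomp :
    indFunctor χ hχ' ⟶ sigmaCurry (fun i j => EqMod (actT ⟨i, j⟩)) ⋙
      Functor.pi (fun i => indFunctor (ψ i) (hψ i)) ⋙ indFunctor φ hφ where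
  app V := decompApp φ hφ ψ hψ χ hχ' hχ V
  naturality V W f := ind_hom_ext fun v => by
    refine (congrArg _ (indMap_gen χ hχ' f v)).trans
      ((decompApp_gen φ hφ ψ hψ χ hχ' hχ W _).trans ?_)
    refine Eq.trans ?_ (congrArg (lin (indMap φ hφ fun i =>
      indMap (ψ i) (hψ i) fun j => f ⟨i, j⟩)) (decompApp_gen φ hφ ψ hψ χ hχ' hχ V v)).symm
    refine Eq.trans ?_ (indMap_gen φ hφ _ _).symm
    exact congrArg (gen φ hφ _) (funext fun i => (indMap_gen (ψ i) (hψ i) _ _).symm)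

end Decomp

/-- The coherence map `v ↦ [v]`. -/
noncomputable def unitApp (ι : Unit → B →ₐ[K] B) (hι : ∀ i g r, ι i (actB g r) = actB g (ι i r))
    (hι' : ι () = AlgHom.id K B) (V : EqMod actB) : V ⟶ ind ι hι fun _ => V :=
  mkHom (W := ind ι hι fun _ => V) (IndMod.unit V.carrier ι :)
    (fun b v => IndMod.unit_smul V.carrier ι hι' b v)
    (fun g v => (ind_ρ_gen ι hι (fun _ => V) g (fun _ => v)).symm)

/-- The coherence map `v ↦ [v]` as a natural transformation. -/
noncomputable def unit (ι : Unit → B →ₐ[K] B) (hι : ∀ i g r, ι i (actB g r) = actB g (ι i r))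
    (hι' : ι () = AlgHom.id K B) :
    𝟭 (EqMod actB) ⟶ Functor.pi' (fun _ : Unit => 𝟭 (EqMod actB)) ⋙ indFunctor ι hι where
  app V := unitApp ι hι hι' V
  naturality V W f := hom_ext fun v => (indMap_gen ι hι (V := fun _ => V) (W := fun _ => W)
    (fun _ => f) (fun _ => v)).symm

section Perm

variable {I' : Type} (e : I' ≃ I) (φ' : ∀ i', R (e i') →ₐ[K] B)
  (hφ' : ∀ i g r, φ' i (actR (e i) g r) = actB g (φ' i r)) (h : ∀ i', φ' i' = φ (e i'))

/-- The coherence map `[v] ↦ [v ∘ e]` for a bijection `e` of index types. -/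
noncomputable def permApp (V : ∀ i, EqMod (actR i)) :
    ind φ hφ V ⟶ ind φ' hφ' fun i' => V (e i') :=
  indMk (V := V) (W := ind φ' hφ' fun i' => V (e i'))
    (IndMod.perm φ e (fun i => (V i).carrier) φ' h :)
    (fun b x => IndMod.perm_op_smul φ e (fun i => (V i).carrier) φ' h b x)
    (fun g v => by
      refine (IndMod.perm_gen φ e (fun i => (V i).carrier) φ' h _).trans
        (Eq.trans ?_ (congrArg _ (IndMod.perm_gen φ e (fun i => (V i).carrier) φ' h v).symm))
      exact (ind_ρ_gen φ' hφ' (fun i' => V (e i')) g _).symm)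

lemma permApp_gen (V : ∀ i, EqMod (actR i)) (v : ∀ i, V i) :
    lin (permApp φ hφ e φ' hφ' h V) (gen φ hφ V v) =
      gen φ' hφ' (fun i' => V (e i')) fun i' => v (e i') :=
  IndMod.perm_gen φ e (fun i => (V i).carrier) φ' h v

/-- The coherence map `[v] ↦ [v ∘ e]` as a natural transformation. -/
noncomputable def perm :
    indFunctor φ hφ ⟶ reindex e (fun i => EqMod (actR i)) ⋙ indFunctor φ' hφ' where
  app V := permApp φ hφ e φ' hφ' h V
  naturality V W f := ind_hom_ext fun v => by
    refine (congrArg _ (indMap_gen φ hφ f v)).trans ((permApp_gen φ hφ e φ' hφ' h W _).trans ?_)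
    refine Eq.trans ?_ (congrArg (lin (indMap φ' hφ' (V := fun i' => V (e i'))
      (W := fun i' => W (e i')) fun i' => f (e i'))) (permApp_gen φ hφ e φ' hφ' h V v)).symm
    exact (indMap_gen φ' hφ' (V := fun i' => V (e i')) (W := fun i' => W (e i')) _ _).symm

end Perm

end Coherence

end EqMod

/-! ### The gauging construction -/

section Gauging

/-- A `G`-equivariant AQFT: an AQFT with a `G`-action by AQFT automorphisms. -/
structure EquivariantAQFT (K : Type u) [Field K] {C : Type w} [Category.{v} C]
    (O : Orthogonality C) (G : Type u) [Group G] where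
  aqft : AQFT.{v, w, u} K O
  ρ : G →* Aut aqft

variable {K : Type u} [Field K] {C : Type w} [Category.{v} C] {O : Orthogonality C}
  {G : Type u} [Group G]

namespace EquivariantAQFT

variable (A : EquivariantAQFT.{v, w, u} K O G)

/-- The action of `G` on the algebra `𝔄(c)`. -/
def act (c : C) : G →* (A.aqft.obj.obj c →ₐ[K] A.aqft.obj.obj c) where
  toFun g := ((A.ρ g).hom.hom.app c).hom
  map_one' := by rw [map_one]; rfl
  map_mul' g h := by rw [map_mul]; rfl

lemma map_act {c t : C} (f : c ⟶ t) (g : G) (a : A.aqft.obj.obj c) :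
    (A.aqft.obj.map f).hom (A.act c g a) = A.act t g ((A.aqft.obj.map f).hom a) :=
  congrArg (fun k => AlgCat.Hom.hom k a) ((A.ρ g).hom.hom.naturality f).symm

lemma map_comp_apply {b c t : C} (g : b ⟶ c) (f : c ⟶ t) (a : A.aqft.obj.obj b) :
    (A.aqft.obj.map (g ≫ f)).hom a = (A.aqft.obj.map f).hom ((A.aqft.obj.map g).hom a) :=
  congrArg (fun k => AlgCat.Hom.hom k a) (A.aqft.obj.map_comp g f)

lemma map_id_eq (t : C) : (A.aqft.obj.map (𝟙 t)).hom = AlgHom.id K (A.aqft.obj.obj t) :=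
  congrArg AlgCat.Hom.hom (A.aqft.obj.map_id t)

/-- The functor `(V₁, …, Vₙ) ↦ (V₁ ⊗ ⋯ ⊗ Vₙ) ⊗_{𝔄(c₁) ⊗ ⋯ ⊗ 𝔄(cₙ)} 𝔄(t)`. -/
noncomputable def gaugingProd {I : Type} {c : I → C} {t : C} (f : Op O c t) :
    (∀ i, EqMod (A.act (c i))) ⥤ EqMod (A.act t) :=
  EqMod.indFunctor (fun i => (A.aqft.obj.map (f.hom i)).hom)
    (fun i g r => A.map_act (f.hom i) g r)

/-- The composition coherence of the gauging construction. -/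
noncomputable def gaugingDecomp {I : Type} {J : I → Type} {b : ∀ i, J i → C}
    {a : I → C} {t : C} (f : Op O a t) (g : ∀ i, Op O (b i) (a i)) :
    A.gaugingProd (f.comp g) ⟶ sigmaCurry (fun i j => EqMod (A.act (b i j))) ⋙
      Functor.pi (fun i => A.gaugingProd (g i)) ⋙ A.gaugingProd f :=
  EqMod.decomp (T := fun p => A.aqft.obj.obj (b p.1 p.2)) (actT := fun p => A.act (b p.1 p.2))
    (fun i => (A.aqft.obj.map (f.hom i)).hom)
    (fun i g r => A.map_act (f.hom i) g r) (fun i j => (A.aqft.obj.map ((g i).hom j)).hom)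
    (fun i j g' r => A.map_act ((g i).hom j) g' r)
    (fun p => (A.aqft.obj.map ((f.comp g).hom p)).hom)
    (fun p g' r => A.map_act ((f.comp g).hom p) g' r)
    (fun i j x => A.map_comp_apply ((g i).hom j) (f.hom i) x)

/-- The categorified orbifold construction (gauging): to `c` it assigns the category of
`G`-equivariant right `𝔄(c)`-modules, and its factorization products are
`(V₁, …, Vₙ) ↦ (V₁ ⊗ ⋯ ⊗ Vₙ) ⊗_{𝔄(c₁) ⊗ ⋯ ⊗ 𝔄(cₙ)} 𝔄(t)` with the diagonal `G`-action. -/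
noncomputable def gauging : TwoAQFTData.{v, w, u} K O where
  obj c := { carrier := EqMod (A.act c) }
  prod f := A.gaugingProd f
  decomp f g := A.gaugingDecomp f g
  unit t := EqMod.unit (fun i => (A.aqft.obj.map ((Op.id O t).hom i)).hom)
    (fun i g r => A.map_act ((Op.id O t).hom i) g r) (A.map_id_eq t)
  perm {_ _} _ _ e {_ _} f f' h := EqMod.perm (fun i => (A.aqft.obj.map (f.hom i)).hom)
    (fun i g r => A.map_act (f.hom i) g r) e (fun i => (A.aqft.obj.map (f'.hom i)).hom)
    (fun i g r => A.map_act (f'.hom i) g r) (fun i' => by subst h; rfl)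

end EquivariantAQFT

end Gauging

/-! ### The inclusion of AQFTs into 2AQFTs -/

section ModInd

variable {K : Type u} [Field K] {I : Type} {R : I → Type u}
  [∀ i, Ring (R i)] [∀ i, Algebra K (R i)] {B : Type u} [Ring B] [Algebra K B]
  (φ : ∀ i, R i →ₐ[K] B)

/-- The induced right module `(V₁ ⊗ ⋯ ⊗ Vₙ) ⊗_{R₁ ⊗ ⋯ ⊗ Rₙ} B`. Right modules over an algebra are
left modules over the opposite algebra. -/
noncomputable def modInd (V : ∀ i, ModuleCat.{u} (R i)ᵐᵒᵖ) : ModuleCat.{u} Bᵐᵒᵖ :=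
  ModuleCat.of Bᵐᵒᵖ (IndMod φ fun i => V i)

/-- The generator `[v₁, …, vₙ]` of an induced module. -/
noncomputable def modGen (V : ∀ i, ModuleCat.{u} (R i)ᵐᵒᵖ) (v : ∀ i, V i) : modInd φ V :=
  IndMod.gen φ (fun i => V i) v

lemma modGen_update_add (V : ∀ i, ModuleCat.{u} (R i)ᵐᵒᵖ) [DecidableEq I] (v : ∀ i, V i) (i : I)
    (x y : V i) :
    modGen φ V (Function.update v i (x + y)) =
      modGen φ V (Function.update v i x) + modGen φ V (Function.update v i y) :=
  IndMod.gen_update_add φ (fun i => V i) v i x y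

lemma modGen_update_op (V : ∀ i, ModuleCat.{u} (R i)ᵐᵒᵖ) [DecidableEq I] (v : ∀ i, V i) (i : I)
    (r : R i) :
    modGen φ V (Function.update v i (op r • v i)) = op (φ i r) • modGen φ V v :=
  IndMod.gen_update_op φ (fun i => V i) v i r

variable {φ}

lemma modInd_hom_ext {V : ∀ i, ModuleCat.{u} (R i)ᵐᵒᵖ} {W : ModuleCat.{u} Bᵐᵒᵖ}
    {f g : modInd φ V ⟶ W} (h : ∀ v, f.hom (modGen φ V v) = g.hom (modGen φ V v)) : f = g :=
  ModuleCat.hom_ext (IndMod.hom_ext f.hom g.hom h)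

/-- The universal property of the induced module, as a multilinear map. -/
noncomputable def modMulti {V : ∀ i, ModuleCat.{u} (R i)ᵐᵒᵖ} {W : ModuleCat.{u} Bᵐᵒᵖ}
    (Φ : (∀ i, V i) → W)
    (h : ∀ [DecidableEq I] (v : ∀ i, V i) (i) (x y : V i), Φ (Function.update v i (x + y)) =
      Φ (Function.update v i x) + Φ (Function.update v i y))
    (h' : ∀ [DecidableEq I] (v : ∀ i, V i) (i) (r : R i),
      Φ (Function.update v i (op r • v i)) = op (φ i r) • Φ v) :
    MultilinearMap K (fun i => V i) W where
  toFun := Φ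
  map_update_add' := h
  map_update_smul' v i k x := by
    have := h' (Function.update v i x) i (algebraMap K (R i) k)
    rw [Function.update_self, Function.update_idem, AlgHom.commutes] at this
    exact this

/-- The universal property of the induced module. -/
noncomputable def modLift {V : ∀ i, ModuleCat.{u} (R i)ᵐᵒᵖ} {W : ModuleCat.{u} Bᵐᵒᵖ}
    (Φ : (∀ i, V i) → W)
    (h : ∀ [DecidableEq I] (v : ∀ i, V i) (i) (x y : V i), Φ (Function.update v i (x + y)) =
      Φ (Function.update v i x) + Φ (Function.update v i y))
    (h' : ∀ [DecidableEq I] (v : ∀ i, V i) (i) (r : R i),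
      Φ (Function.update v i (op r • v i)) = op (φ i r) • Φ v) : modInd φ V ⟶ W :=
  ModuleCat.ofHom
    { toFun := IndMod.lift (AlgHom.id K B) (modMulti Φ h h') (fun v i r => h' v i r)
      map_add' := fun x y => map_add _ x y
      map_smul' := fun b x => IndMod.lift_smul (AlgHom.id K B) (modMulti Φ h h')
        (fun v i r => h' v i r) b.unop x }

lemma modLift_gen {V : ∀ i, ModuleCat.{u} (R i)ᵐᵒᵖ} {W : ModuleCat.{u} Bᵐᵒᵖ}
    (Φ : (∀ i, V i) → W) (h) (h') (v : ∀ i, V i) :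
    (modLift (φ := φ) Φ h h').hom (modGen φ V v) = Φ v :=
  IndMod.lift_gen (AlgHom.id K B) (modMulti Φ h h') (fun v i r => h' v i r) v

variable (φ)

/-- The action of the induction functor on morphisms. -/
noncomputable def modMap {V W : ∀ i, ModuleCat.{u} (R i)ᵐᵒᵖ} (f : ∀ i, V i ⟶ W i) :
    modInd φ V ⟶ modInd φ W :=
  modLift (fun v => modGen φ W fun i => (f i).hom (v i))
    (fun v i x y => by
      have (z : V i) := funext (Function.apply_update (fun j => (f j).hom) v i z)
      simp only [this, map_add, modGen_update_add])
    (fun v i r => by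
      have (z : V i) := funext (Function.apply_update (fun j => (f j).hom) v i z)
      rw [this, map_smul]
      exact modGen_update_op φ W (fun i => (f i).hom (v i)) i r)

lemma modMap_gen {V W : ∀ i, ModuleCat.{u} (R i)ᵐᵒᵖ} (f : ∀ i, V i ⟶ W i) (v : ∀ i, V i) :
    (modMap φ f).hom (modGen φ V v) = modGen φ W fun i => (f i).hom (v i) :=
  modLift_gen _ _ _ v

/-- The functor `(V₁, …, Vₙ) ↦ (V₁ ⊗ ⋯ ⊗ Vₙ) ⊗_{R₁ ⊗ ⋯ ⊗ Rₙ} B`. -/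
noncomputable def modFunctor : (∀ i, ModuleCat.{u} (R i)ᵐᵒᵖ) ⥤ ModuleCat.{u} Bᵐᵒᵖ where
  obj V := modInd φ V
  map f := modMap φ f
  map_id V := modInd_hom_ext fun v => modMap_gen φ _ v
  map_comp f g := modInd_hom_ext fun v => by
    rw [ModuleCat.hom_comp, LinearMap.comp_apply, modMap_gen, modMap_gen, modMap_gen]
    rfl

section Decomp

variable {J : I → Type} {T : (Σ i, J i) → Type u} [∀ p, Ring (T p)] [∀ p, Algebra K (T p)]
  (ψ : ∀ i j, T ⟨i, j⟩ →ₐ[K] R i) (χ : ∀ p : Σ i, J i, T p →ₐ[K] B)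
  (hχ : ∀ i j x, χ ⟨i, j⟩ x = φ i (ψ i j x))

/-- The coherence map `[v] ↦ [[v₁], …, [vₙ]]`. -/
noncomputable def modDecompApp (V : ∀ p : Σ i, J i, ModuleCat.{u} (T p)ᵐᵒᵖ) :
    modInd χ V ⟶ modInd φ fun i => modInd (ψ i) fun j => V ⟨i, j⟩ :=
  modLift (fun v => modGen φ (fun i => modInd (ψ i) fun j => V ⟨i, j⟩) fun i =>
      modGen (ψ i) (fun j => V ⟨i, j⟩) fun j => v ⟨i, j⟩)
    (fun v p x y => by
      classical
      obtain ⟨i, j⟩ := p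
      have h₁ := IndMod.sigma_update (V := fun p => (V p : Type u))
        (fun i => modGen (ψ i) fun j => V ⟨i, j⟩) v i j
      simp only [h₁, modGen_update_add])
    (fun v p x => by
      classical
      obtain ⟨i, j⟩ := p
      have h₁ := IndMod.sigma_update (V := fun p => (V p : Type u))
        (fun i => modGen (ψ i) fun j => V ⟨i, j⟩) v i j (op x • v ⟨i, j⟩)
      have h₂ := modGen_update_op (ψ i) (fun j => V ⟨i, j⟩) (fun j => v ⟨i, j⟩) j x
      have h₃ := modGen_update_op φ (fun i => modInd (ψ i) fun j => V ⟨i, j⟩)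
        (fun i => modGen (ψ i) (fun j => V ⟨i, j⟩) fun j => v ⟨i, j⟩) i (ψ i j x)
      rw [hχ]
      refine (congrArg (modGen φ fun i => modInd (ψ i) fun j => V ⟨i, j⟩) h₁).trans
        (Eq.trans ?_ h₃)
      rw [← h₂])

lemma modDecompApp_gen (V : ∀ p : Σ i, J i, ModuleCat.{u} (T p)ᵐᵒᵖ) (v : ∀ p, V p) :
    (modDecompApp φ ψ χ hχ V).hom (modGen χ V v) =
      modGen φ (fun i => modInd (ψ i) fun j => V ⟨i, j⟩) fun i =>
        modGen (ψ i) (fun j => V ⟨i, j⟩) fun j => v ⟨i, j⟩ :=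
  modLift_gen _ _ _ v

/-- The coherence map `[v] ↦ [[v₁], …, [vₙ]]` as a natural transformation. -/
noncomputable def modDecomp :
    modFunctor χ ⟶ sigmaCurry (fun i j => ModuleCat.{u} (T ⟨i, j⟩)ᵐᵒᵖ) ⋙
      Functor.pi (fun i => modFunctor (ψ i)) ⋙ modFunctor φ where
  app V := modDecompApp φ ψ χ hχ V
  naturality V W f := modInd_hom_ext fun v => by
    refine (congrArg (modDecompApp φ ψ χ hχ W).hom (modMap_gen χ f v)).trans
      ((modDecompApp_gen φ ψ χ hχ W _).trans ?_)
    refine Eq.trans ?_ (congrArg (modMap φ fun i => modMap (ψ i) fun j => f ⟨i, j⟩).hom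
      (modDecompApp_gen φ ψ χ hχ V v)).symm
    refine Eq.trans ?_ (modMap_gen φ _ _).symm
    exact congrArg (modGen φ _) (funext fun i => (modMap_gen (ψ i) _ _).symm)

end Decomp

/-- The coherence map `v ↦ [v]`. -/
noncomputable def modUnitApp (ι : Unit → B →ₐ[K] B) (hι : ι () = AlgHom.id K B)
    (V : ModuleCat.{u} Bᵐᵒᵖ) : V ⟶ modInd ι fun _ => V :=
  ModuleCat.ofHom
    { toFun := fun v => modGen ι (fun _ => V) fun _ => v
      map_add' := fun x y => by
        have := modGen_update_add ι (fun _ => V) (fun _ => x) () x y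
        simp only [IndMod.update_const_unit] at this
        exact this
      map_smul' := fun b x => by
        have := modGen_update_op ι (fun _ => V) (fun _ => x) () b.unop
        simp only [IndMod.update_const_unit, hι] at this
        exact this }

/-- The coherence map `v ↦ [v]` as a natural transformation. -/
noncomputable def modUnit (ι : Unit → B →ₐ[K] B) (hι : ι () = AlgHom.id K B) :
    𝟭 (ModuleCat.{u} Bᵐᵒᵖ) ⟶
      Functor.pi' (fun _ : Unit => 𝟭 (ModuleCat.{u} Bᵐᵒᵖ)) ⋙ modFunctor ι where
  app V := modUnitApp ι hι V
  naturality V W f := by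
    ext v
    exact (modMap_gen ι (V := fun _ => V) (W := fun _ => W) (fun _ => f) (fun _ => v)).symm

section Perm

variable {I' : Type} (e : I' ≃ I) (φ' : ∀ i', R (e i') →ₐ[K] B) (h : ∀ i', φ' i' = φ (e i'))

/-- The coherence map `[v] ↦ [v ∘ e]` for a bijection `e` of index types. -/
noncomputable def modPermApp (V : ∀ i, ModuleCat.{u} (R i)ᵐᵒᵖ) :
    modInd φ V ⟶ modInd φ' fun i' => V (e i') :=
  modLift (fun v => modGen φ' (fun i' => V (e i')) fun i' => v (e i'))
    (fun v i x y => by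
      classical
      obtain ⟨i, rfl⟩ := e.surjective i
      simp only [Function.update_comp_eq_of_injective' _ e.injective, modGen_update_add])
    (fun v i r => by
      classical
      obtain ⟨i, rfl⟩ := e.surjective i
      simp only [Function.update_comp_eq_of_injective' _ e.injective]
      rw [← h]
      exact modGen_update_op φ' (fun i' => V (e i')) (fun i' => v (e i')) i r)

lemma modPermApp_gen (V : ∀ i, ModuleCat.{u} (R i)ᵐᵒᵖ) (v : ∀ i, V i) :
    (modPermApp φ e φ' h V).hom (modGen φ V v) =
      modGen φ' (fun i' => V (e i')) fun i' => v (e i') :=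
  modLift_gen _ _ _ v

/-- The coherence map `[v] ↦ [v ∘ e]` as a natural transformation. -/
noncomputable def modPerm :
    modFunctor φ ⟶ reindex e (fun i => ModuleCat.{u} (R i)ᵐᵒᵖ) ⋙ modFunctor φ' where
  app V := modPermApp φ e φ' h V
  naturality V W f := modInd_hom_ext fun v => by
    refine (congrArg (modPermApp φ e φ' h W).hom (modMap_gen φ f v)).trans
      ((modPermApp_gen φ e φ' h W _).trans ?_)
    refine Eq.trans ?_ (congrArg (modMap φ' (V := fun i' => V (e i'))
      (W := fun i' => W (e i')) fun i' => f (e i')).hom (modPermApp_gen φ e φ' h V v)).symm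
    exact (modMap_gen φ' (V := fun i' => V (e i')) (W := fun i' => W (e i')) _ _).symm

end Perm

end ModInd

section Inclusion

variable {K : Type u} [Field K] {C : Type w} [Category.{v} C] {O : Orthogonality C}

namespace AQFT

variable (A : AQFT.{v, w, u} K O)

lemma map_comp_apply {b c t : C} (g : b ⟶ c) (f : c ⟶ t) (a : A.obj.obj b) :
    (A.obj.map (g ≫ f)).hom a = (A.obj.map f).hom ((A.obj.map g).hom a) :=
  congrArg (fun k => AlgCat.Hom.hom k a) (A.obj.map_comp g f)

lemma map_id_eq (t : C) : (A.obj.map (𝟙 t)).hom = AlgHom.id K (A.obj.obj t) :=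
  congrArg AlgCat.Hom.hom (A.obj.map_id t)

/-- The functor `(V₁, …, Vₙ) ↦ (V₁ ⊗ ⋯ ⊗ Vₙ) ⊗_{𝔄(c₁) ⊗ ⋯ ⊗ 𝔄(cₙ)} 𝔄(t)`. -/
noncomputable def modProd {I : Type} {c : I → C} {t : C} (f : Op O c t) :
    (∀ i, ModuleCat.{u} (A.obj.obj (c i))ᵐᵒᵖ) ⥤ ModuleCat.{u} (A.obj.obj t)ᵐᵒᵖ :=
  modFunctor (fun i => (A.obj.map (f.hom i)).hom)

/-- The composition coherence of `ι(𝔄)`. -/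
noncomputable def inclusionDecomp {I : Type} {J : I → Type} {b : ∀ i, J i → C}
    {a : I → C} {t : C} (f : Op O a t) (g : ∀ i, Op O (b i) (a i)) :
    modProd A (f.comp g) ⟶ sigmaCurry (fun i j => ModuleCat.{u} (A.obj.obj (b i j))ᵐᵒᵖ) ⋙
      Functor.pi (fun i => modProd A (g i)) ⋙ modProd A f :=
  modDecomp (T := fun p => A.obj.obj (b p.1 p.2)) (fun i => (A.obj.map (f.hom i)).hom)
    (fun i j => (A.obj.map ((g i).hom j)).hom) (fun p => (A.obj.map ((f.comp g).hom p)).hom)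
    (fun i j x => map_comp_apply A ((g i).hom j) (f.hom i) x)

/-- The 2AQFT `ι(𝔄)` associated with an AQFT `𝔄`: to `c` it assigns the category of right
`𝔄(c)`-modules, and its factorization products are
`(V₁, …, Vₙ) ↦ (V₁ ⊗ ⋯ ⊗ Vₙ) ⊗_{𝔄(c₁) ⊗ ⋯ ⊗ 𝔄(cₙ)} 𝔄(t)`. -/
noncomputable def inclusion : TwoAQFTData.{v, w, u} K O where
  obj c := { carrier := ModuleCat.{u} (A.obj.obj c)ᵐᵒᵖ }
  prod f := modProd A f
  decomp f g := inclusionDecomp A f g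
  unit t := modUnit (fun i => (A.obj.map ((Op.id O t).hom i)).hom) (map_id_eq A t)
  perm {_ _} _ _ e {_ _} f f' h := modPerm (fun i => (A.obj.map (f.hom i)).hom) e
    (fun i => (A.obj.map (f'.hom i)).hom) (fun i' => by subst h; rfl)

end AQFT

end Inclusion

/-! ### The counit of the inclusion-truncation biadjunction and truncated 2AQFTs -/

section LeftMul

variable {K : Type u} [Field K] {R : Empty → Type u} [∀ i, Ring (R i)] [∀ i, Algebra K (R i)]
  {B : Type u} [Ring B] [Algebra K B]

/-- For an empty index type, the induced module is the free right `B`-module of rank one on its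
canonical generator. This is the left multiplication by `a`, i.e. the endomorphism which sends the
generator `1` to `a`. -/
noncomputable def modLeftMul (φ : ∀ i, R i →ₐ[K] B) (V : ∀ i, ModuleCat.{u} (R i)ᵐᵒᵖ) (a : B) :
    modInd φ V ⟶ modInd φ V :=
  modLift (fun v => op a • modGen φ V v) (fun _ i => i.elim) (fun _ i => i.elim)

end LeftMul

section Counit

variable {K : Type u} [Field K] {C : Type w} [Category.{v} C] {O : Orthogonality C}

namespace AQFT

/-- The map `𝔄(t) → End(𝔄(t))` to the endomorphisms of the pointing `𝔄(t)` of `ι(𝔄)(t)`, which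
assigns to `a` the left multiplication by `a`. -/
noncomputable def eta (A : AQFT.{v, w, u} K O) {t : C} (a : A.obj.obj t) :
    End ((inclusion A).point t) :=
  modLeftMul (fun i => (A.obj.map ((Op.empty O t).hom i)).hom) (fun i => i.elim) a

end AQFT

/-- The adjunct `𝔄 → π(𝔅)` of a 1-morphism `ζ : ι(𝔄) → 𝔅` sends `a` to
`ζ_{∗}⁻¹ ∘ ζ(a ·) ∘ ζ_{∗}`. A 1-morphism `ε : ιπ(𝔅) → 𝔅` is the component at `𝔅` of the counit of
the biadjunction between the inclusion and the truncation if its adjunct is the identity of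
`π(𝔅)`; this determines `ε` up to invertible 2-morphisms. -/
def IsCounit (B : TwoAQFT.{v, w, u} K O)
    (ε : Hom (AQFT.inclusion (truncation B)) B.toTwoAQFTData) : Prop :=
  ∀ (t : C) (h : End (B.point t)),
    ε.pointMap t ≫ (ε.app t).map (AQFT.eta (truncation B) (t := t) h) = h ≫ ε.pointMap t

/-- A 2AQFT is truncated if the component of the counit at it is an equivalence. -/
def IsTruncated (B : TwoAQFT.{v, w, u} K O) : Prop :=
  ∃ ε : Hom (AQFT.inclusion (truncation B)) B.toTwoAQFTData, IsCounit B ε ∧ ε.IsEquivalence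

end Counit

/-! ### Trivial theories and traditional orbifolds -/

section Trivial

variable (K : Type u) [Field K] {C : Type w} [Category.{v} C] (O : Orthogonality C)
  (G : Type u) [Group G]

/-- The trivial AQFT with value `K`. -/
noncomputable def trivialAQFT : AQFT.{v, w, u} K O where
  obj := (Functor.const C).obj (AlgCat.of K K)
  property := fun _ _ _ _ _ _ a₁ a₂ => mul_comm (G := K) a₁ a₂

/-- The trivial AQFT with the trivial `G`-action. -/
noncomputable def trivialEquivariantAQFT : EquivariantAQFT.{v, w, u} K O G where
  aqft := trivialAQFT K O
  ρ := 1

variable {K O G}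

namespace EquivariantAQFT

variable (A : EquivariantAQFT.{v, w, u} K O G)

/-- The subalgebra of `G`-invariants of `𝔄(c)`. -/
def invariants (c : C) : Subalgebra K (A.aqft.obj.obj c) where
  carrier := {a | ∀ g, A.act c g a = a}
  mul_mem' ha hb g := by rw [map_mul, ha g, hb g]
  add_mem' ha hb g := by rw [map_add, ha g, hb g]
  algebraMap_mem' k g := AlgHom.commutes _ k

/-- The traditional orbifold theory `𝔄₀ᴳ` of `G`-invariants. -/
noncomputable def orbifold : AQFT.{v, w, u} K O where
  obj :=
    { obj := fun c => AlgCat.of K (A.invariants c)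
      map := fun {c t} f => AlgCat.ofHom
        (((A.aqft.obj.map f).hom.comp (A.invariants c).val).codRestrict (A.invariants t)
          fun a g => (A.map_act f g a.1).symm.trans (congrArg _ (a.2 g)))
      map_id := fun t => by
        ext a
        exact DFunLike.congr_fun (A.map_id_eq t) a.1
      map_comp := fun g f => by
        ext a
        exact A.map_comp_apply g f a.1 }
  property := fun _ _ _ f₁ f₂ hf a₁ a₂ =>
    Subtype.ext (A.aqft.property f₁ f₂ hf a₁.1 a₂.1)

end EquivariantAQFT

end Trivial

/-! ### Representations -/

section Representations

variable {K : Type u} [Field K] {G : Type u} [Group G]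

/-- The functor which forgets the `A`-action on a `G`-equivariant right `A`-module. -/
def EqMod.forgetRep {A : Type u} [Ring A] [Algebra K A] (act : G →* (A →ₐ[K] A)) :
    EqMod act ⥤ Rep.{u} K G where
  obj V := Rep.of V.ρ
  map f := Rep.ofHom
    { toLinearMap :=
        { toFun := EqMod.lin f
          map_add' := map_add _
          map_smul' := EqMod.lin_smul f }
      isIntertwining' := fun g => LinearMap.ext fun v => EqMod.lin_ρ f g v }

variable (K G)

/-- The `n`-ary tensor product of representations, with the diagonal action. -/
noncomputable def repTensor (I : Type) : (∀ _ : I, Rep.{u} K G) ⥤ Rep.{u} K G where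
  obj V := Rep.of
    ({ toFun := fun g => PiTensorProduct.map fun i => (V i).ρ g
       map_one' := by
        simp only [map_one]
        exact PiTensorProduct.map_one
       map_mul' := fun g h => by
        simp only [map_mul]
        exact PiTensorProduct.map_mul _ _ } : Representation K G (PiTensorProduct K fun i => V i))
  map f := Rep.ofHom
    { toLinearMap := PiTensorProduct.map fun i => (f i).hom.toLinearMap
      isIntertwining' := fun g => by
        refine (PiTensorProduct.map_comp _ _).symm.trans (Eq.trans ?_ (PiTensorProduct.map_comp _ _))
        exact congrArg _ (funext fun i => (f i).hom.isIntertwining' g) }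
  map_id V := Rep.hom_ext (Representation.IntertwiningMap.ext PiTensorProduct.map_id)
  map_comp f g := Rep.hom_ext (Representation.IntertwiningMap.ext (PiTensorProduct.map_comp
    (fun i => (g i).hom.toLinearMap) (fun i => (f i).hom.toLinearMap)))

end Representations

namespace EquivariantAQFT

variable {K : Type u} [Field K] {C : Type w} [Category.{v} C] {O : Orthogonality C}
  {G : Type u} [Group G] (A : EquivariantAQFT.{v, w, u} K O G)

/-- The functor from `𝔄ᴳ(c)` to representations of `G` which forgets the `𝔄(c)`-action. -/
noncomputable def toRep (c : C) : A.gauging.obj c ⥤ Rep.{u} K G :=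
  EqMod.forgetRep (A.act c)

/-- The element `v₁ ⊗ ⋯ ⊗ vₙ ⊗ 1` of `(V₁ ⊗ ⋯ ⊗ Vₙ) ⊗_{𝔄(c₁) ⊗ ⋯ ⊗ 𝔄(cₙ)} 𝔄(t)`. -/
noncomputable def gaugingGen {I : Type} [Finite I] {c : I → C} {t : C} (f : Op O c t)
    (V : ∀ i, A.gauging.obj (c i)) (v : ∀ i, (A.toRep (c i)).obj (V i)) :
    (A.toRep t).obj ((A.gauging.prod f).obj V) :=
  EqMod.gen (fun i => (A.aqft.obj.map (f.hom i)).hom) (fun i g r => A.map_act (f.hom i) g r) V v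

end EquivariantAQFT

end TwoCatAQFT

/-!
All algebras involved in the gauging of the trivial theory are one-dimensional, and nothing else
about them is used: the intermediate results concern an arbitrary equivariant AQFT `𝔄` whose
algebras consist of the scalars, expressed by the bijectivity of all `algebraMap K (𝔄(c))`.

Over such an algebra every module structure is the scalar one, so forgetting it is an equivalence
`𝔄ᴳ(c) ≃ Rep G` (`EqMod.forgetRep_isEquivalence`), and a factorization product is the tensor product
of the underlying vector spaces with the diagonal action, `[v₁, …, vₙ] ↦ v₁ ⊗ ⋯ ⊗ vₙ`
(`IndMod.tensorEquiv`, `EquivariantAQFT.prodIsoRepTensor`).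

The gauging is a 2AQFT (`EquivariantAQFT.gauging_isTwoAQFT`) for the following reasons.
* `Rep G` is locally presentable, since the regular representation is a finitely presentable strong
  generator: it represents the underlying set functor.
* Factorization products are co-continuous in each variable: with all but one argument fixed they
  become the tensor product with a fixed representation (`EqMod.insertAtIndIso`), which is a left
  adjoint.
* The coherence maps send generators `[v₁, …, vₙ]` to generators. If the `vᵢ` run through bases,
  then these generators form a basis (`IndMod.genBasis`), so the coherence maps are bijective. The
  coherence axioms can be checked on generators.

The pointing is the trivial representation, whose endomorphisms are the scalars. Hence
`π(𝔄ᴳ)`, the invariants `𝔄₀ᴳ` and `K` are all one-dimensional, and AQFTs with one-dimensional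
algebras are isomorphic (`AQFT.isoOfOneDimensional`). The counit at `𝔄ᴳ` regards a vector space as
a trivial representation (`EquivariantAQFT.trivialHom`); its adjunct is the identity because it
preserves scalars (`EquivariantAQFT.isCounit_trivialHom`).

Finally, for every AQFT `𝔅` the pointing of `ι(𝔅)(t)` is the free module of rank one and thus a
separator, a property which an equivalence of 2AQFTs carries over to the pointing of its target
(`Hom.IsEquivalence.isSeparator_point`). But the trivial representation of a nontrivial group is not
a separator (`not_isSeparator_trivial`): it cannot tell a right translation of the functions on `G`
from the identity, because the left invariant functions are constant. So `𝔄ᴳ` is not equivalent to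
any `ι(𝔅)`, and in particular it is not truncated.
-/

namespace TwoCatAQFT

/-! ### Local presentability of the category of representations -/

section RepPresentable

variable (K : Type u) [Field K] (G : Type u) [Group G]

lemma leftRegular_hom_ext {A : Rep.{u} K G} {f g : Rep.leftRegular K G ⟶ A}
    (h : f.hom (.single 1 1) = g.hom (.single 1 1)) : f = g := by
  refine Rep.hom_ext (Representation.IntertwiningMap.ext (MonoidAlgebra.lhom_ext' fun x =>
    LinearMap.ext_ring ?_))
  have hx : (MonoidAlgebra.single x (1 : K)) =
      (Rep.leftRegular K G).ρ x (MonoidAlgebra.single 1 1) := by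
    simp
  change f.hom (MonoidAlgebra.single x 1) = g.hom (MonoidAlgebra.single x 1)
  rw [hx, Rep.hom_comm_apply, Rep.hom_comm_apply, h]

/-- The regular representation represents the underlying set functor. -/
noncomputable def leftRegularCoyoneda :
    coyoneda.obj (Opposite.op (Rep.leftRegular K G)) ≅ forget (Rep.{u} K G) :=
  NatIso.ofComponents (fun A => Equiv.toIso
    { toFun := fun f => f.hom (.single 1 1)
      invFun := fun x => Rep.leftRegularHom A x
      left_inv := fun f => leftRegular_hom_ext K G (by simp)
      right_inv := fun x => by simp })
    (fun f => by ext; rfl)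

instance : PreservesFilteredColimits (forget (Rep.{u} K G)) :=
  inferInstanceAs (PreservesFilteredColimits
    (forget₂ (Rep.{u} K G) (ModuleCat.{u} K) ⋙ forget (ModuleCat.{u} K)))

attribute [local instance] Cardinal.fact_isRegular_aleph0

/-- The regular representation is a finitely presentable strong generator. -/
instance : IsLocallyPresentable.{u} (Rep.{u} K G) where
  exists_cardinal := by
    refine ⟨Cardinal.aleph0, inferInstance, ?_⟩
    rw [IsCardinalLocallyPresentable.iff_exists_isStrongGenerator]
    refine ⟨.singleton (Rep.leftRegular K G), inferInstance, ?_, ?_⟩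
    · -- Evaluation at `1` identifies maps out of the regular representation with elements.
      rw [ObjectProperty.isStrongGenerator_iff]
      refine ⟨fun X Y f g h => ?_, fun X Y i hi h => ?_⟩
      · ext x
        have := h _ ⟨()⟩ (Rep.leftRegularHom X x)
        have := congrArg (fun k => Rep.Hom.hom k (MonoidAlgebra.single 1 1)) this
        simpa [Rep.leftRegularHom_hom_single] using this
      · have hs : Function.Bijective i.hom := by
          refine ⟨(Rep.mono_iff_injective i).1 hi, fun y => ?_⟩
          obtain ⟨f, hf⟩ := h _ ⟨()⟩ (Rep.leftRegularHom Y y)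
          refine ⟨f.hom (MonoidAlgebra.single 1 1), ?_⟩
          have := congrArg (fun k => Rep.Hom.hom k (MonoidAlgebra.single 1 1)) hf
          simpa [Rep.leftRegularHom_hom_single] using this
        have : IsIso ((forget (Rep.{u} K G)).map i) := (isIso_iff_bijective _).2 hs
        exact isIso_of_reflects_iso i (forget (Rep.{u} K G))
    · simp only [ObjectProperty.singleton_le_iff, isCardinalPresentable_iff]
      have : (forget (Rep.{u} K G)).IsCardinalAccessible Cardinal.aleph0.{u} :=
        { preservesColimitOfShape := fun J _ _ => by
            have := isFiltered_of_isCardinalFiltered J Cardinal.aleph0.{u}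
            infer_instance }
      exact Functor.isCardinalAccessible_of_natIso (leftRegularCoyoneda K G).symm _

end RepPresentable

/-! ### Induced modules over one-dimensional algebras -/

namespace IndMod

section OneDimensional

variable {K : Type u} [Field K] {I : Type} {R : I → Type u} [∀ i, Ring (R i)]
  [∀ i, Algebra K (R i)] {B : Type u} [Ring B] [Algebra K B] (φ : ∀ i, R i →ₐ[K] B)
  {V : I → Type u} [∀ i, AddCommGroup (V i)] [∀ i, Module K (V i)] [∀ i, Module (R i)ᵐᵒᵖ (V i)]

lemma op_algebraMap_smul {R V : Type u} [Ring R] [Algebra K R] [AddCommGroup V] [Module K V]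
    [Module Rᵐᵒᵖ V] [IsScalarTower K Rᵐᵒᵖ V] (k : K) (v : V) :
    op (algebraMap K R k) • v = k • v := by
  rw [Algebra.algebraMap_eq_smul_one, op_smul, op_one, smul_assoc, one_smul]

variable {φ} in
/-- If `B` consists of scalars, then `K`-linear maps out of an induced module are determined by
their values on the generators `[v₁, …, vₙ]`; in general only `B`-linear maps are. -/
lemma linearMap_ext {W : Type u} [AddCommGroup W] [Module K W]
    (hB : Function.Surjective (algebraMap K B)) {f g : IndMod φ V →ₗ[K] W}
    (h : ∀ v, f (gen φ V v) = g (gen φ V v)) : f = g := by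
  refine LinearMap.ext fun x => ?_
  induction x using induction with
  | h₀ => rw [map_zero, map_zero]
  | h₁ v b =>
    obtain ⟨k, rfl⟩ := hB b
    rw [op_algebraMap_smul, map_smul, map_smul, h]
  | h₂ x y hx hy => rw [map_add, map_add, hx, hy]

variable [∀ i, IsScalarTower K (R i)ᵐᵒᵖ (V i)]

variable {φ} in
/-- For one-dimensional algebras, `v₁ ⊗ ⋯ ⊗ vₙ` satisfies the relations which define the induced
module: all actions are by scalars. -/
lemma tprod_update_op (hR : ∀ i, Function.Surjective (algebraMap K (R i))) (τ : B →ₐ[K] K)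
    [DecidableEq I] (v : ∀ i, V i) (i : I) (r : R i) :
    PiTensorProduct.tprod K (Function.update v i (op r • v i)) =
      op (τ (φ i r)) • PiTensorProduct.tprod K v := by
  obtain ⟨k, rfl⟩ := hR i r
  rw [op_algebraMap_smul, MultilinearMap.map_update_smul, Function.update_eq_self,
    AlgHom.commutes, AlgHom.commutes, op_algebraMap_smul]

/-- If the algebras `Rᵢ` and `B` are one-dimensional, then the induced module is the tensor product
of the underlying vector spaces. -/
noncomputable def tensorEquiv (hR : ∀ i, Function.Surjective (algebraMap K (R i)))
    (hB : Function.Bijective (algebraMap K B)) :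
    IndMod φ V ≃ₗ[K] PiTensorProduct K V :=
  LinearEquiv.ofLinearMap
    (lift (S := K) (AlgEquiv.ofBijective (Algebra.ofId K B) hB).symm.toAlgHom
      (PiTensorProduct.tprod K) (fun v i r => tprod_update_op hR _ v i r))
    (PiTensorProduct.lift (genMulti φ fun _ => LinearMap.id))
    (PiTensorProduct.ext (by
      ext v
      simp only [LinearMap.compMultilinearMap_apply, LinearMap.comp_apply,
        PiTensorProduct.lift.tprod, LinearMap.id_apply]
      exact lift_gen (hΦ := fun v i r => tprod_update_op hR _ v i r) ..))
    (linearMap_ext hB.2 fun v => by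
      rw [LinearMap.comp_apply, lift_gen (hΦ := fun v i r => tprod_update_op hR _ v i r),
        PiTensorProduct.lift.tprod]
      rfl)

@[simp]
lemma tensorEquiv_gen (hR : ∀ i, Function.Surjective (algebraMap K (R i)))
    (hB : Function.Bijective (algebraMap K B)) (v : ∀ i, V i) :
    tensorEquiv φ hR hB (gen φ V v) = PiTensorProduct.tprod K v :=
  lift_gen (hΦ := fun v i r => tprod_update_op hR _ v i r) ..

/-- The basis of an induced module over one-dimensional algebras which is formed by the generators
`[b₁, …, bₙ]` on basis vectors. -/
noncomputable def genBasis [Finite I] (hR : ∀ i, Function.Surjective (algebraMap K (R i)))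
    (hB : Function.Bijective (algebraMap K B)) {κ : I → Type u}
    (b : ∀ i, Module.Basis (κ i) K (V i)) : Module.Basis (∀ i, κ i) K (IndMod φ V) :=
  (Basis.piTensorProduct b).map (tensorEquiv φ hR hB).symm

lemma genBasis_apply [Finite I] (hR : ∀ i, Function.Surjective (algebraMap K (R i)))
    (hB : Function.Bijective (algebraMap K B)) {κ : I → Type u}
    (b : ∀ i, Module.Basis (κ i) K (V i)) (p : ∀ i, κ i) :
    genBasis φ hR hB b p = gen φ V fun i => b i (p i) := by
  rw [genBasis, Module.Basis.map_apply, LinearEquiv.symm_apply_eq, tensorEquiv_gen,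
    Basis.piTensorProduct_apply]

/-- A linear map which restricts to a bijection of bases is bijective. -/
lemma _root_.LinearMap.bijective_of_basis {M N ι ι' : Type*} [AddCommGroup M] [Module K M]
    [AddCommGroup N] [Module K N] (f : M →ₗ[K] N) (b : Module.Basis ι K M)
    (b' : Module.Basis ι' K N) (e : ι ≃ ι') (h : ∀ i, f (b i) = b' (e i)) :
    Function.Bijective f := by
  have : f = (b.equiv b' e : M →ₗ[K] N) := b.ext fun i => by simp [h]
  rw [this]
  exact (b.equiv b' e).bijective

/-- The permutation coherence permutes the generators on basis vectors. -/
lemma bijective_perm [Finite I] {I' : Type} [Finite I'] (e : I' ≃ I)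
    (hR : ∀ i, Function.Surjective (algebraMap K (R i)))
    (hB : Function.Bijective (algebraMap K B)) (φ' : ∀ i', R (e i') →ₐ[K] B)
    (h : ∀ i', φ' i' = φ (e i')) : Function.Bijective (perm φ e V φ' h) :=
  LinearMap.bijective_of_basis _ (genBasis φ hR hB fun i => Module.Basis.ofVectorSpace K (V i))
    (genBasis φ' (fun i' => hR (e i')) hB fun i' => Module.Basis.ofVectorSpace K (V (e i')))
    (e.piCongrLeft _).symm (fun p => by
      rw [genBasis_apply, genBasis_apply, perm_gen]
      rfl)

/-- The unit coherence sends a basis to the generators on its elements. -/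
lemma bijective_unit (hB : Function.Bijective (algebraMap K B)) (V : Type u) [AddCommGroup V]
    [Module K V] [Module Bᵐᵒᵖ V] [IsScalarTower K Bᵐᵒᵖ V] (ι : Unit → B →ₐ[K] B) :
    Function.Bijective (unit V ι) :=
  LinearMap.bijective_of_basis _ (Module.Basis.ofVectorSpace K V)
    (genBasis ι (fun _ => hB.2) hB fun _ => Module.Basis.ofVectorSpace K V)
    (Equiv.funUnique Unit _).symm (fun p => by
      rw [genBasis_apply]
      rfl)

/-- The composition coherence sends the generators on basis vectors to the generators on those of
an iterated basis of generators. -/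
lemma bijective_decomp [Finite I] (hR : ∀ i, Function.Bijective (algebraMap K (R i)))
    (hB : Function.Bijective (algebraMap K B)) {J : I → Type} [∀ i, Finite (J i)]
    {T : (Σ i, J i) → Type u} [∀ p, Ring (T p)] [∀ p, Algebra K (T p)]
    (hT : ∀ p, Function.Surjective (algebraMap K (T p)))
    (ψ : ∀ i j, T ⟨i, j⟩ →ₐ[K] R i)
    (χ : ∀ p : Σ i, J i, T p →ₐ[K] B) (hχ : ∀ i j x, χ ⟨i, j⟩ x = φ i (ψ i j x))
    {V : (Σ i, J i) → Type u} [∀ p, AddCommGroup (V p)] [∀ p, Module K (V p)]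
    [∀ p, Module (T p)ᵐᵒᵖ (V p)] [∀ p, IsScalarTower K (T p)ᵐᵒᵖ (V p)] :
    Function.Bijective (decomp φ ψ χ hχ (V := V)) :=
  LinearMap.bijective_of_basis _ (genBasis χ hT hB fun p => Module.Basis.ofVectorSpace K (V p))
    (genBasis φ (V := fun i => IndMod (ψ i) fun j => V ⟨i, j⟩) (fun i => (hR i).2) hB fun i =>
      genBasis (ψ i) (fun j => hT ⟨i, j⟩) (hR i)
        fun j => Module.Basis.ofVectorSpace K (V ⟨i, j⟩))
    (Equiv.piCurry fun i j => Module.Basis.ofVectorSpaceIndex K (V ⟨i, j⟩)) (fun p => by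
      rw [genBasis_apply, genBasis_apply, decomp_gen]
      simp only [genBasis_apply]
      rfl)

end OneDimensional

end IndMod

/-! ### Equivariant modules over one-dimensional algebras -/

namespace EqMod

section

variable {K : Type u} [Field K] {G : Type u} [Group G] {A : Type u} [Ring A] [Algebra K A]
  {act : G →* (A →ₐ[K] A)}

/-- The `K`-linear equivalence underlying an isomorphism. -/
noncomputable def linEquiv {V W : EqMod act} (e : V ≅ W) : V ≃ₗ[K] W :=
  { toFun := lin e.hom
    invFun := lin e.inv
    map_add' := map_add _
    map_smul' := lin_smul e.hom
    left_inv := fun v => by rw [← lin_comp, e.hom_inv_id]; rfl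
    right_inv := fun v => by rw [← lin_comp, e.inv_hom_id]; rfl }

lemma isIso_of_bijective {V W : EqMod act} (f : V ⟶ W) (h : Function.Bijective (lin f)) :
    IsIso f := by
  let e := LinearEquiv.ofBijective (lin f) h
  have he (w : W) : lin f (e.symm w) = w := e.apply_symm_apply w
  refine ⟨⟨e.symm.toLinearMap, fun g w => h.1 ?_⟩, hom_ext fun v => e.symm_apply_apply v,
    hom_ext he⟩
  change lin f (e.symm _) = lin f (V.ρ g (e.symm w))
  rw [he, lin_ρ, he]

instance forgetRep_additive : (forgetRep act).Additive where
  map_add := rfl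

instance forgetRep_linear : (forgetRep act).Linear K where
  map_smul _ _ := rfl

instance forgetRep_faithful : (forgetRep act).Faithful where
  map_injective h := hom_ext fun v => congrArg (fun k => Rep.Hom.hom k v) h

/-- An equivariant module over a one-dimensional algebra is the same as a representation: the
algebra acts by scalars. -/
noncomputable def ofRep (act : G →* (A →ₐ[K] A)) (hA : Function.Bijective (algebraMap K A))
    {V : Type u} [AddCommGroup V] [Module K V] (ρ : Representation K G V) : EqMod act :=
  let e : A ≃ₐ[K] K := (AlgEquiv.ofBijective (Algebra.ofId K A) hA).symm
  let ε : Aᵐᵒᵖ →ₐ[K] K := (e : A →ₐ[K] K).fromOpposite fun _ _ => mul_comm _ _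
  letI : Module Aᵐᵒᵖ V := Module.compHom V ε.toRingHom
  haveI hs (a : Aᵐᵒᵖ) (v : V) : a • v = ε a • v := rfl
  { carrier := V
    isScalarTower := ⟨fun k a v => by rw [hs, hs, map_smul, smul_assoc]⟩
    ρ := ρ
    ρ_smul := fun g a v => by
      obtain ⟨k, rfl⟩ := hA.2 a
      rw [AlgHom.commutes, hs, hs, map_smul] }

/-- Linear maps are automatically compatible with the actions of a one-dimensional algebra. -/
lemma mkHom_smul (hA : Function.Surjective (algebraMap K A)) {V W : EqMod act} (f : V →ₗ[K] W)
    (a : A) (v : V) : f (op a • v) = op a • f v := by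
  obtain ⟨k, rfl⟩ := hA a
  rw [IndMod.op_algebraMap_smul, IndMod.op_algebraMap_smul, map_smul]

/-- Equivariant modules over a one-dimensional algebra are representations. -/
lemma forgetRep_isEquivalence (hA : Function.Bijective (algebraMap K A)) :
    (forgetRep act).IsEquivalence where
  full := ⟨fun {V W} f => ⟨mkHom (V := V) (W := W) f.hom.toLinearMap
    (mkHom_smul hA.2 (V := V) (W := W) f.hom.toLinearMap)
    (fun g v => Rep.hom_comm_apply f g v), rfl⟩⟩
  essSurj := ⟨fun V => ⟨ofRep act hA V.ρ, ⟨Iso.refl _⟩⟩⟩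

end

end EqMod

lemma rep_isIso_of_bijective {K : Type u} [Field K] {G : Type u} [Group G] {V W : Rep.{u} K G}
    (f : V ⟶ W) (h : Function.Bijective f.hom) : IsIso f := by
  have : IsIso ((forget (Rep.{u} K G)).map f) := (isIso_iff_bijective _).2 h
  exact isIso_of_reflects_iso f (forget (Rep.{u} K G))

/-! ### Tensor products preserve colimits in each variable -/

section InsertAt

variable {I : Type} {D : I → Type w} [∀ i, Category.{v} (D i)] (X : ∀ i, D i) (i : I)

/-- The `i`-th component of `insertAt X i` is the identity functor. -/
noncomputable def insertAtEvalSelf : insertAt X i ⋙ Pi.eval D i ≅ 𝟭 (D i) :=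
  eqToIso (dif_pos rfl)

/-- The components of `insertAt X i` away from `i` are constant functors. -/
noncomputable def insertAtEvalOfNe {j : I} (h : i ≠ j) :
    insertAt X i ⋙ Pi.eval D j ≅ (Functor.const (D i)).obj (X j) :=
  eqToIso (dif_neg h)

end InsertAt

section Colimits

open MonoidalCategory (tensorLeft)

namespace EqMod

variable {K : Type u} [Field K] {G : Type u} [Group G] {I : Type} {R : I → Type u}
  [∀ i, Ring (R i)] [∀ i, Algebra K (R i)] {actR : ∀ i, G →* (R i →ₐ[K] R i)}
  {B : Type u} [Ring B] [Algebra K B] {actB : G →* (B →ₐ[K] B)} (φ : ∀ i, R i →ₐ[K] B)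
  (hφ : ∀ i g r, φ i (actR i g r) = actB g (φ i r))

variable {φ hφ} in
lemma ind_linearMap_ext {V : ∀ i, EqMod (actR i)} {W : Type u} [AddCommGroup W] [Module K W]
    (hB : Function.Surjective (algebraMap K B)) {f g : ind φ hφ V →ₗ[K] W}
    (h : ∀ v, f (gen φ hφ V v) = g (gen φ hφ V v)) : f = g :=
  IndMod.linearMap_ext hB h

/-- For one-dimensional algebras, the induced module is the tensor product of the underlying
vector spaces. -/
noncomputable def tensorEquiv (hR : ∀ i, Function.Surjective (algebraMap K (R i)))
    (hB : Function.Bijective (algebraMap K B)) (V : ∀ i, EqMod (actR i)) :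
    ind φ hφ V ≃ₗ[K] PiTensorProduct K fun i => V i :=
  (IndMod.tensorEquiv φ (V := fun j => (V j).carrier) hR hB :)

lemma tensorEquiv_gen (hR : ∀ i, Function.Surjective (algebraMap K (R i)))
    (hB : Function.Bijective (algebraMap K B)) (V : ∀ i, EqMod (actR i)) (v : ∀ i, V i) :
    tensorEquiv φ hφ hR hB V (gen φ hφ V v) = PiTensorProduct.tprod K v :=
  IndMod.tensorEquiv_gen φ (V := fun j => (V j).carrier) hR hB v

variable (hR : ∀ i, Function.Surjective (algebraMap K (R i)))
  (hB : Function.Bijective (algebraMap K B)) {X Y Y' : ∀ i, EqMod (actR i)} (i : I)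
  {V V' : EqMod (actR i)} (a : Y i ≅ V) (b : ∀ j : ({i}ᶜ : Set I), Y j ≅ X j)
  (a' : Y' i ≅ V') (b' : ∀ j : ({i}ᶜ : Set I), Y' j ≅ X j)

/-- The induced module as a tensor product of its `i`-th factor with the tensor product of the
other factors. The isomorphisms `a` and `b` identify the argument `Y` with the value of
`insertAt X i` at `V`, which is not available definitionally. -/
noncomputable def splitEquiv :
    ind φ hφ Y ≃ₗ[K] (PiTensorProduct K fun j : ({i}ᶜ : Set I) => X j) ⊗[K] V :=
  haveI := Classical.decEq I
  (tensorEquiv φ hφ hR hB Y).trans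
    ((PiTensorProduct.equivPiTensorComplSingletonTensor K _ i).trans
      (TensorProduct.congr (PiTensorProduct.congr fun j => linEquiv (b j)) (linEquiv a)))

lemma splitEquiv_gen (v : ∀ j, Y j) :
    splitEquiv φ hφ hR hB i a b (gen φ hφ _ v) =
      (PiTensorProduct.tprod K fun j : ({i}ᶜ : Set I) => lin (b j).hom (v j)) ⊗ₜ[K]
        lin a.hom (v i) := by
  simp only [splitEquiv, LinearEquiv.trans_apply]
  rw [tensorEquiv_gen]
  have := Classical.decEq I
  refine (congrArg (TensorProduct.congr _ _)
    (PiTensorProduct.equivPiTensorComplSingletonTensor_tprod K _ i v)).trans ?_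
  refine (TensorProduct.congr_tmul _ _ _ _).trans ?_
  exact congrArg₂ _ (PiTensorProduct.congr_tprod _ _) rfl

lemma splitEquiv_ρ (g : G) (x : ind φ hφ Y) :
    splitEquiv φ hφ hR hB i a b ((ind φ hφ Y).ρ g x) =
      TensorProduct.map (PiTensorProduct.map fun j : ({i}ᶜ : Set I) => (X j).ρ g) (V.ρ g)
        (splitEquiv φ hφ hR hB i a b x) := by
  refine DFunLike.congr_fun (ind_linearMap_ext (φ := φ) (hφ := hφ)
    (f := (splitEquiv φ hφ hR hB i a b).toLinearMap ∘ₗ (ind φ hφ Y).ρ g)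
    (g := TensorProduct.map _ _ ∘ₗ (splitEquiv φ hφ hR hB i a b).toLinearMap) hB.2
    fun v => ?_) x
  simp only [LinearMap.comp_apply, LinearEquiv.coe_coe]
  rw [ind_ρ_gen, splitEquiv_gen, splitEquiv_gen, TensorProduct.map_tmul,
    PiTensorProduct.map_tprod]
  simp only [lin_ρ]

lemma splitEquiv_indMap (f : Y ⟶ Y') (g : V ⟶ V') (hi : f i ≫ a'.hom = a.hom ≫ g)
    (hj : ∀ j : ({i}ᶜ : Set I), f j.1 ≫ (b' j).hom = (b j).hom) (x : ind φ hφ Y) :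
    splitEquiv φ hφ hR hB i a' b' (lin (indMap φ hφ f) x) =
      TensorProduct.map LinearMap.id ((lin g).restrictScalars K)
        (splitEquiv φ hφ hR hB i a b x) := by
  refine DFunLike.congr_fun (ind_linearMap_ext (φ := φ) (hφ := hφ)
    (f := (splitEquiv φ hφ hR hB i a' b').toLinearMap ∘ₗ (lin (indMap φ hφ f)).restrictScalars K)
    (g := TensorProduct.map _ _ ∘ₗ (splitEquiv φ hφ hR hB i a b).toLinearMap) hB.2
    fun v => ?_) x
  simp only [LinearMap.comp_apply, LinearEquiv.coe_coe, LinearMap.coe_restrictScalars]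
  rw [indMap_gen, splitEquiv_gen, splitEquiv_gen, TensorProduct.map_tmul]
  simp only [← lin_comp, hi, hj, LinearMap.id_apply, LinearMap.coe_restrictScalars]

/-- `splitEquiv` as a morphism of representations. -/
noncomputable def splitHom :
    (forgetRep actB).obj (ind φ hφ Y) ⟶
      (tensorLeft ((repTensor K G ({i}ᶜ : Set I)).obj fun j => (forgetRep (actR j)).obj (X j))).obj
        ((forgetRep (actR i)).obj V) :=
  Rep.ofHom
    { toLinearMap := (splitEquiv φ hφ hR hB i a b).toLinearMap
      isIntertwining' := fun g => LinearMap.ext fun x => splitEquiv_ρ φ hφ hR hB i a b g x }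

/-- `splitEquiv` as an isomorphism of representations. -/
noncomputable def splitIso :
    (forgetRep actB).obj (ind φ hφ Y) ≅
      (tensorLeft ((repTensor K G ({i}ᶜ : Set I)).obj fun j => (forgetRep (actR j)).obj (X j))).obj
        ((forgetRep (actR i)).obj V) :=
  haveI := rep_isIso_of_bijective (splitHom φ hφ hR hB i a b)
    (splitEquiv φ hφ hR hB i a b).bijective
  asIso (splitHom φ hφ hR hB i a b)

lemma splitHom_naturality (f : Y ⟶ Y') (g : V ⟶ V') (hi : f i ≫ a'.hom = a.hom ≫ g)
    (hj : ∀ j : ({i}ᶜ : Set I), f j.1 ≫ (b' j).hom = (b j).hom) :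
    (forgetRep actB).map (indMap φ hφ f) ≫ splitHom φ hφ hR hB i a' b' =
      splitHom φ hφ hR hB i a b ≫ (tensorLeft _).map ((forgetRep (actR i)).map g) :=
  Rep.hom_ext (Representation.IntertwiningMap.ext (LinearMap.ext fun x =>
    splitEquiv_indMap φ hφ hR hB i a b a' b' f g hi hj x))

/-- For one-dimensional algebras, the induction functor with all but one of its arguments fixed is,
on underlying representations, the tensor product with a fixed representation. -/
noncomputable def insertAtIndIso (X : ∀ i, EqMod (actR i)) :
    insertAt X i ⋙ indFunctor φ hφ ⋙ forgetRep actB ≅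
      forgetRep (actR i) ⋙ tensorLeft ((repTensor K G ({i}ᶜ : Set I)).obj
        fun j => (forgetRep (actR j)).obj (X j)) :=
  let a (V : EqMod (actR i)) : (insertAt X i).obj V i ≅ V := (insertAtEvalSelf X i).app V
  let b (V : EqMod (actR i)) (j : ({i}ᶜ : Set I)) : (insertAt X i).obj V j ≅ X j :=
    (insertAtEvalOfNe X i (Ne.symm j.2)).app V
  NatIso.ofComponents (fun V => splitIso φ hφ hR hB i (a V) (b V)) fun {V W} f =>
    splitHom_naturality φ hφ hR hB i (a V) (b V) (a W) (b W) ((insertAt X i).map f) f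
      ((insertAtEvalSelf X i).hom.naturality f)
      (fun j => ((insertAtEvalOfNe X i (Ne.symm j.2)).hom.naturality f).trans (Category.comp_id _))

/-- For one-dimensional algebras, induction is co-continuous in each variable: tensoring with a
fixed representation is a left adjoint. -/
lemma preservesColimits_insertAt_indFunctor
    (hR : ∀ i, Function.Surjective (algebraMap K (R i)))
    (hB : Function.Bijective (algebraMap K B)) (i : I)
    (hi : Function.Bijective (algebraMap K (R i))) (X : ∀ i, EqMod (actR i)) :
    PreservesColimitsOfSize.{u, u} (insertAt X i ⋙ indFunctor φ hφ) := by
  have := forgetRep_isEquivalence (act := actB) hB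
  have := forgetRep_isEquivalence (act := actR i) hi
  have : PreservesColimitsOfSize.{u, u} ((insertAt X i ⋙ indFunctor φ hφ) ⋙ forgetRep actB) :=
    preservesColimits_of_natIso (insertAtIndIso φ hφ hR hB i X).symm
  exact preservesColimits_of_reflects_of_preserves _ (forgetRep actB)

end EqMod

end Colimits

/-! ### The gauging of a one-dimensional theory is a 2AQFT -/

namespace EquivariantAQFT

open EqMod

variable {K : Type u} [Field K] {C : Type w} [Category.{v} C] {O : Orthogonality C}
  {G : Type u} [Group G] (A : EquivariantAQFT.{v, w, u} K O G)

/-- The generator `[v₁, …, vₙ]` of a factorization product of `𝔄ᴳ`. -/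
noncomputable def prodGen {I : Type} {c : I → C} {t : C} (f : Op O c t)
    (V : ∀ i, EqMod (A.act (c i))) (v : ∀ i, V i) : (A.gaugingProd f).obj V :=
  EqMod.gen _ _ V v

variable {A}

lemma gaugingProd_hom_ext {I : Type} {c : I → C} {t : C} {f : Op O c t}
    {V : ∀ i, EqMod (A.act (c i))} {W : EqMod (A.act t)} {k l : (A.gaugingProd f).obj V ⟶ W}
    (h : ∀ v, lin k (A.prodGen f V v) = lin l (A.prodGen f V v)) : k = l :=
  ind_hom_ext h

variable (A)

lemma gaugingProd_map_gen {I : Type} {c : I → C} {t : C} (f : Op O c t)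
    {V W : ∀ i, EqMod (A.act (c i))} (h : V ⟶ W) (v : ∀ i, V i) :
    lin ((A.gaugingProd f).map h) (A.prodGen f V v) =
      A.prodGen f W fun i => lin (h i) (v i) :=
  indMap_gen _ _ h v

/-- The components of the composition coherence of `𝔄ᴳ`. -/
noncomputable def decompHom {I : Type} {J : I → Type} {b : ∀ i, J i → C} {a : I → C} {t : C}
    (f : Op O a t) (g : ∀ i, Op O (b i) (a i)) (V : ∀ p : Σ i, J i, EqMod (A.act (b p.1 p.2))) :
    (A.gaugingProd (f.comp g)).obj V ⟶
      (A.gaugingProd f).obj fun i => (A.gaugingProd (g i)).obj fun j => V ⟨i, j⟩ :=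
  (A.gaugingDecomp f g).app V

lemma decompHom_gen {I : Type} {J : I → Type} {b : ∀ i, J i → C} {a : I → C} {t : C}
    (f : Op O a t) (g : ∀ i, Op O (b i) (a i)) (V : ∀ p : Σ i, J i, EqMod (A.act (b p.1 p.2)))
    (v : ∀ p, V p) :
    lin (A.decompHom f g V) (A.prodGen (f.comp g) V v) =
      A.prodGen f (fun i => (A.gaugingProd (g i)).obj fun j => V ⟨i, j⟩)
        fun i => A.prodGen (g i) (fun j => V ⟨i, j⟩) fun j => v ⟨i, j⟩ :=
  decompApp_gen (T := fun p => A.aqft.obj.obj (b p.1 p.2))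
    (actT := fun p => A.act (b p.1 p.2)) _ _ _ _ _ _ _ V v

/-- The components of the permutation coherence of `𝔄ᴳ`. -/
noncomputable def permHom {I I' : Type} [Finite I] [Finite I'] (e : I' ≃ I) {c : I → C} {t : C}
    (f : Op O c t) (f' : Op O (fun i' => c (e i')) t) (h : f' = f.perm e)
    (V : ∀ i, EqMod (A.act (c i))) :
    (A.gaugingProd f).obj V ⟶ (A.gaugingProd f').obj fun i' => V (e i') :=
  (A.gauging.perm e f f' h).app V

lemma permHom_gen {I I' : Type} [Finite I] [Finite I'] (e : I' ≃ I) {c : I → C} {t : C}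
    (f : Op O c t) (f' : Op O (fun i' => c (e i')) t) (h : f' = f.perm e)
    (V : ∀ i, EqMod (A.act (c i))) (v : ∀ i, V i) :
    lin (A.permHom e f f' h V) (A.prodGen f V v) =
      A.prodGen f' (fun i' => V (e i')) fun i' => v (e i') :=
  permApp_gen _ _ e _ _ _ V v

/-- The components of the unit coherence of `𝔄ᴳ`. -/
noncomputable def unitHom (t : C) (V : EqMod (A.act t)) :
    V ⟶ (A.gaugingProd (Op.id O t)).obj fun _ => V :=
  (A.gauging.unit t).app V

/-- The value of a composition from the values of its factors, for objects which are equivariant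
modules only up to unfolding `A.gauging`. -/
lemma lin_comp_eq {c : C} {U V W : EqMod (A.act c)} (f : U ⟶ V) (g : V ⟶ W) {x : U} {y : V}
    {z : W} (h₁ : lin f x = y) (h₂ : lin g y = z) : lin (f ≫ g) x = z := by
  rw [lin_comp, h₁, h₂]

lemma decompHom_assoc {I : Type} [Finite I] {J : I → Type} [∀ i, Finite (J i)]
    {L : ∀ i, J i → Type} [∀ i j, Finite (L i j)] {d : ∀ i j, L i j → C} {b : ∀ i, J i → C}
    {a : I → C} {t : C} (f : Op O a t) (g : ∀ i, Op O (b i) (a i))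
    (h : ∀ i j, Op O (d i j) (b i j))
    (V : ∀ p : Σ i, Σ j, L i j, EqMod (A.act (d p.1 p.2.1 p.2.2))) :
    A.permHom (sigmaAssoc L) (f.comp fun i => (g i).comp (h i)) _ (Op.assoc_eq f g h) V ≫
        A.decompHom (f.comp g) (fun p => h p.1 p.2) (fun q => V (sigmaAssoc L q)) ≫
        A.decompHom f g (fun p => (A.gaugingProd (h p.1 p.2)).obj fun l => V ⟨p.1, p.2, l⟩) =
      A.decompHom f (fun i => (g i).comp (h i)) V ≫
        (A.gaugingProd f).map (fun i => A.decompHom (g i) (h i) fun q => V ⟨i, q⟩) := by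
  refine gaugingProd_hom_ext fun v => ?_
  have h₁ := A.permHom_gen (sigmaAssoc L) (f.comp fun i => (g i).comp (h i)) _
    (Op.assoc_eq f g h) V v
  have h₂ := A.decompHom_gen (f.comp g) (fun p => h p.1 p.2) (fun q => V (sigmaAssoc L q))
    fun q => v (sigmaAssoc L q)
  have h₃ := A.decompHom_gen f g
    (fun p => (A.gaugingProd (h p.1 p.2)).obj fun l => V ⟨p.1, p.2, l⟩)
    fun p => A.prodGen (h p.1 p.2) (fun l => V ⟨p.1, p.2, l⟩) fun l => v ⟨p.1, p.2, l⟩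
  have h₄ := A.decompHom_gen f (fun i => (g i).comp (h i)) V v
  have h₅ := A.gaugingProd_map_gen f (fun i => A.decompHom (g i) (h i) fun q => V ⟨i, q⟩)
    fun i => A.prodGen ((g i).comp (h i)) (fun q => V ⟨i, q⟩) fun q => v ⟨i, q⟩
  simp only [decompHom_gen] at h₅
  exact (A.lin_comp_eq _ _ h₁ (A.lin_comp_eq _ _ h₂ h₃)).trans (A.lin_comp_eq _ _ h₄ h₅).symm

lemma decompHom_unit_left {I : Type} [Finite I] {c : I → C} {t : C} (f : Op O c t)
    (V : ∀ i, EqMod (A.act (c i))) :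
    A.permHom (unitSigma I) f _ (Op.id_comp_eq f) V ≫
        A.decompHom (Op.id O t) (fun _ => f) (fun p => V p.2) =
      A.unitHom t ((A.gaugingProd f).obj V) := by
  refine gaugingProd_hom_ext fun v => ?_
  have h₁ := A.permHom_gen (unitSigma I) f _ (Op.id_comp_eq f) V v
  have h₂ := A.decompHom_gen (Op.id O t) (fun _ => f) (fun p => V p.2) fun p => v p.2
  exact A.lin_comp_eq _ _ h₁ h₂

lemma decompHom_unit_right {I : Type} [Finite I] {c : I → C} {t : C} (f : Op O c t)
    (V : ∀ i, EqMod (A.act (c i))) :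
    A.permHom (sigmaUnit I) f _ (Op.comp_id_eq f) V ≫
        A.decompHom f (fun i => Op.id O (c i)) (fun p => V p.1) =
      (A.gaugingProd f).map (fun i => A.unitHom (c i) (V i)) := by
  refine gaugingProd_hom_ext fun v => ?_
  have h₁ := A.permHom_gen (sigmaUnit I) f _ (Op.comp_id_eq f) V v
  have h₂ := A.decompHom_gen f (fun i => Op.id O (c i)) (fun p => V p.1) fun p => v p.1
  have h₃ := A.gaugingProd_map_gen f (fun i => A.unitHom (c i) (V i)) v
  exact (A.lin_comp_eq _ _ h₁ h₂).trans h₃.symm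

lemma permHom_trans {I I' I'' : Type} [Finite I] [Finite I'] [Finite I''] (e : I' ≃ I)
    (e' : I'' ≃ I') {c : I → C} {t : C} (f : Op O c t) (V : ∀ i, EqMod (A.act (c i))) :
    A.permHom e f _ rfl V ≫ A.permHom e' (f.perm e) _ rfl (fun i' => V (e i')) =
      A.permHom (e'.trans e) f _ rfl V := by
  refine gaugingProd_hom_ext fun v => ?_
  have h₁ := A.permHom_gen e f _ rfl V v
  have h₂ := A.permHom_gen e' (f.perm e) _ rfl (fun i => V (e i)) (fun i => v (e i))
  have h₃ := A.permHom_gen (e'.trans e) f _ rfl V v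
  exact (A.lin_comp_eq _ _ h₁ h₂).trans h₃.symm

lemma decompHom_outer {I I' : Type} [Finite I] [Finite I'] (e : I' ≃ I) {J : I → Type}
    [∀ i, Finite (J i)] {b : ∀ i, J i → C} {a : I → C} {t : C} (f : Op O a t)
    (g : ∀ i, Op O (b i) (a i)) (V : ∀ p : Σ i, J i, EqMod (A.act (b p.1 p.2))) :
    A.permHom (sigmaOuter e J) (f.comp g) ((f.perm e).comp fun i' => g (e i')) rfl V ≫
        A.decompHom (f.perm e) (fun i' => g (e i')) (fun p => V ⟨e p.1, p.2⟩) =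
      A.decompHom f g V ≫
        A.permHom e f _ rfl (fun i => (A.gaugingProd (g i)).obj fun j => V ⟨i, j⟩) := by
  refine gaugingProd_hom_ext fun v => ?_
  have h₁ := A.permHom_gen (sigmaOuter e J) (f.comp g) ((f.perm e).comp fun i' => g (e i'))
    rfl V v
  have h₂ := A.decompHom_gen (f.perm e) (fun i' => g (e i')) (fun p => V ⟨e p.1, p.2⟩)
    fun p => v ⟨e p.1, p.2⟩
  have h₃ := A.decompHom_gen f g V v
  have h₄ := A.permHom_gen e f _ rfl (fun i => (A.gaugingProd (g i)).obj fun j => V ⟨i, j⟩)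
    fun i => A.prodGen (g i) (fun j => V ⟨i, j⟩) fun j => v ⟨i, j⟩
  exact (A.lin_comp_eq _ _ h₁ h₂).trans (A.lin_comp_eq _ _ h₃ h₄).symm

lemma decompHom_inner {I : Type} [Finite I] {J J' : I → Type} [∀ i, Finite (J i)]
    [∀ i, Finite (J' i)] (e : ∀ i, J' i ≃ J i) {b : ∀ i, J i → C} {a : I → C} {t : C}
    (f : Op O a t) (g : ∀ i, Op O (b i) (a i))
    (V : ∀ p : Σ i, J i, EqMod (A.act (b p.1 p.2))) :
    A.permHom (sigmaInner e) (f.comp g) (f.comp fun i => (g i).perm (e i)) rfl V ≫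
        A.decompHom f (fun i => (g i).perm (e i)) (fun p => V ⟨p.1, e p.1 p.2⟩) =
      A.decompHom f g V ≫
        (A.gaugingProd f).map (fun i => A.permHom (e i) (g i) _ rfl fun j => V ⟨i, j⟩) := by
  refine gaugingProd_hom_ext fun v => ?_
  have h₁ := A.permHom_gen (sigmaInner e) (f.comp g) (f.comp fun i => (g i).perm (e i)) rfl V v
  have h₂ := A.decompHom_gen f (fun i => (g i).perm (e i)) (fun p => V ⟨p.1, e p.1 p.2⟩)
    fun p => v ⟨p.1, e p.1 p.2⟩
  have h₃ := A.decompHom_gen f g V v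
  have h₄ := A.gaugingProd_map_gen f (fun i => A.permHom (e i) (g i) _ rfl fun j => V ⟨i, j⟩)
    fun i => A.prodGen (g i) (fun j => V ⟨i, j⟩) fun j => v ⟨i, j⟩
  simp only [permHom_gen] at h₄
  exact (A.lin_comp_eq _ _ h₁ h₂).trans (A.lin_comp_eq _ _ h₃ h₄).symm

lemma lin_update {I : Type} [DecidableEq I] {c : I → C} {X Y : ∀ i, EqMod (A.act (c i))}
    (h : ∀ i, X i ⟶ Y i) (i : I) (m : X i ⟶ Y i) (v : ∀ i, X i) :
    (fun j => lin (Function.update h i m j) (v j)) =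
      Function.update (fun j => lin (h j) (v j)) i (lin m (v i)) :=
  funext fun j => by
    by_cases hj : j = i
    · subst hj
      simp
    · simp [hj]

/-- The multilinearity of the factorization products of `𝔄ᴳ`. -/
lemma gaugingProd_multi (hA : ∀ c, Function.Bijective (algebraMap K (A.aqft.obj.obj c)))
    {I : Type} [Finite I] {c : I → C} {t : C} (f : Op O c t) :
    IsMultiLinCocont K (A.gaugingProd f) where
  map_update_add {_ X Y} h i k l := gaugingProd_hom_ext fun v => by
    have e (m : X i ⟶ Y i) := (A.gaugingProd_map_gen f (V := X) (W := Y)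
      (Function.update h i m) v).trans (congrArg (A.prodGen f Y) (A.lin_update h i m v))
    exact ((e (k + l)).trans (IndMod.gen_update_add _ (fun j => (Y j).carrier) _ i _ _)).trans
      (congrArg₂ (· + ·) (e k) (e l)).symm
  map_update_smul {_ X Y} h i r k := gaugingProd_hom_ext fun v => by
    have e (m : X i ⟶ Y i) := (A.gaugingProd_map_gen f (V := X) (W := Y)
      (Function.update h i m) v).trans (congrArg (A.prodGen f Y) (A.lin_update h i m v))
    exact ((e (r • k)).trans (IndMod.gen_update_smul _ (fun j => (Y j).carrier) _ i _ _)).trans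
      (congrArg (r • ·) (e k)).symm
  preserves X i := preservesColimits_insertAt_indFunctor _ _ (fun j => (hA (c j)).2) (hA t) i
    (hA (c i)) X

lemma isIso_decompHom (hA : ∀ c, Function.Bijective (algebraMap K (A.aqft.obj.obj c)))
    {I : Type} [Finite I] {J : I → Type} [∀ i, Finite (J i)]
    {b : ∀ i, J i → C} {a : I → C} {t : C} (f : Op O a t) (g : ∀ i, Op O (b i) (a i))
    (V : ∀ p : Σ i, J i, EqMod (A.act (b p.1 p.2))) : IsIso (A.decompHom f g V) :=
  isIso_of_bijective _ (IndMod.bijective_decomp (T := fun p => A.aqft.obj.obj (b p.1 p.2))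
    (V := fun p => (V p).carrier) _ (fun i => hA (a i)) (hA t) (fun _ => (hA _).2) _ _
    fun i j x => A.map_comp_apply ((g i).hom j) (f.hom i) x)

lemma isIso_unitHom (hA : ∀ c, Function.Bijective (algebraMap K (A.aqft.obj.obj c)))
    (t : C) (V : EqMod (A.act t)) : IsIso (A.unitHom t V) :=
  isIso_of_bijective _ (IndMod.bijective_unit (hA t) V.carrier _)

lemma isIso_permHom (hA : ∀ c, Function.Bijective (algebraMap K (A.aqft.obj.obj c)))
    {I I' : Type} [Finite I] [Finite I'] (e : I' ≃ I) {c : I → C} {t : C}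
    (f : Op O c t) (f' : Op O (fun i' => c (e i')) t) (h : f' = f.perm e)
    (V : ∀ i, EqMod (A.act (c i))) : IsIso (A.permHom e f f' h V) :=
  isIso_of_bijective _ (IndMod.bijective_perm (V := fun i => (V i).carrier) _ e
    (fun i => (hA (c i)).2) (hA t) _ fun i' => by subst h; rfl)

/-- The gauging of a one-dimensional theory is a 2AQFT. -/
theorem gauging_isTwoAQFT (hA : ∀ c, Function.Bijective (algebraMap K (A.aqft.obj.obj c))) :
    IsTwoAQFT A.gauging where
  presentable c := by
    have := forgetRep_isEquivalence (act := A.act c) (hA c)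
    exact (forgetRep (A.act c)).asEquivalence.symm.isLocallyPresentable
  multi f := A.gaugingProd_multi hA f
  isIso_decomp := by
    intro _ _ _ _ _ _ _ f g
    have h (V) : IsIso ((A.gauging.decomp f g).app V) := A.isIso_decompHom hA f g V
    exact NatIso.isIso_of_isIso_app _
  isIso_unit := by
    intro t
    have h (V) : IsIso ((A.gauging.unit t).app V) := A.isIso_unitHom hA t V
    exact NatIso.isIso_of_isIso_app _
  isIso_perm := by
    intro _ _ _ _ e _ _ f f' h
    have h (V) : IsIso ((A.gauging.perm e f f' h).app V) := A.isIso_permHom hA e f f' h V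
    exact NatIso.isIso_of_isIso_app _
  assoc := A.decompHom_assoc
  unit_left := A.decompHom_unit_left
  unit_right := A.decompHom_unit_right
  perm_refl f V := gaugingProd_hom_ext fun v => A.permHom_gen _ _ _ _ V v
  perm_trans := A.permHom_trans
  outer := A.decompHom_outer
  inner := A.decompHom_inner

end EquivariantAQFT

/-! ### Factorization products, pointings and truncation in the one-dimensional case -/

namespace EquivariantAQFT

open EqMod

variable {K : Type u} [Field K] {C : Type w} [Category.{v} C] {O : Orthogonality C}
  {G : Type u} [Group G] (A : EquivariantAQFT.{v, w, u} K O G)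
  (hA : ∀ c, Function.Bijective (algebraMap K (A.aqft.obj.obj c)))

/-- The linear equivalence `v₁ ⊗ ⋯ ⊗ vₙ ⊗ 1 ↦ v₁ ⊗ ⋯ ⊗ vₙ` underlying `prodIsoRepTensor`. -/
noncomputable def prodEquiv {I : Type} {c : I → C} {t : C} (f : Op O c t)
    (V : ∀ i, EqMod (A.act (c i))) : (A.gaugingProd f).obj V ≃ₗ[K] PiTensorProduct K fun i => V i :=
  EqMod.tensorEquiv _ _ (fun i => (hA (c i)).2) (hA t) V

lemma prodEquiv_gen {I : Type} {c : I → C} {t : C} (f : Op O c t)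
    (V : ∀ i, EqMod (A.act (c i))) (v : ∀ i, V i) :
    A.prodEquiv hA f V (A.prodGen f V v) = PiTensorProduct.tprod K v :=
  EqMod.tensorEquiv_gen _ _ (fun i => (hA (c i)).2) (hA t) V v

variable {A} in
lemma gaugingProd_linearMap_ext {I : Type} {c : I → C} {t : C} {f : Op O c t}
    {V : ∀ i, EqMod (A.act (c i))} {W : Type u} [AddCommGroup W] [Module K W]
    (ht : Function.Surjective (algebraMap K (A.aqft.obj.obj t)))
    {k l : (A.gaugingProd f).obj V →ₗ[K] W}
    (h : ∀ v, k (A.prodGen f V v) = l (A.prodGen f V v)) : k = l :=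
  ind_linearMap_ext ht h

/-- `prodEquiv` as a morphism of representations. -/
noncomputable def prodHom {I : Type} {c : I → C} {t : C} (f : Op O c t)
    (V : ∀ i, EqMod (A.act (c i))) :
    (forgetRep (A.act t)).obj ((A.gaugingProd f).obj V) ⟶
      (repTensor K G I).obj fun i => (forgetRep (A.act (c i))).obj (V i) :=
  Rep.ofHom
    { toLinearMap := (A.prodEquiv hA f V).toLinearMap
      isIntertwining' := fun g => gaugingProd_linearMap_ext (hA t).2 fun v => by
        refine (congrArg (A.prodEquiv hA f V) (ind_ρ_gen _ _ V g v)).trans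
          ((A.prodEquiv_gen hA f V _).trans ?_)
        refine Eq.trans ?_ (congrArg (PiTensorProduct.map fun i => (V i).ρ g)
          (A.prodEquiv_gen hA f V v)).symm
        exact (PiTensorProduct.map_tprod _ _).symm }

/-- `prodEquiv` as an isomorphism of representations. -/
noncomputable def prodIso {I : Type} {c : I → C} {t : C} (f : Op O c t)
    (V : ∀ i, EqMod (A.act (c i))) :
    (forgetRep (A.act t)).obj ((A.gaugingProd f).obj V) ≅
      (repTensor K G I).obj fun i => (forgetRep (A.act (c i))).obj (V i) :=
  haveI := rep_isIso_of_bijective (A.prodHom hA f V) (A.prodEquiv hA f V).bijective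
  asIso (A.prodHom hA f V)

/-- The factorization products of the gauging of a one-dimensional theory are the tensor products
of representations. -/
noncomputable def prodIsoRepTensor {I : Type} [Finite I] {c : I → C} {t : C} (f : Op O c t) :
    A.gauging.prod f ⋙ A.toRep t ≅
      Functor.pi (fun i => A.toRep (c i)) ⋙ repTensor K G I :=
  NatIso.ofComponents (fun V => A.prodIso hA f V)
    fun {V W : ∀ i, EqMod (A.act (c i))} (h : ∀ i, V i ⟶ W i) =>
    Rep.hom_ext (Representation.IntertwiningMap.ext (gaugingProd_linearMap_ext (hA t).2
      fun v => by
        refine (congrArg (A.prodEquiv hA f W) (A.gaugingProd_map_gen f h v)).trans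
          ((A.prodEquiv_gen hA f W _).trans ?_)
        refine Eq.trans ?_ (congrArg (PiTensorProduct.map (R := K) (s := fun i => (V i).carrier)
            (t := fun i => (W i).carrier) fun i => (lin (h i)).restrictScalars K)
          (A.prodEquiv_gen hA f V v)).symm
        exact (PiTensorProduct.map_tprod (R := K) (s := fun i => (V i).carrier)
          (t := fun i => (W i).carrier) (fun i => (lin (h i)).restrictScalars K) v).symm))

/-- The pointing of the gauging of a one-dimensional theory is the trivial representation. -/
noncomputable def pointIso (t : C) :
    (A.toRep t).obj (A.gauging.point t) ≅ Rep.trivial K G K :=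
  (A.prodIsoRepTensor hA (Op.empty O t)).app _ ≪≫
    Rep.mkIso (X := PiTensorProduct K _)
      { toLinearEquiv := PiTensorProduct.isEmptyEquiv Empty
        isIntertwining' := fun _ => PiTensorProduct.ext (MultilinearMap.ext fun v =>
          (congrArg (PiTensorProduct.isEmptyEquiv Empty) (PiTensorProduct.map_tprod _ v)).trans
            ((PiTensorProduct.isEmptyEquiv_apply_tprod _ _).trans
              (PiTensorProduct.isEmptyEquiv_apply_tprod _ v).symm)) }

/-- The pointing of `𝔄ᴳ(t)` as an equivariant module. -/
noncomputable def pointMod (t : C) : EqMod (A.act t) := A.gauging.point t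

/-- The generator of the pointing of `𝔄ᴳ(t)`. -/
noncomputable def pointGen (t : C) : A.pointMod t :=
  A.prodGen (Op.empty O t) _ fun i => i.elim

lemma prodGen_empty (t : C) (v : ∀ i : Empty, (i.elim : EqMod (A.act i.elim))) :
    A.prodGen (Op.empty O t) (fun i => i.elim) v = A.pointGen t :=
  congrArg (A.prodGen (Op.empty O t) fun i => i.elim) (funext fun i => i.elim)

/-- The coordinate of the pointing with respect to its generator. -/
noncomputable def pointEquiv (t : C) : A.pointMod t ≃ₗ[K] K :=
  (A.prodEquiv hA (Op.empty O t) fun i => i.elim).trans (PiTensorProduct.isEmptyEquiv Empty)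

lemma pointEquiv_pointGen (t : C) : A.pointEquiv hA t (A.pointGen t) = 1 :=
  (congrArg (PiTensorProduct.isEmptyEquiv Empty) (A.prodEquiv_gen hA _ _ _)).trans
    (PiTensorProduct.isEmptyEquiv_apply_tprod _ _)

variable {A} in
lemma pointMod_hom_ext {t : C} {V : EqMod (A.act t)} {k l : A.pointMod t ⟶ V}
    (h : lin k (A.pointGen t) = lin l (A.pointGen t)) : k = l :=
  gaugingProd_hom_ext (f := Op.empty O t) (V := fun i => i.elim) fun v =>
    (congrArg (lin k) (A.prodGen_empty t v)).trans
      (h.trans (congrArg (lin l) (A.prodGen_empty t v)).symm)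

lemma lin_algebraMap_end {c : C} (V : EqMod (A.act c)) (k : K) (v : V) :
    lin (V := V) (W := V) (algebraMap K (End V) k) v = k • v := by
  rw [Algebra.algebraMap_eq_smul_one]
  rfl

lemma bijective_algebraMap_end_pointMod
    (hA : ∀ c, Function.Bijective (algebraMap K (A.aqft.obj.obj c))) (t : C) :
    Function.Bijective (algebraMap K (End (A.pointMod t))) := by
  have h₁ := A.pointEquiv_pointGen hA t
  have h₂ (k : K) : A.pointEquiv hA t (lin (V := A.pointMod t) (W := A.pointMod t)
      (algebraMap K (End (A.pointMod t)) k) (A.pointGen t)) = k := by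
    rw [lin_algebraMap_end, map_smul, h₁, smul_eq_mul, mul_one]
  refine ⟨fun k l hkl => ?_, fun h => ⟨A.pointEquiv hA t
    (lin (V := A.pointMod t) (W := A.pointMod t) h (A.pointGen t)),
    pointMod_hom_ext ((A.pointEquiv hA t).injective (h₂ _))⟩⟩
  rw [← h₂ k, ← h₂ l, hkl]

/-- The pointing of the gauging of a one-dimensional theory has only scalar endomorphisms. -/
lemma bijective_algebraMap_truncation (t : C) :
    Function.Bijective (algebraMap K
      ((truncation ⟨_, A.gauging_isTwoAQFT hA⟩).obj.obj t)) :=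
  A.bijective_algebraMap_end_pointMod hA t

end EquivariantAQFT

/-! ### One-dimensional AQFTs -/

namespace AQFT

variable {K : Type u} [Field K] {C : Type w} [Category.{v} C] {O : Orthogonality C}

/-- Any two AQFTs with one-dimensional algebras are isomorphic, since algebra homomorphisms preserve
scalars. -/
noncomputable def isoOfOneDimensional (A B : AQFT.{v, w, u} K O)
    (hA : ∀ c, Function.Bijective (algebraMap K (A.obj.obj c)))
    (hB : ∀ c, Function.Bijective (algebraMap K (B.obj.obj c))) : A ≅ B :=
  (PerpCommutative K O).isoMk (NatIso.ofComponents (fun c =>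
    AlgEquiv.toAlgebraIso ((AlgEquiv.ofBijective (Algebra.ofId K (A.obj.obj c)) (hA c)).symm.trans
        (AlgEquiv.ofBijective (Algebra.ofId K (B.obj.obj c)) (hB c)))) fun {c d} f => by
    ext a
    obtain ⟨k, rfl⟩ := (hA c).2 a
    simp)

end AQFT

lemma bijective_algebraMap_trivialAQFT {K : Type u} [Field K] {C : Type w} [Category.{v} C]
    (O : Orthogonality C) (c : C) :
    Function.Bijective (algebraMap K ((trivialAQFT.{v, w, u} K O).obj.obj c)) :=
  Function.bijective_id

lemma EquivariantAQFT.bijective_algebraMap_orbifold {K : Type u} [Field K] {C : Type w}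
    [Category.{v} C] {O : Orthogonality C} {G : Type u} [Group G]
    (A : EquivariantAQFT.{v, w, u} K O G)
    (hA : ∀ c, Function.Bijective (algebraMap K (A.aqft.obj.obj c))) (c : C) :
    Function.Bijective (algebraMap K (A.orbifold.obj.obj c)) :=
  ⟨fun _ _ h => (hA c).1 (congrArg Subtype.val h), fun a => by
    obtain ⟨k, hk⟩ := (hA c).2 a.1
    exact ⟨k, Subtype.ext hk⟩⟩

/-! ### Modules as trivial representations -/

section TrivialModule

variable {K : Type u} [Field K] {G : Type u} [Group G] {R : Type u} [Ring R] [Algebra K R]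
  {A : Type u} [Ring A] [Algebra K A] (act : G →* (A →ₐ[K] A))
  (hA : Function.Bijective (algebraMap K A))

namespace EqMod

/-- The functor which sends a right `R`-module to its underlying vector space, regarded as a trivial
representation. -/
noncomputable def trivialModule : ModuleCat.{u} Rᵐᵒᵖ ⥤ EqMod act where
  obj V := ofRep act hA (Representation.trivial K G V)
  map {V W} f := mkHom (V := ofRep act hA (Representation.trivial K G V))
    (W := ofRep act hA (Representation.trivial K G W)) (f.hom.restrictScalars K)
    (mkHom_smul hA.2 (V := ofRep act hA (Representation.trivial K G V))
      (W := ofRep act hA (Representation.trivial K G W)) (f.hom.restrictScalars K))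
    (fun _ _ => rfl)

instance : (trivialModule (R := R) act hA).Additive where
  map_add := rfl

instance : (trivialModule (R := R) act hA).Linear K where
  map_smul _ _ := rfl

/-- Forgetting down to vector spaces reflects colimits, and the composition with `trivialModule` is
a restriction of scalars. -/
lemma preservesColimits_trivialModule :
    PreservesColimitsOfSize.{u, u} (trivialModule (R := R) act hA) := by
  have := forgetRep_isEquivalence (act := act) hA
  let F : EqMod act ⥤ ModuleCat.{u} K := forgetRep act ⋙ forget₂ (Rep.{u} K G) (ModuleCat.{u} K)
  have h : PreservesColimitsOfSize.{u, u} (ModuleCat.restrictScalars.{u} (algebraMap K Rᵐᵒᵖ)) :=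
    inferInstance
  have : PreservesColimitsOfSize.{u, u} (trivialModule (R := R) act hA ⋙ F) := h
  exact preservesColimits_of_reflects_of_preserves _ F

end EqMod

end TrivialModule

section ModTensor

variable {K : Type u} [Field K] {I : Type} {R : I → Type u}
  [∀ i, Ring (R i)] [∀ i, Algebra K (R i)] {B : Type u} [Ring B] [Algebra K B]
  (φ : ∀ i, R i →ₐ[K] B)

/-- For one-dimensional algebras, the induced module is the tensor product of the underlying vector
spaces. -/
noncomputable def modTensorEquiv (hR : ∀ i, Function.Surjective (algebraMap K (R i)))
    (hB : Function.Bijective (algebraMap K B)) (V : ∀ i, ModuleCat.{u} (R i)ᵐᵒᵖ) :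
    modInd φ V ≃ₗ[K] PiTensorProduct K fun i => V i :=
  { IndMod.tensorEquiv φ (V := fun i => (V i : Type u)) hR hB with
    map_smul' := fun k x => by
      refine Eq.trans ?_ ((IndMod.tensorEquiv φ (V := fun i => (V i : Type u)) hR hB).map_smul k x)
      refine congrArg (IndMod.tensorEquiv φ (V := fun i => (V i : Type u)) hR hB) ?_
      exact IndMod.op_algebraMap_smul (R := B) (V := IndMod φ fun i => (V i : Type u)) k x }

lemma modTensorEquiv_gen (hR : ∀ i, Function.Surjective (algebraMap K (R i)))
    (hB : Function.Bijective (algebraMap K B)) (V : ∀ i, ModuleCat.{u} (R i)ᵐᵒᵖ) (v : ∀ i, V i) :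
    modTensorEquiv φ hR hB V (modGen φ V v) = PiTensorProduct.tprod K v :=
  IndMod.tensorEquiv_gen φ (V := fun i => (V i : Type u)) hR hB v

end ModTensor

/-! ### The 1-morphism of trivial representations and the counit -/

namespace EquivariantAQFT

open EqMod

variable {K : Type u} [Field K] {C : Type w} [Category.{v} C] {O : Orthogonality C}
  {G : Type u} [Group G] (A : EquivariantAQFT.{v, w, u} K O G)
  (hA : ∀ c, Function.Bijective (algebraMap K (A.aqft.obj.obj c)))
  (B : AQFT.{v, w, u} K O) (hB : ∀ c, Function.Bijective (algebraMap K (B.obj.obj c)))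

/-- A right `𝔅(c)`-module as an equivariant `𝔄(c)`-module with trivial `G`-action. -/
noncomputable abbrev triv {c : C} (V : ModuleCat.{u} (B.obj.obj c)ᵐᵒᵖ) : EqMod (A.act c) :=
  (trivialModule (A.act c) (hA c)).obj V

/-- The generator `[v₁, …, vₙ]` of a factorization product of `ι(𝔅)`. -/
noncomputable def modProdGen {I : Type} {c : I → C} {t : C} (f : Op O c t)
    (V : ∀ i, ModuleCat.{u} (B.obj.obj (c i))ᵐᵒᵖ) (v : ∀ i, V i) : (AQFT.modProd B f).obj V :=
  modGen _ V v

/-- The linear equivalence `[v₁, …, vₙ] ↦ [v₁, …, vₙ]` between the factorization products of the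
gauging and of `ι(𝔅)`, both of which are tensor products of vector spaces. -/
noncomputable def trivEquiv {I : Type} {c : I → C} {t : C} (f : Op O c t)
    (V : ∀ i, ModuleCat.{u} (B.obj.obj (c i))ᵐᵒᵖ) :
    (A.gaugingProd f).obj (fun i => A.triv hA B (V i)) ≃ₗ[K]
      A.triv hA B ((AQFT.modProd B f).obj V) :=
  (A.prodEquiv hA f fun i => A.triv hA B (V i)).trans
    (modTensorEquiv (fun i => (B.obj.map (f.hom i)).hom) (fun i => (hB (c i)).2) (hB t) V).symm

lemma trivEquiv_gen {I : Type} {c : I → C} {t : C} (f : Op O c t)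
    (V : ∀ i, ModuleCat.{u} (B.obj.obj (c i))ᵐᵒᵖ) (v : ∀ i, V i) :
    A.trivEquiv hA B hB f V (A.prodGen f (fun i => A.triv hA B (V i)) v) =
      modProdGen B f V v := by
  refine (congrArg (modTensorEquiv _ (fun i => (hB (c i)).2) (hB t) V).symm
    (A.prodEquiv_gen hA f (fun i => A.triv hA B (V i)) v)).trans ?_
  exact (LinearEquiv.symm_apply_eq (modTensorEquiv (fun i => (B.obj.map (f.hom i)).hom)
    (fun i => (hB (c i)).2) (hB t) V)).2
      (modTensorEquiv_gen (fun i => (B.obj.map (f.hom i)).hom) (fun i => (hB (c i)).2) (hB t)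
        V v).symm

/-- `trivEquiv` as a morphism of equivariant modules. -/
noncomputable def trivHom {I : Type} {c : I → C} {t : C} (f : Op O c t)
    (V : ∀ i, ModuleCat.{u} (B.obj.obj (c i))ᵐᵒᵖ) :
    (A.gaugingProd f).obj (fun i => A.triv hA B (V i)) ⟶
      A.triv hA B ((AQFT.modProd B f).obj V) :=
  indMk (V := fun i => A.triv hA B (V i)) (A.trivEquiv hA B hB f V).toLinearMap
    (mkHom_smul (hA t).2 (V := (A.gaugingProd f).obj fun i => A.triv hA B (V i))
      (W := A.triv hA B ((AQFT.modProd B f).obj V)) (A.trivEquiv hA B hB f V).toLinearMap)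
    (fun _ _ => rfl)

lemma trivHom_gen {I : Type} {c : I → C} {t : C} (f : Op O c t)
    (V : ∀ i, ModuleCat.{u} (B.obj.obj (c i))ᵐᵒᵖ) (v : ∀ i, V i) :
    lin (A.trivHom hA B hB f V) (A.prodGen f (fun i => A.triv hA B (V i)) v) =
      modProdGen B f V v :=
  A.trivEquiv_gen hA B hB f V v

/-- `trivEquiv` as an isomorphism of equivariant modules. -/
noncomputable def trivIso {I : Type} {c : I → C} {t : C} (f : Op O c t)
    (V : ∀ i, ModuleCat.{u} (B.obj.obj (c i))ᵐᵒᵖ) :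
    (A.gaugingProd f).obj (fun i => A.triv hA B (V i)) ≅
      A.triv hA B ((AQFT.modProd B f).obj V) :=
  haveI := isIso_of_bijective (A.trivHom hA B hB f V) (A.trivEquiv hA B hB f V).bijective
  asIso (A.trivHom hA B hB f V)

lemma trivHom_naturality {I : Type} {c : I → C} {t : C} (f : Op O c t)
    {V W : ∀ i, ModuleCat.{u} (B.obj.obj (c i))ᵐᵒᵖ} (h : ∀ i, V i ⟶ W i) :
    (A.gaugingProd f).map (fun i => (trivialModule (A.act (c i)) (hA (c i))).map (h i)) ≫
        A.trivHom hA B hB f W =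
      A.trivHom hA B hB f V ≫
        (trivialModule (A.act t) (hA t)).map ((AQFT.modProd B f).map h) := by
  refine gaugingProd_hom_ext fun v => ?_
  have h₁ := A.gaugingProd_map_gen f
    (fun i => (trivialModule (A.act (c i)) (hA (c i))).map (h i)) v
  have h₂ := A.trivHom_gen hA B hB f W fun i => (h i).hom (v i)
  have h₃ := A.trivHom_gen hA B hB f V v
  have h₄ : lin ((trivialModule (A.act t) (hA t)).map ((AQFT.modProd B f).map h))
      (modProdGen B f V v) = modProdGen B f W fun i => (h i).hom (v i) := modMap_gen _ h v
  exact (A.lin_comp_eq _ _ h₁ h₂).trans (A.lin_comp_eq _ _ h₃ h₄).symm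

/-- The functors and coherence isomorphisms of `trivialHom`. -/
noncomputable def trivialPreHom : PreHom (AQFT.inclusion B) A.gauging where
  app c := trivialModule (A.act c) (hA c)
  coh f := NatIso.ofComponents (fun V => A.trivIso hA B hB f V)
    fun h => A.trivHom_naturality hA B hB f h

lemma trivHom_comp {I : Type} [Finite I] {J : I → Type} [∀ i, Finite (J i)] {b : ∀ i, J i → C}
    {a : I → C} {t : C} (f : Op O a t) (g : ∀ i, Op O (b i) (a i))
    (V : ∀ p : Σ i, J i, ModuleCat.{u} (B.obj.obj (b p.1 p.2))ᵐᵒᵖ) :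
    A.trivHom hA B hB (f.comp g) V ≫
        (trivialModule (A.act t) (hA t)).map ((AQFT.inclusionDecomp B f g).app V) =
      A.decompHom f g (fun p => A.triv hA B (V p)) ≫
        (A.gaugingProd f).map (fun i => A.trivHom hA B hB (g i) fun j => V ⟨i, j⟩) ≫
        A.trivHom hA B hB f (fun i => (AQFT.modProd B (g i)).obj fun j => V ⟨i, j⟩) := by
  refine gaugingProd_hom_ext fun v => ?_
  have h₁ := A.trivHom_gen hA B hB (f.comp g) V v
  have h₂ : lin ((trivialModule (A.act t) (hA t)).map ((AQFT.inclusionDecomp B f g).app V))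
      (modProdGen B (f.comp g) V v) =
      modProdGen B f (fun i => (AQFT.modProd B (g i)).obj fun j => V ⟨i, j⟩)
        fun i => modProdGen B (g i) (fun j => V ⟨i, j⟩) fun j => v ⟨i, j⟩ :=
    modDecompApp_gen (T := fun p => B.obj.obj (b p.1 p.2))
      (fun i => (B.obj.map (f.hom i)).hom) (fun i j => (B.obj.map ((g i).hom j)).hom)
      (fun p => (B.obj.map ((f.comp g).hom p)).hom)
      (fun i j x => AQFT.map_comp_apply B ((g i).hom j) (f.hom i) x) V v
  have h₃ := A.decompHom_gen f g (fun p => A.triv hA B (V p)) v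
  have h₄ := (A.gaugingProd_map_gen f (fun i => A.trivHom hA B hB (g i) fun j => V ⟨i, j⟩)
    fun i => A.prodGen (g i) (fun j => A.triv hA B (V ⟨i, j⟩)) fun j => v ⟨i, j⟩).trans
    (congrArg (A.prodGen f fun i => A.triv hA B ((AQFT.modProd B (g i)).obj fun j => V ⟨i, j⟩))
      (funext fun i => A.trivHom_gen hA B hB (g i) (fun j => V ⟨i, j⟩) fun j => v ⟨i, j⟩))
  have h₅ := A.trivHom_gen hA B hB f (fun i => (AQFT.modProd B (g i)).obj fun j => V ⟨i, j⟩)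
    fun i => modProdGen B (g i) (fun j => V ⟨i, j⟩) fun j => v ⟨i, j⟩
  exact (A.lin_comp_eq _ _ h₁ h₂).trans (A.lin_comp_eq _ _ h₃ (A.lin_comp_eq _ _ h₄ h₅)).symm

lemma trivHom_unit (t : C) (V : ModuleCat.{u} (B.obj.obj t)ᵐᵒᵖ) :
    A.unitHom t (A.triv hA B V) ≫ A.trivHom hA B hB (Op.id O t) (fun _ => V) =
      (trivialModule (A.act t) (hA t)).map (((AQFT.inclusion B).unit t).app V) :=
  EqMod.hom_ext fun v => A.trivHom_gen hA B hB (Op.id O t) (fun _ => V) fun _ => v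

lemma trivHom_perm {I I' : Type} [Finite I] [Finite I'] (e : I' ≃ I) {c : I → C} {t : C}
    (f : Op O c t) (V : ∀ i, ModuleCat.{u} (B.obj.obj (c i))ᵐᵒᵖ) :
    A.trivHom hA B hB f V ≫ (trivialModule (A.act t) (hA t)).map
        (((AQFT.inclusion B).perm e f _ rfl).app V) =
      A.permHom e f _ rfl (fun i => A.triv hA B (V i)) ≫
        A.trivHom hA B hB (f.perm e) (fun i' => V (e i')) := by
  refine gaugingProd_hom_ext fun v => ?_
  have h₁ := A.trivHom_gen hA B hB f V v
  have h₂ : lin ((trivialModule (A.act t) (hA t)).map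
      (((AQFT.inclusion B).perm e f _ rfl).app V)) (modProdGen B f V v) =
      modProdGen B (f.perm e) (fun i' => V (e i')) fun i' => v (e i') :=
    modPermApp_gen (fun i => (B.obj.map (f.hom i)).hom) e
      (fun i => (B.obj.map ((f.perm e).hom i)).hom) (fun _ => rfl) V v
  have h₃ := A.permHom_gen e f _ rfl (fun i => A.triv hA B (V i)) v
  have h₄ := A.trivHom_gen hA B hB (f.perm e) (fun i' => V (e i')) fun i' => v (e i')
  exact (A.lin_comp_eq _ _ h₁ h₂).trans (A.lin_comp_eq _ _ h₃ h₄).symm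

/-- The 1-morphism `ι(𝔅) → 𝔄ᴳ` between one-dimensional theories which regards a vector space as a
trivial representation. -/
noncomputable def trivialHom : Hom (AQFT.inclusion B) A.gauging where
  toPreHom := A.trivialPreHom hA B hB
  additive _ := inferInstanceAs (trivialModule _ _).Additive
  linear _ := inferInstanceAs ((trivialModule _ _).Linear K)
  preserves _ := preservesColimits_trivialModule _ _
  coh_comp f g V := A.trivHom_comp hA B hB f g V
  coh_unit t V := A.trivHom_unit hA B hB t V
  coh_perm e _ _ f V := A.trivHom_perm hA B hB e f V

/-- The pointing of `ι(𝔅)(t)` as a right module. -/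
noncomputable def inclusionPoint (t : C) : ModuleCat.{u} (B.obj.obj t)ᵐᵒᵖ :=
  (AQFT.inclusion B).point t

/-- The generator of the pointing of `ι(𝔅)(t)`. -/
noncomputable def inclusionPointGen (t : C) : inclusionPoint B t :=
  modProdGen B (Op.empty O t) _ fun i => i.elim

lemma eta_inclusionPointGen (t : C) (b : B.obj.obj t) :
    (show inclusionPoint B t ⟶ inclusionPoint B t from AQFT.eta B b).hom (inclusionPointGen B t) =
      op b • inclusionPointGen B t :=
  modLift_gen (φ := fun i => (B.obj.map ((Op.empty O t).hom i)).hom) _ _ _ _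

/-- The comparison of pointings of `trivialHom`. -/
noncomputable def trivialPointMap (t : C) : A.pointMod t ⟶ A.triv hA B (inclusionPoint B t) :=
  (A.trivialHom hA B hB).pointMap t

lemma trivialPointMap_pointGen (t : C) :
    lin (A.trivialPointMap hA B hB t) (A.pointGen t) = inclusionPointGen B t := by
  have h₁ := A.gaugingProd_map_gen (Op.empty O t) (V := fun i => i.elim)
    (W := fun i => A.triv hA B i.elim) (fun i => i.elim) (fun i => i.elim)
  have h₂ := A.trivHom_gen hA B hB (Op.empty O t) (fun i => i.elim) (fun i => i.elim)
  refine A.lin_comp_eq _ _ (h₁.trans ?_) h₂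
  exact congrArg (A.prodGen (Op.empty O t) fun i => A.triv hA B i.elim) (funext fun i => i.elim)

/-- The 1-morphism of trivial representations is the counit. Its adjunct is automatically the
identity since the algebras are one-dimensional. -/
lemma isCounit_trivialHom :
    IsCounit ⟨_, A.gauging_isTwoAQFT hA⟩ (A.trivialHom hA
      (truncation ⟨_, A.gauging_isTwoAQFT hA⟩) (A.bijective_algebraMap_truncation hA)) := by
  intro t h
  let B := truncation ⟨_, A.gauging_isTwoAQFT hA⟩
  let hB := A.bijective_algebraMap_truncation hA
  obtain ⟨k, rfl⟩ := A.bijective_algebraMap_truncation hA t |>.2 h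
  have h₁ := A.trivialPointMap_pointGen hA B hB t
  have h₂ : lin ((trivialModule (A.act t) (hA t)).map
      (show inclusionPoint B t ⟶ inclusionPoint B t from AQFT.eta B (algebraMap K (B.obj.obj t) k)))
      (inclusionPointGen B t) = k • inclusionPointGen B t :=
    eta_inclusionPointGen B t (algebraMap K (B.obj.obj t) k)
  have h₃ := A.lin_algebraMap_end (A.pointMod t) k (A.pointGen t)
  have h₄ := (lin_smul (A.trivialPointMap hA B hB t) k (A.pointGen t)).trans (congrArg _ h₁)
  refine pointMod_hom_ext ?_
  exact (A.lin_comp_eq (A.trivialPointMap hA B hB t) _ h₁ h₂).trans (A.lin_comp_eq _ _ h₃ h₄).symm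

end EquivariantAQFT

/-! ### Non-truncated theories -/

section Separator

variable (K : Type u) [Field K] (G : Type u) [Group G]

/-- The representation of `G` on the functions `G → K` by left translation. -/
def leftTranslation : Representation K G (G → K) where
  toFun g := LinearMap.funLeft K K fun a => g⁻¹ * a
  map_one' := by ext; simp [LinearMap.funLeft]
  map_mul' g h := by ext; simp [LinearMap.funLeft, mul_assoc]

/-- The right translation by `g`, an endomorphism of the representation by left translations. -/
def rightTranslation (g : G) :
    Rep.of (leftTranslation K G) ⟶ Rep.of (leftTranslation K G) :=
  Rep.ofHom
    { toLinearMap := LinearMap.funLeft K K fun a => a * g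
      isIntertwining' := fun h => by
        ext
        simp [LinearMap.funLeft, leftTranslation, mul_assoc] }

/-- The trivial representation only sees invariants, so it does not separate the right translations
from the identity: the functions which are invariant under left translations are constant. -/
lemma not_isSeparator_trivial [Nontrivial G] : ¬ IsSeparator (Rep.trivial K G K) := by
  intro h
  obtain ⟨g, hg⟩ := exists_ne (1 : G)
  have h₁ : rightTranslation K G g = 𝟙 _ := h.def _ _ fun (f : Rep.trivial K G K ⟶ _) => by
    ext : 1
    refine Representation.IntertwiningMap.ext (LinearMap.ext fun k => funext fun a => ?_)
    have h₂ : f.hom k = leftTranslation K G (a * g * a⁻¹) (f.hom k) :=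
      Rep.hom_comm_apply f (a * g * a⁻¹) k
    -- `f k` is invariant; translating by `a * g * a⁻¹` compares its values at `a * g` and at `a`.
    refine (congrFun h₂ (a * g)).trans (congrArg (f.hom k) ?_)
    group
  classical
  have h₂ : (rightTranslation K G g).hom (Pi.single 1 1) (1 : G) = (Pi.single 1 1 : G → K) 1 := by
    rw [h₁]
    rfl
  have h₃ : (Pi.single 1 1 : G → K) (1 * g) = (Pi.single 1 1 : G → K) 1 := h₂
  simp [hg] at h₃

end Separator

section General

variable {D : Type*} [Category* D]

lemma isSeparator_of_iso {P Q : D} (e : P ≅ Q) (h : IsSeparator P) : IsSeparator Q :=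
  (isSeparator_def Q).2 fun X Y f g hfg => h.def _ _ fun k => by
    have := e.hom ≫= hfg (e.inv ≫ k)
    simpa using this

end General

section PointMap

variable {K : Type u} [Field K] {C : Type w} [Category.{v} C] {O : Orthogonality C}
  {X Y : TwoAQFTData.{v, w, u} K O}

/-- The comparison of pointings is an isomorphism since its first factor is the image of a morphism
between families with empty index type. -/
instance (ζ : PreHom X Y) (t : C) : IsIso (ζ.pointMap t) := by
  have h : IsIso (C := ∀ i : Empty, Y.obj i.elim) (X := fun i => i.elim)
      (Y := fun i => (ζ.app _).obj i.elim) (fun i => i.elim) :=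
    ⟨fun i => i.elim, funext fun i => i.elim, funext fun i => i.elim⟩
  have h₁ := @Functor.map_isIso _ _ _ _ _ _ (Y.prod (Op.empty O t)) _ h
  have h₂ := NatIso.isIso_app_of_isIso (ζ.coh (Op.empty O t)).hom fun i => i.elim
  exact IsIso.comp_isIso' h₁ h₂

/-- An equivalence preserves the property of the pointing to be a separator. -/
lemma Hom.IsEquivalence.isSeparator_point {ζ : Hom X Y} (hζ : ζ.IsEquivalence) (t : C)
    (h : IsSeparator (X.point t)) : IsSeparator (Y.point t) := by
  obtain ⟨ξ, ⟨α⟩, ⟨β⟩⟩ := hζ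
  exact isSeparator_of_iso (asIso (ζ.pointMap t)).symm
    (h.of_equivalence (CategoryTheory.Equivalence.mk (ζ.app t) (ξ.app t) (α.iso t).symm (β.iso t)))

end PointMap

namespace AQFT

variable {K : Type u} [Field K] {C : Type w} [Category.{v} C] {O : Orthogonality C}
  (B : AQFT.{v, w, u} K O)

/-- The pointing of `ι(𝔅)(t)` is the free module of rank one. -/
lemma isSeparator_inclusion_point (t : C) : IsSeparator ((inclusion B).point t) := by
  refine (isSeparator_def (EquivariantAQFT.inclusionPoint B t)).2 fun V W f g hfg => ?_
  ext v
  -- Test on the morphism which sends the generator to `v`.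
  have h := hfg (modLift (φ := fun i => (B.obj.map ((Op.empty O t).hom i)).hom) (fun _ => v)
    (fun _ i => i.elim) (fun _ i => i.elim))
  have h₁ := modLift_gen (φ := fun i => (B.obj.map ((Op.empty O t).hom i)).hom)
    (V := fun i => i.elim) (fun _ => v) (fun _ i => i.elim) (fun _ i => i.elim) fun i => i.elim
  have h₂ := LinearMap.congr_fun (congrArg ModuleCat.Hom.hom h)
    (EquivariantAQFT.inclusionPointGen B t)
  exact (congrArg f.hom h₁).symm.trans (h₂.trans (congrArg g.hom h₁))

end AQFT

namespace EquivariantAQFT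

variable {K : Type u} [Field K] {C : Type w} [Category.{v} C] {O : Orthogonality C}
  {G : Type u} [Group G] (A : EquivariantAQFT.{v, w, u} K O G)

/-- The gauging of a one-dimensional theory by a nontrivial group is not equivalent to any theory in
the image of the inclusion, because its pointings, the trivial representations, are not
separators. -/
lemma not_isEquivalence_of_oneDimensional
    (hA : ∀ c, Function.Bijective (algebraMap K (A.aqft.obj.obj c))) [Nonempty C] [Nontrivial G]
    (B : AQFT.{v, w, u} K O) (ζ : Hom (AQFT.inclusion B) A.gauging) : ¬ ζ.IsEquivalence := by
  intro hζ
  obtain ⟨t⟩ := ‹Nonempty C›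
  have h₁ := hζ.isSeparator_point t (B.isSeparator_inclusion_point t)
  have : (A.toRep t).IsEquivalence := EqMod.forgetRep_isEquivalence (hA t)
  exact not_isSeparator_trivial K G (isSeparator_of_iso (A.pointIso hA t)
    (h₁.of_equivalence (A.toRep t).asEquivalence))

end EquivariantAQFT

end TwoCatAQFT

theorem mainTheorem6 {K : Type u} [Field K] [CharZero K] {C : Type w} [Category.{v} C]
    [Nonempty C] (O : TwoCatAQFT.Orthogonality C) (G : Type u) [Group G] [Finite G] :
    ∃ h : TwoCatAQFT.IsTwoAQFT (TwoCatAQFT.trivialEquivariantAQFT K O G).gauging,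
      (∀ c : C, ((TwoCatAQFT.trivialEquivariantAQFT K O G).toRep c).IsEquivalence ∧
        ((TwoCatAQFT.trivialEquivariantAQFT K O G).toRep c).Additive ∧
        ((TwoCatAQFT.trivialEquivariantAQFT K O G).toRep c).Linear K) ∧
      (∀ (I : Type) [Finite I] (c : I → C) (t : C) (f : TwoCatAQFT.Op O c t),
        ∃ e : (TwoCatAQFT.trivialEquivariantAQFT K O G).gauging.prod f ⋙
              (TwoCatAQFT.trivialEquivariantAQFT K O G).toRep t ≅
            Functor.pi (fun i => (TwoCatAQFT.trivialEquivariantAQFT K O G).toRep (c i)) ⋙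
              TwoCatAQFT.repTensor K G I,
          ∀ (V : ∀ i, (TwoCatAQFT.trivialEquivariantAQFT K O G).gauging.obj (c i))
            (v : ∀ i, ((TwoCatAQFT.trivialEquivariantAQFT K O G).toRep (c i)).obj (V i)),
            (e.hom.app V).hom
                ((TwoCatAQFT.trivialEquivariantAQFT K O G).gaugingGen f V v) =
              PiTensorProduct.tprod K v) ∧
      (∀ t : C, Nonempty (((TwoCatAQFT.trivialEquivariantAQFT K O G).toRep t).obj
          ((TwoCatAQFT.trivialEquivariantAQFT K O G).gauging.point t) ≅
            Rep.trivial K G K)) ∧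
      Nonempty (TwoCatAQFT.truncation ⟨_, h⟩ ≅
        (TwoCatAQFT.trivialEquivariantAQFT K O G).orbifold) ∧
      Nonempty ((TwoCatAQFT.trivialEquivariantAQFT K O G).orbifold ≅
        TwoCatAQFT.trivialAQFT K O) ∧
      (∃ ε : TwoCatAQFT.Hom (TwoCatAQFT.AQFT.inclusion (TwoCatAQFT.truncation ⟨_, h⟩))
          (TwoCatAQFT.trivialEquivariantAQFT K O G).gauging, TwoCatAQFT.IsCounit ⟨_, h⟩ ε) ∧
      (Nontrivial G →
        ¬ TwoCatAQFT.IsTruncated ⟨_, h⟩ ∧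
        ∀ (A : TwoCatAQFT.AQFT.{v, w, u} K O)
          (ζ : TwoCatAQFT.Hom (TwoCatAQFT.AQFT.inclusion A)
            (TwoCatAQFT.trivialEquivariantAQFT K O G).gauging),
          ¬ ζ.IsEquivalence) := by
  let A := TwoCatAQFT.trivialEquivariantAQFT.{v, w, u} K O G
  have hA : ∀ c, Function.Bijective (algebraMap K (A.aqft.obj.obj c)) :=
    TwoCatAQFT.bijective_algebraMap_trivialAQFT O
  refine ⟨A.gauging_isTwoAQFT hA, fun c => ⟨TwoCatAQFT.EqMod.forgetRep_isEquivalence (hA c),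
    TwoCatAQFT.EqMod.forgetRep_additive, TwoCatAQFT.EqMod.forgetRep_linear⟩,
    fun I _ c t f => ⟨A.prodIsoRepTensor hA f, fun V v => A.prodEquiv_gen hA f V v⟩,
    fun t => ⟨A.pointIso hA t⟩, ⟨TwoCatAQFT.AQFT.isoOfOneDimensional _ _
      (A.bijective_algebraMap_truncation hA) (A.bijective_algebraMap_orbifold hA)⟩,
    ⟨TwoCatAQFT.AQFT.isoOfOneDimensional _ _ (A.bijective_algebraMap_orbifold hA) hA⟩,
    ⟨_, A.isCounit_trivialHom hA⟩, fun _ => ⟨?_, A.not_isEquivalence_of_oneDimensional hA⟩⟩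
  rintro ⟨ε, _, hε⟩
  exact A.not_isEquivalence_of_oneDimensional hA _ ε hε
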